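/- Let $k$ be a field of characteristic $0$. For $n\ge 0$ let $B_n$ be the braid group on $n$ strands, with generators $\sigma_1,\dots,\sigma_{n-1}$ ($B_0,B_1$ trivial). The profinite braided associative operad $\widehat{\mathrm{BrAss}}$ is the braided operad in pro-vector spaces over $k$ whose $n$th term is the inverse system $\{k[B_n/N]\}_N$, where $N$ runs over the finite index normal subgroups of $B_n$; its right $B_n$-action is right multiplication, its compositions $\circ_i$ are induced by the cabling maps $\circ_i: B_m\times B_n\to B_{m+n-1}$, and its unit is $1\in k[B_1]$. An element $\alpha\in\widehat{\mathrm{BrAss}}(n)$ is an element of $\varprojlim_N k[B_n/N]$. For $p+q=n$ let $\mathfrak S_{p,q}=\sum_\tau\tilde\tau\in k[B_n]$, where $\tau\in S_n$ runs over the inverses of $(p,q)$-shuffles (permutations increasing on $\{1,\dots,p\}$ and on $\{p+1,\dots,n\}$) and $\tilde\tau\in B_n$ is the Matsumoto lift: write $\tau$ as a minimal length product of adjacent transpositions $(i,i+1)$ and replace each by $\sigma_i$. Let $\mathrm{BrPrim}_*\le\widehat{\mathrm{BrAss}}$ be the levelwise family of subspaces with $$\mathrm{BrPrim}_*(0)=0,\qquad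 \mathrm{BrPrim}_*(1)=k\cdot 1,\qquad \mathrm{BrPrim}_*(n)=\bigcap_{p+q=n,\ p,q>0}\ker\big(\mathfrak S_{p,q}\cdot:\widehat{\mathrm{BrAss}}(n)\to\widehat{\mathrm{BrAss}}(n)\big)\quad(n>1).$$ A braided Hopf algebra over $k$ (in the sense of Takeuchi) is a vector space $A$ with an automorphism $\sigma$ of $A\otimes A$ satisfying the braid equation, a unital associative algebra structure and a counital coassociative coalgebra structure which all commute with $\sigma$, such that $\Delta$ and $\epsilon$ are algebra maps (with $A\otimes A$ carrying the product $(\mu\otimes\mu)(\mathrm{id}\otimes\sigma\otimes\mathrm{id})$), and an antipode. It is finitely braided if, for every $n$, the action of $B_n$ on $A^{\otimes n}$, $\sigma_i\mapsto \mathrm{id}^{\otimes i-1}\otimes\sigma\otimes\mathrm{id}^{\otimes n-i-1}$, factors through a finite quotient of $B_n$. In this case, for $\alpha\in\widehat{\mathrm{BrAss}}(n)$ and $a_1,\dots,a_n\in A$, the element $\alpha(a_1,\dots,a_n)\in A$ is obtained by letting $\alpha$ act on $a_1\otimes\cdots\otimes a_n$ through such a quotient and applying the $n$-fold multiplication $A^{\otimes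 n}\to A$. Write $P(A)=\{x\in A:\Delta(x)=x\otimes1+1\otimes x\}$. **Theorem.** 1. For every $n\ge0$, an element $\alpha\in\widehat{\mathrm{BrAss}}(n)$ lies in $\mathrm{BrPrim}_*(n)$ if and only if for every finitely braided Hopf algebra $A$ over $k$ and all $a_1,\dots,a_n\in P(A)$ one has $\alpha(a_1,\dots,a_n)\in P(A)$. 2. $\mathrm{BrPrim}_*$ is a reduced, unital, strict suboperad of $\widehat{\mathrm{BrAss}}$. That is: it is compatible with the transition maps $k[B_n/N]\to k[B_n/N']$ and stable under the right actions of the groups $B_n$; each composition $\circ_i$, as a morphism of pro-vector spaces, restricts to it; $\mathrm{BrPrim}_*(0)=0$; it contains the unit $1\in k[B_1]$; and the transition maps $\mathrm{BrPrim}_*(n)_N\to\mathrm{BrPrim}_*(n)_{N'}$ ($N\subseteq N'$) are surjective. -/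

import Mathlib

open scoped TensorProduct

namespace BraidedPrimitive

/-! ## Braid groups -/

/-- The defining relations of the braid group on `n` strands, in the generators
`σ_0, …, σ_{n-2}`. -/
def braidRels (n : ℕ) : Set (FreeGroup (Fin (n - 1))) :=
  {r | (∃ i j : Fin (n - 1), (i : ℕ) + 1 = j ∧
        r = (.of i * .of j * .of i) * (.of j * .of i * .of j : FreeGroup (Fin (n - 1)))⁻¹) ∨
      (∃ i j : Fin (n - 1), (i : ℕ) + 1 < j ∧
        r = (.of i * .of j) * (.of j * .of i : FreeGroup (Fin (n - 1)))⁻¹)}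

/-- The braid group `B_n`. -/
abbrev BraidGroup (n : ℕ) : Type := PresentedGroup (braidRels n)

/-- The generator of `B_n` crossing the strands in positions `j` and `j + 1`, where positions are
numbered `0, …, n - 1` (and `1` if there are no such positions). -/
def gen (n j : ℕ) : BraidGroup n :=
  if h : j < n - 1 then PresentedGroup.of ⟨j, h⟩ else 1

theorem gen_of {n : ℕ} (j : Fin (n - 1)) : gen n j = PresentedGroup.of j := by
  simp [gen]

theorem gen_braid {n j : ℕ} (h : j + 2 < n) :
    gen n j * gen n (j + 1) * gen n j = gen n (j + 1) * gen n j * gen n (j + 1) := by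
  have h1 : j < n - 1 := by omega
  have h2 : j + 1 < n - 1 := by omega
  simp only [gen, h1, h2, dif_pos]
  exact PresentedGroup.mk_eq_mk_of_mul_inv_mem (Or.inl ⟨⟨j, h1⟩, ⟨j + 1, h2⟩, rfl, rfl⟩)

theorem gen_comm {n i j : ℕ} (h : i + 1 < j) : gen n i * gen n j = gen n j * gen n i := by
  by_cases h2 : j < n - 1
  · have h1 : i < n - 1 := by omega
    simp only [gen, h1, h2, dif_pos]
    exact PresentedGroup.mk_eq_mk_of_mul_inv_mem (Or.inr ⟨⟨i, h1⟩, ⟨j, h2⟩, h, rfl⟩)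
  · simp [gen, h2]

/-- A homomorphism out of the braid group is given by images of the generators satisfying the
braid relations. -/
def braidLift {G : Type*} [Group G] (n : ℕ) (f : ℕ → G)
    (hb : ∀ j, j + 2 < n → f j * f (j + 1) * f j = f (j + 1) * f j * f (j + 1))
    (hc : ∀ i j, i + 1 < j → j + 1 < n → f i * f j = f j * f i) : BraidGroup n →* G :=
  PresentedGroup.toGroup (f := fun j : Fin (n - 1) => f j) (by
    rintro r (⟨i, j, h, rfl⟩ | ⟨i, j, h, rfl⟩)
    · have := hb i (by have := j.2; omega)
      simp only [map_mul, map_inv, FreeGroup.lift_apply_of, mul_inv_eq_one, ← h]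
      exact this
    · have := hc i j h (by have := j.2; omega)
      simp only [map_mul, map_inv, FreeGroup.lift_apply_of, mul_inv_eq_one]
      exact this)

theorem braidLift_gen {G : Type*} [Group G] (n : ℕ) (f : ℕ → G)
    (hb : ∀ j, j + 2 < n → f j * f (j + 1) * f j = f (j + 1) * f j * f (j + 1))
    (hc : ∀ i j, i + 1 < j → j + 1 < n → f i * f j = f j * f i) {j : ℕ} (hj : j + 1 < n) :
    braidLift n f hb hc (gen n j) = f j := by
  have h1 : j < n - 1 := by omega
  simp only [gen, h1, dif_pos, braidLift]
  exact PresentedGroup.toGroup.of _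

/-- The adjacent transposition of the positions `j` and `j + 1`. -/
def adj (n j : ℕ) : Equiv.Perm (Fin n) :=
  if h : j + 1 < n then Equiv.swap ⟨j, by omega⟩ ⟨j + 1, h⟩ else 1

theorem adj_inv (m j : ℕ) : (adj m j)⁻¹ = adj m j := by
  unfold adj
  split_ifs <;> simp

theorem adj_val {n j : ℕ} (h : j + 1 < n) (x : Fin n) :
    ((adj n j x : Fin n) : ℕ) = if (x : ℕ) = j then j + 1 else if (x : ℕ) = j + 1 then j else x := by
  simp only [adj, h, dif_pos, Equiv.swap_apply_def, Fin.ext_iff]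
  split_ifs <;> rfl

theorem adj_braid {n j : ℕ} (h : j + 2 < n) :
    adj n j * adj n (j + 1) * adj n j = adj n (j + 1) * adj n j * adj n (j + 1) := by
  have h1 : j + 1 < n := by omega
  have h2 : j + 1 + 1 < n := by omega
  ext x
  simp only [Equiv.Perm.mul_apply, adj_val h1, adj_val h2]
  split_ifs <;> omega

theorem adj_comm {n i j : ℕ} (h : i + 1 < j) (hj : j + 1 < n) :
    adj n i * adj n j = adj n j * adj n i := by
  have h1 : i + 1 < n := by omega
  ext x
  simp only [Equiv.Perm.mul_apply, adj_val h1, adj_val hj]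
  split_ifs <;> omega

/-- The projection `B_n → S_n`. -/
def toPerm (n : ℕ) : BraidGroup n →* Equiv.Perm (Fin n) :=
  braidLift n (adj n) (fun _ h => adj_braid h) (fun _ _ h hj => adj_comm h hj)

theorem toPerm_gen {n j : ℕ} (h : j + 1 < n) : toPerm n (gen n j) = adj n j :=
  braidLift_gen _ _ _ _ h

/-! ## Matsumoto lifts and the elements `𝔖_{p,q}` -/

/-- The number of values `u < v` which form an inversion of `τ` with the value `v`. -/
def invCount {n : ℕ} (τ : Equiv.Perm (Fin n)) (v : Fin n) : ℕ :=
  (Finset.univ.filter fun u : Fin n => u < v ∧ τ.symm v < τ.symm u).card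

/-- A word of minimal length in the adjacent transpositions whose product is `τ` (see
`prod_reducedWord` and `length_reducedWord_le`). -/
def reducedWord {n : ℕ} (τ : Equiv.Perm (Fin n)) : List ℕ :=
  (List.finRange n).flatMap fun v =>
    (List.range (invCount τ v)).map fun t => (v : ℕ) - 1 - t

theorem card_val_lt {n v : ℕ} (hv : v ≤ n) :
    (Finset.univ.filter fun w : Fin n => (w : ℕ) < v).card = v := by
  have : (Finset.univ.filter fun w : Fin n => (w : ℕ) < v).map Fin.valEmbedding =
      Finset.range v := by
    ext x
    simp only [Finset.mem_map, Finset.mem_filter, Finset.mem_univ, true_and, Finset.mem_range,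
      Fin.valEmbedding_apply]
    exact ⟨by rintro ⟨w, h, rfl⟩; exact h, fun h => ⟨⟨x, by omega⟩, h, rfl⟩⟩
  rw [← Finset.card_map, this, Finset.card_range]

theorem invCount_le {n : ℕ} (τ : Equiv.Perm (Fin n)) (v : Fin n) : invCount τ v ≤ v := by
  refine (Finset.card_le_card (t := Finset.univ.filter fun u : Fin n => u < v) ?_).trans ?_
  · intro u; simp +contextual
  · exact (card_val_lt v.2.le).le

theorem chain_val {n : ℕ} {v : ℕ} (hv : v < n) (c : ℕ) (hc : c ≤ v) (x : Fin n) :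
    (((((List.range c).map fun t => v - 1 - t).map (adj n)).prod x : Fin n) : ℕ) =
      if (x : ℕ) < v - c then (x : ℕ) else if (x : ℕ) = v - c then v
      else if (x : ℕ) ≤ v then (x : ℕ) - 1 else x := by
  induction c generalizing x with
  | zero => simp; split_ifs <;> omega
  | succ c ih =>
    rw [List.range_succ, List.map_append, List.map_append, List.prod_append,
      Equiv.Perm.mul_apply, ih (by omega)]
    simp only [List.map_cons, List.map_nil, List.prod_cons, List.prod_nil, mul_one]
    rw [adj_val (by omega)]
    split_ifs <;> omega

theorem prod_reducedWord {n : ℕ} (τ : Equiv.Perm (Fin n)) :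
    ((reducedWord τ).map (adj n)).prod = τ := by
  let g : ℕ → List ℕ := fun v =>
    if h : v < n then (List.range (invCount τ ⟨v, h⟩)).map fun t => v - 1 - t else []
  have hg : reducedWord τ = (List.range n).flatMap g := by
    rw [← List.map_coe_finRange_eq_range, List.flatMap_map]
    simp [reducedWord, g]
  let r : ℕ → Fin n → ℕ := fun v u =>
    (Finset.univ.filter fun w : Fin n => (w : ℕ) < v ∧ τ.symm w < τ.symm u).card
  have key : ∀ v ≤ n, (∀ x : Fin n, v ≤ x → (((List.range v).flatMap g).map (adj n)).prod x = x) ∧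
      ∀ u x : Fin n, (u : ℕ) < v → (x : ℕ) = r v u →
        (((List.range v).flatMap g).map (adj n)).prod x = u := by
    intro v
    induction v with
    | zero => simp
    | succ v ih =>
      intro hv
      obtain ⟨ihA, ihB⟩ := ih (by omega)
      have hvn : v < n := hv
      set c := invCount τ ⟨v, hvn⟩ with hc
      have hcv : c ≤ v := invCount_le τ ⟨v, hvn⟩
      have hgv : g v = (List.range c).map fun t => v - 1 - t := by simp [g, hvn, hc]
      have hval := chain_val hvn c hcv
      have hP : (((List.range (v + 1)).flatMap g).map (adj n)).prod =
          (((List.range v).flatMap g).map (adj n)).prod *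
            (((List.range c).map fun t => v - 1 - t).map (adj n)).prod := by
        rw [List.range_succ, List.flatMap_append, List.map_append, List.prod_append]
        simp [hgv]
      rw [hP]
      simp only [Equiv.Perm.mul_apply]
      set C := (((List.range c).map fun t => v - 1 - t).map (adj n)).prod
      -- splitting the values below `v` according to their position relative to `u`
      have split : ∀ u : Fin n, r (v + 1) u = r v u +
          if τ.symm ⟨v, hvn⟩ < τ.symm u then 1 else 0 := by
        intro u
        simp only [r]
        rw [← Finset.card_filter_add_card_filter_not (s := Finset.univ.filter fun w : Fin n =>
          (w : ℕ) < v + 1 ∧ τ.symm w < τ.symm u) (fun w : Fin n => (w : ℕ) < v)]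
        congr 1
        · congr 1; ext w
          simp only [Finset.mem_filter, Finset.mem_univ, true_and]
          constructor
          · rintro ⟨⟨_, h2⟩, h3⟩; exact ⟨h3, h2⟩
          · rintro ⟨h1, h2⟩; exact ⟨⟨by omega, h2⟩, h1⟩
        · split_ifs with h
          · rw [Finset.card_eq_one]
            refine ⟨⟨v, hvn⟩, ?_⟩
            ext w
            simp only [Finset.mem_filter, Finset.mem_univ, true_and, Finset.mem_singleton]
            constructor
            · rintro ⟨⟨h1, _⟩, h3⟩; exact Fin.ext (by simp; omega)
            · rintro rfl; exact ⟨⟨by simp, h⟩, by simp⟩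
          · rw [Finset.card_eq_zero, Finset.filter_eq_empty_iff]
            intro w hw h3
            simp only [Finset.mem_filter, Finset.mem_univ, true_and] at hw
            have : w = ⟨v, hvn⟩ := Fin.ext (by simp; omega)
            subst this
            exact h hw.2
      have total : r v ⟨v, hvn⟩ + c = v := by
        have h1 : (Finset.univ.filter fun w : Fin n => (w : ℕ) < v).card = v := by
          exact card_val_lt hvn.le
        rw [hc, invCount]
        simp only [r]
        rw [← Finset.card_union_of_disjoint]
        · conv_rhs => rw [← h1]
          congr 1; ext w
          simp only [Finset.mem_union, Finset.mem_filter, Finset.mem_univ, true_and, Fin.lt_def]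
          constructor
          · rintro (h | h) <;> exact h.1
          · intro h
            have hne : τ.symm w ≠ τ.symm ⟨v, hvn⟩ := by
              intro e; have := τ.symm.injective e; subst this; simp at h
            have hne' : ((τ.symm w : Fin n) : ℕ) ≠ (τ.symm ⟨v, hvn⟩ : Fin n) :=
              fun e => hne (Fin.ext e)
            rcases lt_or_gt_of_ne hne' with h' | h'
            · exact Or.inl ⟨h, h'⟩
            · exact Or.inr ⟨h, h'⟩
        · rw [Finset.disjoint_left]
          intro w h1 h2
          simp only [Finset.mem_filter, Finset.mem_univ, true_and] at h1 h2
          exact absurd h1.2 (lt_asymm h2.2)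
      refine ⟨fun x hx => ?_, fun u x hu hx => ?_⟩
      · have : C x = x := Fin.ext (by rw [hval]; split_ifs <;> omega)
        rw [this]; exact ihA x (by omega)
      · rw [split] at hx
        rcases Nat.lt_or_ge u v with huv | huv
        · by_cases h : τ.symm ⟨v, hvn⟩ < τ.symm u
          · have hle : r v ⟨v, hvn⟩ ≤ r v u := by
              apply Finset.card_le_card
              intro w hw
              simp only [Finset.mem_filter, Finset.mem_univ, true_and] at hw ⊢
              exact ⟨hw.1, hw.2.trans h⟩
            have hlt : r v u < v := by
              have h1 : (Finset.univ.filter fun w : Fin n => (w : ℕ) < v).card = v := by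
                exact card_val_lt hvn.le
              conv_rhs => rw [← h1]
              apply Finset.card_lt_card
              rw [Finset.ssubset_iff_of_subset]
              · exact ⟨u, by simpa using huv, by simp⟩
              · intro w; simp +contextual
            rw [if_pos h] at hx
            refine ihB u (C x) huv ?_
            rw [hval]
            split_ifs <;> omega
          · have hne : τ.symm u ≠ τ.symm ⟨v, hvn⟩ := by
              intro e; have := τ.symm.injective e; subst this; simp at huv
            have h' : τ.symm u < τ.symm ⟨v, hvn⟩ := lt_of_le_of_ne (not_lt.1 h) hne
            have hlt : r v u < r v ⟨v, hvn⟩ := by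
              apply Finset.card_lt_card
              rw [Finset.ssubset_iff_of_subset]
              · exact ⟨u, by simpa using ⟨huv, h'⟩, by simp⟩
              · intro w hw
                simp only [Finset.mem_filter, Finset.mem_univ, true_and] at hw ⊢
                exact ⟨hw.1, hw.2.trans h'⟩
            rw [if_neg h] at hx
            refine ihB u (C x) huv ?_
            rw [hval]
            split_ifs <;> omega
        · have hu' : u = ⟨v, hvn⟩ := Fin.ext (by simp; omega)
          subst hu'
          simp only [lt_irrefl, if_false] at hx
          have : C x = ⟨v, hvn⟩ := Fin.ext (by rw [hval]; simp only; split_ifs <;> omega)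
          rw [this]; exact ihA _ (by simp)
  rw [hg]
  ext1 y
  refine (key n le_rfl).2 (τ y) y (τ y).2 ?_
  have : (Finset.univ.filter fun w : Fin n => (w : ℕ) < n ∧ τ.symm w < τ.symm (τ y)).card =
      (Finset.univ.filter fun z : Fin n => z < y).card := by
    apply Finset.card_equiv τ.symm
    intro w; simp
  exact (this.trans (card_val_lt y.2.le)).symm

theorem length_reducedWord {n : ℕ} (τ : Equiv.Perm (Fin n)) :
    (reducedWord τ).length =
      (Finset.univ.filter fun x : Fin n × Fin n => x.1 < x.2 ∧ τ.symm x.2 < τ.symm x.1).card := by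
  rw [Finset.card_filter, Fintype.sum_prod_type_right]
  simp only [reducedWord, List.length_flatMap, List.length_map, List.length_range, invCount,
    Finset.card_filter, ← Fin.sum_univ_def]

theorem length_reducedWord_le {n : ℕ} (τ : Equiv.Perm (Fin n)) (w : List ℕ)
    (hw : (w.map (adj n)).prod = τ) : (reducedWord τ).length ≤ w.length := by
  induction w generalizing τ with
  | nil =>
    subst hw
    rw [length_reducedWord, List.length_nil, Nat.le_zero, Finset.card_eq_zero,
      Finset.filter_eq_empty_iff]
    rintro ⟨u, v⟩ - ⟨h1, h2⟩
    exact lt_asymm h1 h2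
  | cons j w ih =>
    have h := ih _ rfl
    set τ' := (w.map (adj n)).prod
    have hτ : τ = adj n j * τ' := by rw [← hw]; simp [τ']
    rw [List.length_cons]
    refine le_trans ?_ (Nat.add_le_add_right h 1)
    by_cases hj : j + 1 < n
    · rw [length_reducedWord, length_reducedWord]
      have hs : ∀ x, τ.symm x = τ'.symm (adj n j x) := by
        intro x
        have : τ⁻¹ x = (τ'⁻¹ * (adj n j)⁻¹) x := by rw [hτ, mul_inv_rev]
        rw [adj_inv] at this
        exact this
      have hinv : ∀ x, adj n j (adj n j x) = x := by
        intro x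
        have : adj n j * adj n j = 1 := mul_eq_one_iff_eq_inv.2 (adj_inv n j).symm
        rw [← Equiv.Perm.mul_apply, this, Equiv.Perm.one_apply]
      refine le_trans (Finset.card_le_card (t := insert
        ((⟨j, by omega⟩ : Fin n), (⟨j + 1, hj⟩ : Fin n)) ((Finset.univ.filter fun x : Fin n × Fin n =>
          x.1 < x.2 ∧ τ'.symm x.2 < τ'.symm x.1).map
            ((adj n j).prodCongr (adj n j)).toEmbedding)) ?_) ?_
      · rintro ⟨u, v⟩ hx
        simp only [Finset.mem_filter, Finset.mem_univ, true_and, hs] at hx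
        rw [Finset.mem_insert, Finset.mem_map]
        by_cases hc : (u : ℕ) = j ∧ (v : ℕ) = j + 1
        · left; exact Prod.ext (Fin.ext hc.1) (Fin.ext hc.2)
        · right
          refine ⟨(adj n j u, adj n j v), ?_, by simp [hinv]⟩
          simp only [Finset.mem_filter, Finset.mem_univ, true_and]
          refine ⟨?_, hx.2⟩
          have h1 : (u : ℕ) < v := hx.1
          rw [Fin.lt_def, adj_val hj, adj_val hj]
          split_ifs <;> omega
      · refine (Finset.card_insert_le _ _).trans ?_
        rw [Finset.card_map]
    · have : adj n j = 1 := by simp [adj, hj]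
      rw [hτ, this, one_mul]
      omega

/-- The Matsumoto lift `τ ↦ τ̃` of a permutation to the braid group: replace every adjacent
transposition in a minimal length word for `τ` by the corresponding generator of `B_n`. -/
def matsumotoLift {n : ℕ} (τ : Equiv.Perm (Fin n)) : BraidGroup n :=
  ((reducedWord τ).map (gen n)).prod

/-- The inverses of `(p, n - p)`-shuffles, i.e. of permutations which are increasing on the first
`p` positions and on the last `n - p` positions. -/
def IsUnshuffle {n : ℕ} (p : ℕ) (τ : Equiv.Perm (Fin n)) : Prop :=
  ∀ i j : Fin n, i < j → ((j : ℕ) < p ∨ p ≤ (i : ℕ)) → τ.symm i < τ.symm j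

open Classical in
/-- The element `𝔖_{p,q} ∈ k[B_n]`, where `p + q = n`: the sum of the Matsumoto lifts of all
`(p,q)`-unshuffles. -/
noncomputable def shuffleSum (k : Type*) [Field k] (n p : ℕ) : MonoidAlgebra k (BraidGroup n) :=
  ∑ τ : Equiv.Perm (Fin n) with IsUnshuffle p τ, MonoidAlgebra.of k _ (matsumotoLift τ)

/-! ## Cabling -/

/-- The braid on `N` strands moving `n` parallel strands, which start in positions
`j, …, j + n - 1`, past the strand in position `j + n`. -/
def fatLeft (N n j : ℕ) : BraidGroup N := ((List.range n).map fun t => gen N (j + t)).prod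

/-- The braid on `N` strands moving the strand in position `j` past `n` parallel strands in
positions `j + 1, …, j + n`. -/
def fatRight (N n j : ℕ) : BraidGroup N :=
  ((List.range n).map fun t => gen N (j + (n - 1 - t))).prod

theorem fatLeft_zero (N j : ℕ) : fatLeft N 0 j = 1 := rfl
theorem fatRight_zero (N j : ℕ) : fatRight N 0 j = 1 := rfl

theorem fatLeft_succ (N n j : ℕ) : fatLeft N (n + 1) j = fatLeft N n j * gen N (j + n) := by
  simp [fatLeft, List.range_succ]

theorem fatRight_succ (N n j : ℕ) : fatRight N (n + 1) j = gen N (j + n) * fatRight N n j := by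
  simp only [fatRight, List.range_succ_eq_map, List.map_cons, List.prod_cons, List.map_map]
  congr 3
  funext t
  simp only [Function.comp]
  congr 1
  omega

theorem fatLeft_comm_of_lt (N n : ℕ) {i j : ℕ} (h : i + 1 < j) :
    gen N i * fatLeft N n j = fatLeft N n j * gen N i := by
  induction n with
  | zero => simp [fatLeft_zero]
  | succ n ih =>
    rw [fatLeft_succ, ← mul_assoc, ih, mul_assoc, mul_assoc, gen_comm (by omega)]

theorem fatLeft_comm_of_gt (N n : ℕ) {i j : ℕ} (h : j + n < i) :
    gen N i * fatLeft N n j = fatLeft N n j * gen N i := by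
  induction n with
  | zero => simp [fatLeft_zero]
  | succ n ih =>
    rw [fatLeft_succ, ← mul_assoc, ih (by omega), mul_assoc, mul_assoc,
      gen_comm (i := j + n) (by omega)]

theorem fatRight_comm_of_lt (N n : ℕ) {i j : ℕ} (h : i + 1 < j) :
    gen N i * fatRight N n j = fatRight N n j * gen N i := by
  induction n with
  | zero => simp [fatRight_zero]
  | succ n ih =>
    rw [fatRight_succ, mul_assoc, ← ih, ← mul_assoc, ← mul_assoc, gen_comm (by omega)]

theorem fatRight_comm_of_gt (N n : ℕ) {i j : ℕ} (h : j + n < i) :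
    gen N i * fatRight N n j = fatRight N n j * gen N i := by
  induction n with
  | zero => simp [fatRight_zero]
  | succ n ih =>
    rw [fatRight_succ, mul_assoc, ← ih (by omega), ← mul_assoc, ← mul_assoc,
      gen_comm (i := j + n) (by omega)]

theorem fatLeft_braid (N n j : ℕ) (h : j + n + 1 < N) :
    gen N j * (fatLeft N n (j + 1) * fatLeft N n j) =
      fatLeft N n (j + 1) * fatLeft N n j * gen N (j + n) := by
  induction n with
  | zero => simp [fatLeft_zero]
  | succ n ih =>
    have e : fatLeft N (n + 1) (j + 1) * fatLeft N (n + 1) j =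
        fatLeft N n (j + 1) * fatLeft N n j * (gen N (j + n + 1) * gen N (j + n)) := by
      rw [fatLeft_succ, fatLeft_succ, show j + 1 + n = j + n + 1 by omega]
      simp only [mul_assoc]
      rw [← mul_assoc (gen N (j + n + 1)), fatLeft_comm_of_gt N n (by omega)]
      simp only [mul_assoc]
    rw [e, ← mul_assoc, ih (by omega), mul_assoc, mul_assoc,
      ← mul_assoc (gen N (j + n)), gen_braid (by omega)]
    simp only [mul_assoc, Nat.add_assoc]

theorem fatRight_braid (N n j : ℕ) (h : j + n + 1 < N) :
    fatRight N n j * fatRight N n (j + 1) * gen N j =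
      gen N (j + n) * (fatRight N n j * fatRight N n (j + 1)) := by
  induction n with
  | zero => simp [fatRight_zero]
  | succ n ih =>
    have e : fatRight N (n + 1) j * fatRight N (n + 1) (j + 1) =
        gen N (j + n) * gen N (j + n + 1) * (fatRight N n j * fatRight N n (j + 1)) := by
      rw [fatRight_succ, fatRight_succ, show j + 1 + n = j + n + 1 by omega]
      simp only [mul_assoc]
      rw [← mul_assoc (fatRight N n j) (gen N (j + n + 1)),
        ← fatRight_comm_of_gt N n (i := j + n + 1) (by omega)]
      simp only [mul_assoc]
    rw [e, mul_assoc, ih (by omega), ← mul_assoc, ← mul_assoc, ← mul_assoc,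
      gen_braid (by omega)]
    simp only [mul_assoc, Nat.add_assoc]

theorem fat_braid (N n j : ℕ) (h : j + n + 1 < N) :
    fatLeft N n j * gen N (j + n) * fatRight N n j =
      fatRight N n (j + 1) * gen N j * fatLeft N n (j + 1) := by
  induction n with
  | zero => simp [fatLeft_zero, fatRight_zero]
  | succ n ih =>
    have c1 := fatLeft_comm_of_gt N n (j := j) (i := j + n + 1) (by omega)
    have c2 := fatRight_comm_of_gt N n (j := j) (i := j + n + 1) (by omega)
    calc fatLeft N (n + 1) j * gen N (j + (n + 1)) * fatRight N (n + 1) j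
        = fatLeft N n j * (gen N (j + n) * gen N (j + n + 1) * gen N (j + n)) *
            fatRight N n j := by
          rw [fatLeft_succ, fatRight_succ]; simp only [mul_assoc, Nat.add_assoc]
      _ = (fatLeft N n j * gen N (j + n + 1)) * gen N (j + n) *
            (gen N (j + n + 1) * fatRight N n j) := by
          rw [gen_braid (by omega)]; simp only [mul_assoc]
      _ = gen N (j + n + 1) * (fatLeft N n j * gen N (j + n) * fatRight N n j) *
            gen N (j + n + 1) := by
          rw [← c1, c2]; simp only [mul_assoc]
      _ = _ := by
          rw [ih (by omega), fatLeft_succ, fatRight_succ, show j + 1 + n = j + n + 1 by omega]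
          simp only [mul_assoc]

/-- The effect of the generator `σ_j` after the strand in position `i` has been replaced by `n`
parallel strands. -/
def block (N n j i : ℕ) : BraidGroup N :=
  if i = j then fatLeft N n j else if i = j + 1 then fatRight N n j
  else if i < j then gen N (j + n - 1) else gen N j

abbrev CableTarget (N m : ℕ) : Type :=
  (Fin m → BraidGroup N) ⋊[mulAutArrow] (Equiv.Perm (Fin m))

def cableGen (N m n j : ℕ) : CableTarget N m :=
  ⟨fun x => block N n j ((adj m j)⁻¹ x : Fin m), adj m j⟩

theorem mulAutArrow_app {N m : ℕ} (g : Equiv.Perm (Fin m)) (f : Fin m → BraidGroup N) (x : Fin m) :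
    (mulAutArrow g f : Fin m → BraidGroup N) x = f (g⁻¹ x) := rfl

theorem cableGen_braid {m n j : ℕ} (h : j + 2 < m) :
    cableGen (m + n - 1) m n j * cableGen (m + n - 1) m n (j + 1) * cableGen (m + n - 1) m n j =
      cableGen (m + n - 1) m n (j + 1) * cableGen (m + n - 1) m n j *
        cableGen (m + n - 1) m n (j + 1) := by
  have h1 : j + 1 < m := by omega
  have h2 : j + 1 + 1 < m := by omega
  have f1 : j + 1 + 1 ≠ j := by omega
  have f2 : j ≠ j + 1 + 1 := by omega
  have f3 : ¬ j + 1 + 1 < j := by omega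
  ext x
  · obtain ⟨x, hx⟩ := x
    simp only [cableGen, SemidirectProduct.mul_left, SemidirectProduct.mul_right, Pi.mul_apply,
      mulAutArrow_app, adj_inv, mul_inv_rev, Equiv.Perm.mul_apply, adj_val h1, adj_val h2, block]
    rcases lt_or_ge x j with hxj | hxj
    · have a1 : x ≠ j := by omega
      have a2 : x ≠ j + 1 := by omega
      have a3 : x ≠ j + 1 + 1 := by omega
      have a4 : x < j + 1 := by omega
      simp only [a1, a2, a3, a4, hxj, if_true, if_false]
      rw [show j + 1 + n - 1 = (j + n - 1) + 1 by omega]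
      exact gen_braid (by omega)
    rcases Nat.eq_or_lt_of_le hxj with rfl | hxj
    · have := fatRight_braid (m + n - 1) n j (by omega)
      simpa [mul_assoc, f1, f2, f3, show j + 1 + n - 1 = j + n by omega] using this
    rcases Nat.eq_or_lt_of_le hxj with rfl | hxj
    · have := fat_braid (m + n - 1) n j (by omega)
      simpa [mul_assoc, f1, f2, f3, show j + 1 + n - 1 = j + n by omega] using this
    rcases Nat.eq_or_lt_of_le hxj with rfl | hxj
    · have := fatLeft_braid (m + n - 1) n j (by omega)
      simpa [mul_assoc, f1, f2, f3, show j + 1 + n - 1 = j + n by omega] using this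
    · have a1 : x ≠ j := by omega
      have a2 : x ≠ j + 1 := by omega
      have a3 : x ≠ j + 1 + 1 := by omega
      have a4 : ¬ x < j + 1 := by omega
      have a5 : ¬ x < j := by omega
      simp only [a1, a2, a3, a4, a5, if_false]
      exact gen_braid (by omega)
  · simp only [cableGen, SemidirectProduct.mul_right, adj_braid h]

theorem cableGen_comm {m n i j : ℕ} (h : i + 1 < j) (hj : j + 1 < m) :
    cableGen (m + n - 1) m n i * cableGen (m + n - 1) m n j =
      cableGen (m + n - 1) m n j * cableGen (m + n - 1) m n i := by
  have h1 : i + 1 < m := by omega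
  ext x
  · obtain ⟨x, hx⟩ := x
    simp only [cableGen, SemidirectProduct.mul_left, Pi.mul_apply,
      mulAutArrow_app, adj_inv, adj_val h1, adj_val hj, block]
    rcases lt_or_ge x i with hx1 | hx1
    · have a1 : x ≠ i := by omega
      have a2 : x ≠ i + 1 := by omega
      have a3 : x ≠ j := by omega
      have a4 : x ≠ j + 1 := by omega
      have a5 : x < j := by omega
      simp only [a1, a2, a3, a4, a5, hx1, if_true, if_false]
      exact gen_comm (by omega)
    rcases Nat.eq_or_lt_of_le hx1 with rfl | hx2
    · have a1 : i ≠ j := by omega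
      have a2 : i ≠ j + 1 := by omega
      have a3 : i + 1 ≠ j := by omega
      have a4 : i < j := by omega
      simp [a1, a2, a3, a4, h, (fatRight_comm_of_gt (m + n - 1) n (j := i) (i := j + n - 1)
        (by omega)).symm]
    rcases Nat.eq_or_lt_of_le hx2 with rfl | hx3
    · have a1 : i ≠ j := by omega
      have a2 : i ≠ j + 1 := by omega
      have a3 : i + 1 ≠ j := by omega
      have a4 : i < j := by omega
      simp [a1, a2, a3, a4, h, (fatLeft_comm_of_gt (m + n - 1) n (j := i) (i := j + n - 1)
        (by omega)).symm]
    have a1 : x ≠ i := by omega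
    have a2 : x ≠ i + 1 := by omega
    have a6 : ¬ x < i := by omega
    rcases lt_or_ge x j with hx4 | hx4
    · have a3 : x ≠ j := by omega
      have a4 : x ≠ j + 1 := by omega
      simp only [a1, a2, a3, a4, a6, hx4, if_true, if_false]
      exact gen_comm (by omega)
    rcases Nat.eq_or_lt_of_le hx4 with rfl | hx5
    · have b1 : j ≠ i := by omega
      have b2 : j + 1 ≠ i := by omega
      have b3 : j ≠ i + 1 := by omega
      have b4 : ¬ j + 1 < i := by omega
      have b5 : j ≠ i := by omega
      have b6 : ¬ j < i := by omega
      simp [b1, b2, b3, b4, b6, (fatRight_comm_of_lt (m + n - 1) n h)]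
    rcases Nat.eq_or_lt_of_le hx5 with rfl | hx6
    · have b1 : j ≠ i := by omega
      have b2 : j + 1 ≠ i := by omega
      have b3 : j ≠ i + 1 := by omega
      have b4 : ¬ j + 1 < i := by omega
      have b6 : ¬ j < i := by omega
      simp [b1, b2, b3, b4, b6, (fatLeft_comm_of_lt (m + n - 1) n h)]
    · have a3 : x ≠ j := by omega
      have a4 : x ≠ j + 1 := by omega
      have a5 : ¬ x < j := by omega
      simp only [a1, a2, a3, a4, a5, a6, if_false]
      exact gen_comm h
  · simp only [cableGen, SemidirectProduct.mul_right, adj_comm h hj]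

/-- The homomorphism recording how the braids on `m` strands act on positions and how they look
after one strand has been replaced by `n` parallel strands. The first component is indexed by the
final position of that strand. -/
def cableHom (m n : ℕ) : BraidGroup m →* CableTarget (m + n - 1) m :=
  braidLift m (cableGen (m + n - 1) m n) (fun _ h => cableGen_braid h)
    (fun _ _ h hj => cableGen_comm h hj)

/-- The braid obtained from `γ ∈ B_m` by replacing the strand which starts in position `i` by `n`
parallel strands. -/
def fatten {m : ℕ} (n : ℕ) (i : Fin m) (γ : BraidGroup m) : BraidGroup (m + n - 1) :=
  (cableHom m n γ).left (toPerm m γ i)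

theorem cableHom_right {m : ℕ} (n : ℕ) (γ : BraidGroup m) :
    (cableHom m n γ).right = toPerm m γ := by
  have : SemidirectProduct.rightHom.comp (cableHom m n) = toPerm m := by
    apply PresentedGroup.ext
    intro j
    have hj : (j : ℕ) + 1 < m := by have := j.2; omega
    rw [← gen_of, MonoidHom.comp_apply, cableHom, braidLift_gen _ _ _ _ hj, toPerm_gen hj]
    rfl
  exact DFunLike.congr_fun this γ

theorem fatten_gen {m n j : ℕ} (hj : j + 1 < m) (i : Fin m) :
    fatten n i (gen m j) = block (m + n - 1) n j i := by
  simp only [fatten, cableHom, braidLift_gen _ _ _ _ hj, toPerm_gen hj, cableGen]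
  simp

theorem fatten_mul {m n : ℕ} (i : Fin m) (γ γ' : BraidGroup m) :
    fatten n i (γ * γ') = fatten n (toPerm m γ' i) γ * fatten n i γ' := by
  simp only [fatten, map_mul, SemidirectProduct.mul_left, Pi.mul_apply, mulAutArrow_app,
    cableHom_right, Equiv.Perm.mul_apply]
  simp

/-- The homomorphism `B_n → B_{m + n - 1}` placing a braid on the strands in positions
`i, …, i + n - 1`. -/
def insertAt {m : ℕ} (n : ℕ) (i : Fin m) : BraidGroup n →* BraidGroup (m + n - 1) :=
  braidLift n (fun t => gen (m + n - 1) (i + t))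
    (fun j h => by
      have := i.2
      exact gen_braid (j := (i : ℕ) + j) (by omega))
    (fun s t h _ => gen_comm (by omega))

/-- The cabling `γ ∘_i ρ`: replace the strand of `γ` starting in position `i` by a narrow tube, and
fill that tube with `ρ`. -/
def cabling {m n : ℕ} (i : Fin m) (γ : BraidGroup m) (ρ : BraidGroup n) :
    BraidGroup (m + n - 1) :=
  fatten n i γ * insertAt n i ρ

/-! ## Braided vector spaces and the action of the braid groups on tensor powers -/

section Tensor

variable {k : Type*} [Field k] {V : Type*} [AddCommGroup V] [Module k V]

/-- The endomorphism `id ⊗ f` of `V ⊗ V ⊗ V`, with `f` applied to the last two factors. -/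
noncomputable def applyRight (f : V ⊗[k] V →ₗ[k] V ⊗[k] V) :
    (V ⊗[k] V) ⊗[k] V →ₗ[k] (V ⊗[k] V) ⊗[k] V :=
  (TensorProduct.assoc k V V V).symm.toLinearMap ∘ₗ f.lTensor V ∘ₗ
    (TensorProduct.assoc k V V V).toLinearMap

variable (k V) in
/-- A braiding on a vector space: an automorphism of `V ⊗ V` satisfying the braid equation. -/
structure Braiding where
  /-- The automorphism of `V ⊗ V`. -/
  σ : V ⊗[k] V ≃ₗ[k] V ⊗[k] V
  braid_eq : σ.toLinearMap.rTensor V ∘ₗ applyRight σ.toLinearMap ∘ₗ σ.toLinearMap.rTensor V =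
    applyRight σ.toLinearMap ∘ₗ σ.toLinearMap.rTensor V ∘ₗ applyRight σ.toLinearMap

variable {n : ℕ}

/-- Insert a tensor into the factors `i` and `j` of the pure tensor `⨂ a`. -/
noncomputable def insertPair (a : Fin n → V) (i j : Fin n) (h : i ≠ j) :
    V ⊗[k] V →ₗ[k] ⨂[k] _ : Fin n, V :=
  TensorProduct.lift (LinearMap.mk₂ k
    (fun x y => PiTensorProduct.tprod k (Function.update (Function.update a i x) j y))
    (fun x x' y => by
      rw [Function.update_comm h, Function.update_comm h, Function.update_comm h,
        MultilinearMap.map_update_add])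
    (fun c x y => by
      rw [Function.update_comm h, Function.update_comm h, MultilinearMap.map_update_smul])
    (fun x y y' => by rw [MultilinearMap.map_update_add])
    (fun c x y => by rw [MultilinearMap.map_update_smul]))

theorem insertPair_tmul (a : Fin n → V) (i j : Fin n) (h : i ≠ j) (x y : V) :
    insertPair a i j h (x ⊗ₜ[k] y) =
      PiTensorProduct.tprod k (Function.update (Function.update a i x) j y) := by
  simp [insertPair]

theorem insertPair_update_left (a : Fin n → V) (i j : Fin n) (h : i ≠ j) (z : V) :
    insertPair (k := k) (Function.update a i z) i j h = insertPair a i j h := by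
  ext x y; simp [insertPair]

theorem insertPair_update_right (a : Fin n → V) (i j : Fin n) (h : i ≠ j) (z : V) :
    insertPair (k := k) (Function.update a j z) i j h = insertPair a i j h := by
  ext x y; simp [insertPair, Function.update_comm h]

theorem insertPair_update_add (a : Fin n → V) (i j : Fin n) (h : i ≠ j) (l : Fin n)
    (hi : l ≠ i) (hj : l ≠ j) (z z' : V) :
    insertPair (k := k) (Function.update a l (z + z')) i j h =
      insertPair (Function.update a l z) i j h + insertPair (Function.update a l z') i j h := by
  ext x y
  simp [insertPair, Function.update_comm hi, Function.update_comm hj]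

theorem insertPair_update_smul (a : Fin n → V) (i j : Fin n) (h : i ≠ j) (l : Fin n)
    (hi : l ≠ i) (hj : l ≠ j) (c : k) (z : V) :
    insertPair (k := k) (Function.update a l (c • z)) i j h =
      c • insertPair (Function.update a l z) i j h := by
  ext x y
  simp [insertPair, Function.update_comm hi, Function.update_comm hj]

/-- The endomorphism of `V^{⊗ n}` applying `f` to the tensor factors `i` and `j`. -/
noncomputable def applyAt (f : V ⊗[k] V →ₗ[k] V ⊗[k] V) (i j : Fin n) (h : i ≠ j) :
    (⨂[k] _ : Fin n, V) →ₗ[k] ⨂[k] _ : Fin n, V :=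
  PiTensorProduct.lift (MultilinearMap.mk'
    (fun a => insertPair a i j h (f (a i ⊗ₜ[k] a j)))
    (fun a l z z' => by
      by_cases hi : l = i
      · subst hi
        simp [insertPair_update_left, Function.update_of_ne h.symm, TensorProduct.add_tmul]
      by_cases hj : l = j
      · subst hj
        simp [insertPair_update_right, Function.update_of_ne h, TensorProduct.tmul_add]
      · simp [insertPair_update_add a i j h l hi hj, Function.update_of_ne (Ne.symm hi),
          Function.update_of_ne (Ne.symm hj)])
    (fun a l c z => by
      by_cases hi : l = i
      · subst hi
        simp [insertPair_update_left, Function.update_of_ne h.symm, ← TensorProduct.smul_tmul']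
      by_cases hj : l = j
      · subst hj
        simp [insertPair_update_right, Function.update_of_ne h]
      · simp [insertPair_update_smul a i j h l hi hj, Function.update_of_ne (Ne.symm hi),
          Function.update_of_ne (Ne.symm hj)]))

theorem applyAt_tprod (f : V ⊗[k] V →ₗ[k] V ⊗[k] V) (i j : Fin n) (h : i ≠ j) (a : Fin n → V) :
    applyAt f i j h (PiTensorProduct.tprod k a) = insertPair a i j h (f (a i ⊗ₜ[k] a j)) := by
  simp [applyAt]

/-- `applyAt f i j` intertwines with `f` on the factors `i`, `j`. -/
theorem applyAt_insertPair (f : V ⊗[k] V →ₗ[k] V ⊗[k] V) (i j : Fin n) (h : i ≠ j)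
    (a : Fin n → V) (t : V ⊗[k] V) :
    applyAt f i j h (insertPair a i j h t) = insertPair a i j h (f t) := by
  induction t with
  | zero => simp
  | add x y hx hy => simp [hx, hy]
  | tmul x y =>
    rw [insertPair_tmul, applyAt_tprod, insertPair_update_right, insertPair_update_left]
    simp [Function.update_of_ne h]

theorem applyAt_comp (f g : V ⊗[k] V →ₗ[k] V ⊗[k] V) (i j : Fin n) (h : i ≠ j) :
    applyAt f i j h ∘ₗ applyAt g i j h = applyAt (f ∘ₗ g) i j h := by
  apply PiTensorProduct.ext
  ext a
  simp [applyAt_tprod, applyAt_insertPair]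

theorem applyAt_id (i j : Fin n) (h : i ≠ j) :
    applyAt (LinearMap.id : V ⊗[k] V →ₗ[k] V ⊗[k] V) i j h = LinearMap.id := by
  apply PiTensorProduct.ext
  ext a
  simp [applyAt_tprod, insertPair_tmul]

/-- `applyAt` for an automorphism of `V ⊗ V`. -/
noncomputable def applyAtEquiv (f : V ⊗[k] V ≃ₗ[k] V ⊗[k] V) (i j : Fin n) (h : i ≠ j) :
    (⨂[k] _ : Fin n, V) ≃ₗ[k] ⨂[k] _ : Fin n, V :=
  LinearEquiv.ofLinearMap (applyAt f.toLinearMap i j h) (applyAt f.symm.toLinearMap i j h)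
    (by rw [applyAt_comp, LinearEquiv.comp_symm, applyAt_id])
    (by rw [applyAt_comp, LinearEquiv.symm_comp, applyAt_id])

/-- Insert a tensor into the factors `i`, `j`, `l` of a pure tensor. -/
noncomputable def insertTriple (a : Fin n → V) (i j l : Fin n) (hij : i ≠ j) (hjl : j ≠ l)
    (hil : i ≠ l) : (V ⊗[k] V) ⊗[k] V →ₗ[k] ⨂[k] _ : Fin n, V :=
  TensorProduct.lift (LinearMap.mk₂ k
    (fun t z => insertPair (Function.update a l z) i j hij t)
    (fun t t' z => map_add _ _ _) (fun c t z => map_smul _ _ _)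
    (fun t z z' => by rw [insertPair_update_add a i j hij l hil.symm hjl.symm]; rfl)
    (fun c t z => by rw [insertPair_update_smul a i j hij l hil.symm hjl.symm]; rfl))

theorem insertTriple_tmul (a : Fin n → V) (i j l : Fin n) (hij : i ≠ j) (hjl : j ≠ l)
    (hil : i ≠ l) (t : V ⊗[k] V) (z : V) :
    insertTriple a i j l hij hjl hil (t ⊗ₜ[k] z) =
      insertPair (Function.update a l z) i j hij t := by
  simp [insertTriple]

theorem insertTriple_tmul' (a : Fin n → V) (i j l : Fin n) (hij : i ≠ j) (hjl : j ≠ l)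
    (hil : i ≠ l) (x : V) (t : V ⊗[k] V) :
    insertTriple a i j l hij hjl hil ((TensorProduct.assoc k V V V).symm (x ⊗ₜ[k] t)) =
      insertPair (Function.update a i x) j l hjl t := by
  induction t with
  | zero => simp
  | add x y hx hy => simp [TensorProduct.tmul_add, hx, hy]
  | tmul y z =>
    rw [TensorProduct.assoc_symm_tmul, insertTriple_tmul, insertPair_tmul, insertPair_tmul,
      Function.update_comm hil.symm, Function.update_comm hjl.symm]

theorem applyAt_insertTriple_left (f : V ⊗[k] V →ₗ[k] V ⊗[k] V) (a : Fin n → V) (i j l : Fin n)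
    (hij : i ≠ j) (hjl : j ≠ l) (hil : i ≠ l) :
    applyAt f i j hij ∘ₗ insertTriple a i j l hij hjl hil =
      insertTriple a i j l hij hjl hil ∘ₗ f.rTensor V := by
  apply TensorProduct.ext'
  intro t z
  simp [insertTriple_tmul, applyAt_insertPair]

theorem applyAt_insertTriple_right (f : V ⊗[k] V →ₗ[k] V ⊗[k] V) (a : Fin n → V) (i j l : Fin n)
    (hij : i ≠ j) (hjl : j ≠ l) (hil : i ≠ l) :
    applyAt f j l hjl ∘ₗ insertTriple a i j l hij hjl hil =
      insertTriple a i j l hij hjl hil ∘ₗ applyRight f := by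
  rw [← LinearMap.cancel_right (TensorProduct.assoc k V V V).symm.surjective]
  apply TensorProduct.ext'
  intro x t
  simp [applyRight, insertTriple_tmul', applyAt_insertPair]

theorem applyAt_braid (c : Braiding k V) (i j l : Fin n) (hij : i ≠ j) (hjl : j ≠ l)
    (hil : i ≠ l) :
    applyAtEquiv c.σ i j hij * applyAtEquiv c.σ j l hjl * applyAtEquiv c.σ i j hij =
      applyAtEquiv c.σ j l hjl * applyAtEquiv c.σ i j hij * applyAtEquiv c.σ j l hjl := by
  apply LinearEquiv.toLinearMap_injective
  apply PiTensorProduct.ext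
  ext a
  have ha : PiTensorProduct.tprod k a =
      insertTriple (k := k) a i j l hij hjl hil ((a i ⊗ₜ a j) ⊗ₜ a l) := by
    simp [insertTriple_tmul, insertPair_tmul]
  have h1 := fun t => LinearMap.congr_fun
    (applyAt_insertTriple_left c.σ.toLinearMap a i j l hij hjl hil) t
  have h2 := fun t => LinearMap.congr_fun
    (applyAt_insertTriple_right c.σ.toLinearMap a i j l hij hjl hil) t
  have h3 := LinearMap.congr_fun c.braid_eq ((a i ⊗ₜ a j) ⊗ₜ a l)
  simp only [LinearMap.comp_apply] at h1 h2 h3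
  simp only [LinearMap.compMultilinearMap_apply, ha]
  change applyAt c.σ.toLinearMap i j hij (applyAt c.σ.toLinearMap j l hjl
    (applyAt c.σ.toLinearMap i j hij _)) = applyAt c.σ.toLinearMap j l hjl
    (applyAt c.σ.toLinearMap i j hij (applyAt c.σ.toLinearMap j l hjl _))
  rw [h1, h2, h1, h3, h2, h1, h2]

theorem applyAt_comm (c : Braiding k V) (i j i' j' : Fin n)
    (h : i ≠ j) (h' : i' ≠ j') (h1 : i ≠ i') (h2 : i ≠ j') (h3 : j ≠ i') (h4 : j ≠ j') :
    applyAtEquiv c.σ i j h * applyAtEquiv c.σ i' j' h' =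
      applyAtEquiv c.σ i' j' h' * applyAtEquiv c.σ i j h := by
  apply LinearEquiv.toLinearMap_injective
  apply PiTensorProduct.ext
  ext a
  let Φ : V ⊗[k] V →ₗ[k] V ⊗[k] V →ₗ[k] ⨂[k] _ : Fin n, V :=
    TensorProduct.lift (LinearMap.mk₂ k
      (fun x y => insertPair (Function.update (Function.update a i x) j y) i' j' h')
      (fun x x' y => by
        rw [Function.update_comm h, Function.update_comm h, Function.update_comm h,
          insertPair_update_add _ _ _ _ _ h1 h2])
      (fun c x y => by
        rw [Function.update_comm h, Function.update_comm h,
          insertPair_update_smul _ _ _ _ _ h1 h2])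
      (fun x y y' => by rw [insertPair_update_add _ _ _ _ _ h3 h4])
      (fun c x y => by rw [insertPair_update_smul _ _ _ _ _ h3 h4]))
  have hΦ : ∀ x y t, Φ (x ⊗ₜ y) t =
      insertPair (Function.update (Function.update a i x) j y) i' j' h' t := by
    intro x y t; simp [Φ]
  have hΦ' : ∀ s x y, Φ s (x ⊗ₜ y) =
      insertPair (Function.update (Function.update a i' x) j' y) i j h s := by
    intro s x y
    induction s with
    | zero => simp
    | add u v hu hv => simp [hu, hv]
    | tmul u v =>
      rw [hΦ, insertPair_tmul, insertPair_tmul, Function.update_comm h3.symm.symm,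
        Function.update_comm h1, Function.update_comm h4, Function.update_comm h2]
  have e1 : ∀ s t, applyAt c.σ.toLinearMap i j h (Φ s t) = Φ (c.σ s) t := by
    intro s t
    induction t with
    | zero => simp
    | add u v hu hv => simp [hu, hv]
    | tmul u v => rw [hΦ', hΦ', applyAt_insertPair]; rfl
  have e2 : ∀ s t, applyAt c.σ.toLinearMap i' j' h' (Φ s t) = Φ s (c.σ t) := by
    intro s t
    induction s with
    | zero => simp
    | add u v hu hv => simp [hu, hv]
    | tmul u v => rw [hΦ, hΦ, applyAt_insertPair]; rfl
  have ha : PiTensorProduct.tprod k a = Φ (a i ⊗ₜ a j) (a i' ⊗ₜ a j') := by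
    simp [hΦ, insertPair_tmul]
  simp only [LinearMap.compMultilinearMap_apply, ha]
  change applyAt c.σ.toLinearMap i j h (applyAt c.σ.toLinearMap i' j' h' _) =
    applyAt c.σ.toLinearMap i' j' h' (applyAt c.σ.toLinearMap i j h _)
  rw [e1, e2, e1, e2]

namespace Braiding

variable (c : Braiding k V)

/-- The automorphism `id^{⊗ j} ⊗ σ ⊗ id^{⊗ (n - j - 2)}` of `V^{⊗ n}`, applying `σ` to the tensor
factors in positions `j` and `j + 1`. -/
noncomputable def crossing (n j : ℕ) : (⨂[k] _ : Fin n, V) ≃ₗ[k] ⨂[k] _ : Fin n, V :=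
  if h : j + 1 < n then
    applyAtEquiv c.σ ⟨j, by omega⟩ ⟨j + 1, h⟩ (by simp)
  else 1

/-- The action of the braid group `B_n` on `V^{⊗ n}`. -/
noncomputable def action (n : ℕ) :
    BraidGroup n →* ((⨂[k] _ : Fin n, V) ≃ₗ[k] ⨂[k] _ : Fin n, V) :=
  braidLift n (c.crossing n)
    (fun j h => by
      have h1 : j + 1 < n := by omega
      have h2 : j + 1 + 1 < n := by omega
      simp only [crossing, h1, h2, dif_pos]
      exact applyAt_braid c _ _ _ _ _ (by simp [Fin.ext_iff]; omega))
    (fun i j h hj => by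
      have h1 : i + 1 < n := by omega
      simp only [crossing, h1, hj, dif_pos]
      apply applyAt_comm <;> simp <;> omega)

/-- A braided vector space is finitely braided if, for each `n`, the action of `B_n` on `V^{⊗ n}`
factors through a finite quotient of `B_n`. -/
def FinitelyBraided : Prop := ∀ n : ℕ, (c.action n).ker.FiniteIndex

end Braiding

end Tensor

/-! ## Braided Hopf algebras -/

section Hopf

variable (k : Type*) [Field k] (A : Type*) [Ring A] [Algebra k A] [Coalgebra k A]

/-- A braided Hopf algebra over `k` in the sense of Takeuchi: a braided vector space which is a
unital associative algebra and a counital coassociative coalgebra, such that all structure maps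
commute with the braiding, the comultiplication and the counit are algebra maps for the braided
product on `A ⊗ A`, and there is an
antipode (it is unique and commutes with the braiding). -/
structure BraidedHopfAlgebra extends Braiding k A where
  braid_mul_left : σ.toLinearMap ∘ₗ (LinearMap.mul' k A).rTensor A =
    (LinearMap.mul' k A).lTensor A ∘ₗ (TensorProduct.assoc k A A A).toLinearMap ∘ₗ
      σ.toLinearMap.rTensor A ∘ₗ applyRight σ.toLinearMap
  braid_mul_right : σ.toLinearMap ∘ₗ (LinearMap.mul' k A).lTensor A ∘ₗ
      (TensorProduct.assoc k A A A).toLinearMap =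
    (LinearMap.mul' k A).rTensor A ∘ₗ applyRight σ.toLinearMap ∘ₗ σ.toLinearMap.rTensor A
  braid_one_left : ∀ a : A, σ (1 ⊗ₜ[k] a) = a ⊗ₜ[k] 1
  braid_one_right : ∀ a : A, σ (a ⊗ₜ[k] 1) = 1 ⊗ₜ[k] a
  braid_comul_left : (TensorProduct.assoc k A A A).symm.toLinearMap ∘ₗ
      (Coalgebra.comul (R := k) (A := A)).lTensor A ∘ₗ σ.toLinearMap =
    σ.toLinearMap.rTensor A ∘ₗ applyRight σ.toLinearMap ∘ₗ
      (Coalgebra.comul (R := k) (A := A)).rTensor A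
  braid_comul_right : (Coalgebra.comul (R := k) (A := A)).rTensor A ∘ₗ σ.toLinearMap =
    applyRight σ.toLinearMap ∘ₗ σ.toLinearMap.rTensor A ∘ₗ
      (TensorProduct.assoc k A A A).symm.toLinearMap ∘ₗ
      (Coalgebra.comul (R := k) (A := A)).lTensor A
  braid_counit_left : (TensorProduct.rid k A).toLinearMap ∘ₗ
      (Coalgebra.counit (R := k) (A := A)).lTensor A ∘ₗ σ.toLinearMap =
    (TensorProduct.lid k A).toLinearMap ∘ₗ (Coalgebra.counit (R := k) (A := A)).rTensor A
  braid_counit_right : (TensorProduct.lid k A).toLinearMap ∘ₗ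
      (Coalgebra.counit (R := k) (A := A)).rTensor A ∘ₗ σ.toLinearMap =
    (TensorProduct.rid k A).toLinearMap ∘ₗ (Coalgebra.counit (R := k) (A := A)).lTensor A
  comul_mul : Coalgebra.comul (R := k) (A := A) ∘ₗ LinearMap.mul' k A =
    TensorProduct.map (LinearMap.mul' k A) (LinearMap.mul' k A) ∘ₗ
      -- the map `id ⊗ σ ⊗ id`
      (TensorProduct.assoc k A A (A ⊗[k] A)).symm.toLinearMap ∘ₗ
      ((TensorProduct.assoc k A A A).toLinearMap ∘ₗ σ.toLinearMap.rTensor A ∘ₗ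
        (TensorProduct.assoc k A A A).symm.toLinearMap).lTensor A ∘ₗ
      (TensorProduct.assoc k A A (A ⊗[k] A)).toLinearMap ∘ₗ
      TensorProduct.map (Coalgebra.comul (R := k) (A := A)) (Coalgebra.comul (R := k) (A := A))
  comul_one : Coalgebra.comul (R := k) (1 : A) = 1 ⊗ₜ[k] 1
  counit_mul : ∀ a b : A, Coalgebra.counit (R := k) (a * b) =
    Coalgebra.counit (R := k) a * Coalgebra.counit (R := k) b
  counit_one : Coalgebra.counit (R := k) (1 : A) = 1
  exists_antipode : ∃ S : A →ₗ[k] A,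
    LinearMap.mul' k A ∘ₗ S.rTensor A ∘ₗ Coalgebra.comul =
      Algebra.linearMap k A ∘ₗ Coalgebra.counit ∧
    LinearMap.mul' k A ∘ₗ S.lTensor A ∘ₗ Coalgebra.comul =
      Algebra.linearMap k A ∘ₗ Coalgebra.counit

variable {A}

/-- The primitive elements of a coalgebra with unit. -/
def IsPrimitive (x : A) : Prop := Coalgebra.comul (R := k) x = x ⊗ₜ[k] 1 + 1 ⊗ₜ[k] x

end Hopf

/-! ## The profinite braided associative operad -/

section Operad

variable (k : Type*) [Field k]

/-- The inverse system of finite quotients of `B_n`, encoded by the finite index normal subgroups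
(smaller subgroups correspond to larger quotients). -/
abbrev FinQuot (n : ℕ) : Type := FiniteIndexNormalSubgroup (BraidGroup n)

/-- The term `k[B_n / N]` of the inverse system which is the `n`th term of the profinite completion
of the braided associative operad. -/
abbrev BrAssLevel (n : ℕ) (N : FinQuot n) : Type _ :=
  MonoidAlgebra k (BraidGroup n ⧸ N.toSubgroup)

/-- The transition maps `k[B_n / N] → k[B_n / N']` of the inverse system, for `N ≤ N'`. -/
noncomputable def transition {n : ℕ} {N N' : FinQuot n} (h : N ≤ N') :
    BrAssLevel k n N →ₐ[k] BrAssLevel k n N' :=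
  MonoidAlgebra.mapDomainAlgHom k k
    (QuotientGroup.map N.toSubgroup N'.toSubgroup (MonoidHom.id _) h)

/-- The projection `k[B_n] → k[B_n / N]`. -/
noncomputable def toLevel {n : ℕ} (N : FinQuot n) :
    MonoidAlgebra k (BraidGroup n) →ₐ[k] BrAssLevel k n N :=
  MonoidAlgebra.mapDomainAlgHom k k (QuotientGroup.mk' N.toSubgroup)

/-- The space of elements of the pro-vector space `{k[B_n / N]}_N`: compatible families, i.e. the
morphisms from the constant pro-vector space `k`. -/
noncomputable def BrAssHat (n : ℕ) : Submodule k (∀ N : FinQuot n, BrAssLevel k n N) where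
  carrier := {α | ∀ (N N' : FinQuot n) (h : N ≤ N'), transition k h (α N) = α N'}
  add_mem' ha hb N N' h := by simp [ha N N' h, hb N N' h]
  zero_mem' N N' h := by simp
  smul_mem' c a ha N N' h := by simp [ha N N' h]

variable {k}

section Action

variable {A : Type*} [Ring A] [Algebra k A]

/-- The kernel of the action of `B_n` on `A^{⊗ n}`, a finite index normal subgroup: the action
factors through the quotient of `B_n` by it, and by every smaller subgroup. -/
noncomputable def actionKernel (c : Braiding k A) (hc : c.FinitelyBraided) (n : ℕ) : FinQuot n :=
  { toSubgroup := (c.action n).ker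
    isNormal' := inferInstance
    isFiniteIndex' := hc n }

/-- The value `α(a_1, …, a_n) ∈ A` for a finitely braided algebra `A`: the element `α` acts on
`a_1 ⊗ ⋯ ⊗ a_n` through a finite quotient of `B_n` which acts on `A^{⊗ n}` (which one is irrelevant,
as the components of `α` are compatible), and the result is multiplied out. -/
noncomputable def evaluate (c : Braiding k A) (hc : c.FinitelyBraided) {n : ℕ} (α : BrAssHat k n)
    (a : Fin n → A) : A :=
  PiTensorProduct.lift (MultilinearMap.mkPiAlgebraFin k n A)
    (MonoidAlgebra.lift k _ _
      ((LinearEquiv.automorphismGroup.toLinearMapMonoidHom).comp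
        (QuotientGroup.kerLift (c.action n)))
      (α.1 (actionKernel c hc n)) (PiTensorProduct.tprod k a))

end Action

/-- The cabling map `∘_i : B_m × B_n → B_{m+n-1}` descends to the given finite quotients. -/
def CablingDescends {m n : ℕ} (i : Fin m) (P : FinQuot m) (Q : FinQuot n)
    (L : FinQuot (m + n - 1)) : Prop :=
  ∀ (γ γ' : BraidGroup m) (ρ ρ' : BraidGroup n), γ⁻¹ * γ' ∈ P → ρ⁻¹ * ρ' ∈ Q →
    (cabling i γ ρ)⁻¹ * cabling i γ' ρ' ∈ L

theorem exists_cablingDescends {m n : ℕ} (i : Fin m) (L : FinQuot (m + n - 1)) :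
   ∃ (P₀ : FinQuot m) (Q₀ : FinQuot n), CablingDescends i P₀ Q₀ L := by
  let Q₀ : FinQuot n := L.comap (insertAt n i)
  let π := QuotientGroup.mk' L.toSubgroup
  let F : BraidGroup m →* (Fin m → (BraidGroup (m + n - 1) ⧸ L.toSubgroup)) ⋊[mulAutArrow]
      (Equiv.Perm (Fin m)) :=
   { toFun := fun γ => ⟨fun x => π ((cableHom m n γ).left x), toPerm m γ⟩
     map_one' := by ext <;> simp
     map_mul' := by
      intro a b
      ext x
      · rw [map_mul, SemidirectProduct.mul_left, cableHom_right, SemidirectProduct.mul_left]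
        exact map_mul π _ _
      · simp }
  have : Finite ((Fin m → (BraidGroup (m + n - 1) ⧸ L.toSubgroup)) ⋊[mulAutArrow]
      (Equiv.Perm (Fin m))) :=
    Finite.of_equiv _ SemidirectProduct.equivProd.symm
  let P₀ : FinQuot m := { toSubgroup := F.ker }
  refine ⟨P₀, Q₀, ?_⟩
  intro γ γ' ρ ρ' hγ hρ
  have hF : F γ = F γ' := by
    have : F (γ⁻¹ * γ') = 1 := hγ
    rw [map_mul, map_inv, inv_mul_eq_one] at this; exact this
  have h1 := congrArg (fun z => z.right) hF
  have h2 := congrArg (fun z => z.left) hF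
  simp only [F, MonoidHom.coe_mk, OneHom.coe_mk] at h1 h2
  have h3 := congrFun h2 (toPerm m γ i)
  have hρ2 : (insertAt n i (ρ⁻¹ * ρ')) ∈ L.toSubgroup := hρ
  rw [map_mul, map_inv, ← QuotientGroup.eq] at hρ2
  rw [← FiniteIndexNormalSubgroup.mem_toSubgroup_iff, ← QuotientGroup.eq]
  simp only [cabling, QuotientGroup.mk_mul, fatten]
  rw [← h1, hρ2]
  exact congrArg (· * _) h3

/-- The map `B_m / P × B_n / Q → B_{m+n-1} / L` induced by cabling. -/
def cablingQuot {m n : ℕ} (i : Fin m) {P : FinQuot m} {Q : FinQuot n} {L : FinQuot (m + n - 1)}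
    (h : CablingDescends i P Q L) :
    BraidGroup m ⧸ P.toSubgroup → BraidGroup n ⧸ Q.toSubgroup →
      BraidGroup (m + n - 1) ⧸ L.toSubgroup :=
  Quotient.map₂ (cabling i) (fun γ γ' hγ ρ ρ' hρ => by
    rw [← Quotient.eq_iff_equiv] at hγ hρ ⊢
    exact QuotientGroup.eq.2 (h γ γ' ρ ρ' (QuotientGroup.eq.1 hγ) (QuotientGroup.eq.1 hρ)))

/-- The bilinear map `∘_i : k[B_m / P] × k[B_n / Q] → k[B_{m+n-1} / L]` induced by cabling. For
fixed `L` and all sufficiently small `P` and `Q` these maps represent the operadic composition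
`∘_i`, which is a morphism of pro-vector spaces. -/
noncomputable def comp {m n : ℕ} (i : Fin m) {P : FinQuot m} {Q : FinQuot n}
    {L : FinQuot (m + n - 1)} (h : CablingDescends i P Q L)
    (x : BrAssLevel k m P) (y : BrAssLevel k n Q) : BrAssLevel k (m + n - 1) L :=
  x.coeff.sum fun g a => y.coeff.sum fun r b => MonoidAlgebra.single (cablingQuot i h g r) (a * b)

variable (k) in
/-- A family of subspaces of the terms of the inverse systems `{k[B_n / N]}_N`. -/
abbrev LevelwiseSubspace : Type _ := ∀ (n : ℕ) (N : FinQuot n), Submodule k (BrAssLevel k n N)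

/-- A levelwise family of subspaces is a suboperad if it is a subobject of the inverse systems
(`transition_mem`), is stable under the right action of the braid groups (`right_mem`), and if every
operadic composition `∘_i`, as a morphism of pro-vector spaces, restricts to it (`comp_mem`). -/
structure IsSuboperad (C : LevelwiseSubspace k) : Prop where
  transition_mem : ∀ (n : ℕ) (N N' : FinQuot n) (h : N ≤ N'), ∀ x ∈ C n N,
    transition k h x ∈ C n N'
  right_mem : ∀ (n : ℕ) (N : FinQuot n) (γ : BraidGroup n), ∀ x ∈ C n N,
    x * MonoidAlgebra.of k _ (γ : BraidGroup n ⧸ N.toSubgroup) ∈ C n N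
  comp_mem : ∀ (m n : ℕ) (i : Fin m) (L : FinQuot (m + n - 1)),
    ∃ (P₀ : FinQuot m) (Q₀ : FinQuot n), ∀ P ≤ P₀, ∀ Q ≤ Q₀, ∃ h : CablingDescends i P Q L,
      ∀ x ∈ C m P, ∀ y ∈ C n Q, comp i h x y ∈ C (m + n - 1) L

/-- `C(0) = 0`. -/
def IsReducedSeq (C : LevelwiseSubspace k) : Prop := ∀ N : FinQuot 0, C 0 N = ⊥

/-- The identity operation, i.e. the unit of `k[B_1]`, belongs to `C(1)`. -/
def IsUnitalSeq (C : LevelwiseSubspace k) : Prop := ∀ N : FinQuot 1, 1 ∈ C 1 N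

/-- All transition maps `C(n)_N → C(n)_{N'}` are epimorphisms. -/
def IsStrictSeq (C : LevelwiseSubspace k) : Prop :=
  ∀ (n : ℕ) (N N' : FinQuot n) (h : N ≤ N'), (C n N).map (transition k h).toLinearMap = C n N'

variable (k) in
/-- The braided primitive operad: for `n > 1`, the intersection over all `p + q = n` with
`p, q > 0` of the kernels of left multiplication by `𝔖_{p,q}`. -/
noncomputable def brPrim : LevelwiseSubspace k := fun n N =>
  if 1 < n then
    ⨅ p ∈ Finset.Ioo 0 n, LinearMap.ker (LinearMap.mulLeft k (toLevel k N (shuffleSum k n p)))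
  else ⊥

variable (k) in
/-- The unital enhancement of the braided primitive operad, which differs from it only in arity
`1`, where it is spanned by the identity operation. -/
noncomputable def brPrimStar : LevelwiseSubspace k := fun n N =>
  if n = 1 then Submodule.span k {1} else brPrim k n N

/-- The elements of a levelwise subspace: compatible families whose components lie in it. -/
def LevelwiseSubspace.elements (C : LevelwiseSubspace k) (n : ℕ) : Set (BrAssHat k n) :=
  {α | ∀ N, α.1 N ∈ C n N}

end Operad

end BraidedPrimitive

open BraidedPrimitive

universe u v

/-! The link between the elements `𝔖_{p,q}` and primitive elements is the coproduct formula `Δ(a_1 ⋯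
a_n) = ∑_p (μ_p ⊗ μ_{n-p})(𝔖_{p,n-p} · (a_1 ⊗ ⋯ ⊗ a_n))` for primitive `a_i` (`comul_mulMap_tprod`).
It follows by induction on `n` from `Δ(x m) = (x ⊗ 1 + 1 ⊗ x) Δ(m)`, because splitting unshuffles by
the image of the first position gives a matching recursion for `𝔖_{p,q}` (`shuffleSum_succ`). The
braiding of a braided Hopf algebra maps `P(A) ⊗ P(A)` into itself, so the span of tensors of
primitive elements is stable under the group algebra, and the formula holds on that whole span. If
all `𝔖_{p,q}` with `p, q > 0` kill `α`, only the terms `p = 0` and `p = n` survive, and `α(a_1, …,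
a_n)` is primitive.

For the converse, each finite quotient `B_n / L` has to be seen by some finitely braided Hopf
algebra. An augmented rack is a set `X` with an action of a group `G` and an equivariant degree map
to `G`. It braids the tensor algebra on `X` by `v ⊗ w ↦ |v| w ⊗ v`, and the letters are primitive;
if `G` is finite, the result is finitely braided (`WordAlg.finitelyBraided`). Combing braids, by
induction on the number of strands, produces a finite `G` and degrees `t` such that every braid
fixing the base sequence of free `G`-strands lies in `L` (`exists_detecting_rack`). The words
obtained by letting braids act on the base letters then distinguish the cosets of `L`. Reading off
the bidegree `(p, n - p)` part of the coproduct therefore recovers `𝔖_{p,q} α` in `k[B_n / L]`, and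
primitivity forces it to vanish (`mem_brPrimStar_of_isPrimitive`).

The same criterion gives closure under composition. On letters, `α ∘_i β` is `α` evaluated with one
argument replaced by a value of `β` (`mulMap_cabling`). Both operations preserve primitive elements,
so the value is primitive in an algebra detecting the target level. Strictness is the only place
where characteristic `0` enters: averaging over the kernel of `B_n / N → B_n / N'` gives an element
`e ↦ 1` such that right multiplication by `e` kills the kernel of the transition map. Multiplying
any lift of a primitive operation by `e` gives a primitive lift. -/

namespace BraidedPrimitive

/-! ## Generators of the braid groups -/

theorem closure_gen (n : ℕ) : Subgroup.closure (gen n '' {j | j + 1 < n}) = ⊤ := by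
  rw [eq_top_iff, ← PresentedGroup.closure_range_of (braidRels n), Subgroup.closure_le]
  rintro _ ⟨j, rfl⟩
  exact Subgroup.subset_closure ⟨j, by have := j.2; simp; omega, gen_of j⟩

theorem braid_induction {n : ℕ} {P : BraidGroup n → Prop} (one : P 1)
    (of_gen : ∀ j, j + 1 < n → P (gen n j)) (mul : ∀ β γ, P β → P γ → P (β * γ))
    (inv : ∀ β, P β → P β⁻¹) (β : BraidGroup n) : P β := by
  have hβ : β ∈ Subgroup.closure (gen n '' {j | j + 1 < n}) := by simp [closure_gen]
  induction hβ using Subgroup.closure_induction with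
  | mem x hx => obtain ⟨j, hj, rfl⟩ := hx; exact of_gen j hj
  | one => exact one
  | mul x y _ _ hx hy => exact mul x y hx hy
  | inv x _ hx => exact inv x hx

/-- The target is only a monoid, so the values on inverses are compared by playing a left inverse
against a right inverse. -/
theorem braidHom_ext {n : ℕ} {M : Type*} [Monoid M] {f g : BraidGroup n →* M}
    (h : ∀ j, j + 1 < n → f (gen n j) = g (gen n j)) : f = g := by
  ext β
  refine braid_induction (P := fun β => f β = g β) (by simp) h
    (fun β γ h1 h2 => by simp [h1, h2]) (fun β h => ?_) β
  have h1 : f β⁻¹ * f β = 1 := by rw [← map_mul]; simp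
  have h2 : g β * g β⁻¹ = 1 := by rw [← map_mul]; simp
  calc f β⁻¹ = f β⁻¹ * (g β * g β⁻¹) := by rw [h2, mul_one]
    _ = g β⁻¹ := by rw [← h, ← mul_assoc, h1, one_mul]

theorem braidGroup_subsingleton {n : ℕ} (hn : n ≤ 1) : Subsingleton (BraidGroup n) := by
  refine ⟨fun a b => ?_⟩
  have : ∀ c : BraidGroup n, c = 1 := braid_induction rfl (fun j hj => by omega)
    (fun β γ h1 h2 => by simp [h1, h2]) (fun β h => by simp [h])
  rw [this a, this b]

/-! ## Combing -/

section Combing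

variable {Γ : Type*} [Group Γ] (s : ℕ → Γ) (n : ℕ)

/-- The product `s_p s_{p+1} ⋯ s_{n-1}`. -/
def strandChain (p : ℕ) : Γ := ((List.range (n - p)).map fun t => s (p + t)).prod

/-- For generators `s` of a braid group, the pure braid in which the last strand moves around the
strand in position `i`. -/
def pureGen (i : ℕ) : Γ := (strandChain s n (i + 1))⁻¹ * (s i * s i) * strandChain s n (i + 1)

theorem strandChain_self : strandChain s n n = 1 := by simp [strandChain]

variable {n}

theorem strandChain_of_lt {p : ℕ} (hp : p < n) :
    strandChain s n p = s p * strandChain s n (p + 1) := by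
  obtain ⟨d, rfl⟩ : ∃ d, n = p + 1 + d := ⟨n - (p + 1), by omega⟩
  simp only [strandChain, show p + 1 + d - p = d + 1 by omega,
    show p + 1 + d - (p + 1) = d by omega, List.range_succ_eq_map, List.map_cons, List.map_map,
    List.prod_cons, add_zero]
  congr 3
  funext t
  simp only [Function.comp]
  congr 1
  omega

variable {s}
variable (hb : ∀ j, j + 1 < n → s j * s (j + 1) * s j = s (j + 1) * s j * s (j + 1))
  (hc : ∀ i j, i + 1 < j → j < n → s i * s j = s j * s i)

include hc in
theorem strandChain_comm {j p : ℕ} (hp : p ≤ n) (h : j + 1 < p) :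
    s j * strandChain s n p = strandChain s n p * s j := by
  induction hp using Nat.decreasingInduction with
  | self => simp [strandChain_self]
  | of_succ p hp ih =>
    rw [strandChain_of_lt s hp, ← mul_assoc, hc j p h hp, mul_assoc, ih (by omega), mul_assoc]

include hb hc in
-- Passing the factors `s j * s (j + 1)` of the chain is one braid relation, which lowers the index
-- by one; all other factors are far away and commute.
theorem strandChain_shift {j p : ℕ} (hj : j + 1 < n) (h : p ≤ j) :
    s (j + 1) * strandChain s n p = strandChain s n p * s j := by
  induction h using Nat.decreasingInduction with
  | self =>
    rw [strandChain_of_lt s (by omega), strandChain_of_lt s hj]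
    calc _ = s (j + 1) * s j * s (j + 1) * strandChain s n (j + 1 + 1) := by group
      _ = s j * s (j + 1) * (s j * strandChain s n (j + 1 + 1)) := by rw [← hb j hj]; group
      _ = _ := by rw [strandChain_comm hc (by omega) (by omega)]; group
  | of_succ p hp ih =>
    rw [strandChain_of_lt s (by omega), ← mul_assoc, ← hc p (j + 1) (by omega) hj, mul_assoc, ih,
      mul_assoc]

include hc in
theorem pureGen_comm_lt {i j : ℕ} (hi : i < n) (h : j + 1 < i) :
    s j * pureGen s n i = pureGen s n i * s j := by
  have h1 : Commute (s j) (strandChain s n (i + 1)) := strandChain_comm hc hi (by omega)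
  have h2 : Commute (s j) (s i) := hc j i h hi
  exact (h1.inv_right.mul_right (h2.mul_right h2)).mul_right h1

include hb hc in
-- The chain conjugates `s j` to `s (j + 1)`, which is far from `s i`.
theorem pureGen_comm_gt {i j : ℕ} (hj : j + 1 < n) (h : i < j) :
    s j * pureGen s n i = pureGen s n i * s j := by
  have h1 : SemiconjBy (strandChain s n (i + 1)) (s j) (s (j + 1)) :=
    (strandChain_shift hb hc hj h).symm
  have h2 : Commute (s i) (s (j + 1)) := hc i (j + 1) (by omega) hj
  exact ((h1.inv_symm_left.mul_left (h2.mul_left h2)).mul_left h1).symm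

include hb hc in
theorem pureGen_conj_succ {i : ℕ} (hi : i + 1 < n) :
    s i * pureGen s n (i + 1) * (s i)⁻¹ = pureGen s n i := by
  have h1 : Commute (s i) (strandChain s n (i + 1 + 1)) := strandChain_comm hc hi (by omega)
  have h2 : (s i) * s (i + 1) * s (i + 1) * (s i)⁻¹ = (s (i + 1))⁻¹ * s i * s i * s (i + 1) := by
    have h := hb i hi
    calc _ = (s (i + 1))⁻¹ * (s (i + 1) * s i * s (i + 1)) * s (i + 1) * (s i)⁻¹ := by group
      _ = (s (i + 1))⁻¹ * s i * (s (i + 1) * s i * s (i + 1)) * (s i)⁻¹ := by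
        conv_lhs => rw [← h]
        group
      _ = _ := by rw [← h]; group
  rw [pureGen, pureGen, strandChain_of_lt s hi]
  generalize strandChain s n (i + 1 + 1) = c at *
  calc _ = (s i * c⁻¹) * (s (i + 1) * s (i + 1)) * (c * (s i)⁻¹) := by group
    _ = c⁻¹ * (s i * s (i + 1) * s (i + 1) * (s i)⁻¹) * c := by
      rw [h1.inv_right.eq, h1.symm.inv_right.eq]; group
    _ = _ := by rw [h2]; group

include hb hc in
-- Writing `A_i` for `pureGen s n i`, this and `pureGen_conj_succ` give `s_i A_i s_i⁻¹ = A_i⁻¹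
-- A_{i+1} A_i` and `s_i⁻¹ A_{i+1} s_i = A_{i+1} A_i A_{i+1}⁻¹`. These are the only conjugates of an
-- `A_i` by a generator or its inverse that are not visibly among the `A_i` themselves.
theorem pureGen_mul_comm {i : ℕ} (hi : i + 1 < n) :
    s i * (pureGen s n (i + 1) * pureGen s n i) = pureGen s n (i + 1) * pureGen s n i * s i := by
  have h1 : Commute (s i) (strandChain s n (i + 1 + 1)) := strandChain_comm hc hi (by omega)
  have h2 : Commute (s i) (s (i + 1) * (s i * s i) * s (i + 1)) := by
    have h := hb i hi
    calc s i * (s (i + 1) * (s i * s i) * s (i + 1))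
        = (s i * s (i + 1) * s i) * s i * s (i + 1) := by group
      _ = s (i + 1) * s i * (s (i + 1) * s i * s (i + 1)) := by rw [h]; group
      _ = _ := by rw [← h]; group
  have h3 : pureGen s n (i + 1) * pureGen s n i = (strandChain s n (i + 1 + 1))⁻¹ *
      (s (i + 1) * (s i * s i) * s (i + 1)) * strandChain s n (i + 1 + 1) := by
    rw [pureGen, pureGen, strandChain_of_lt s hi]; group
  rw [h3]
  exact (h1.inv_right.mul_right h2).mul_right h1

/-- Both conjugations are assumed, since for an infinite subgroup stability under one does not imply
stability under the other. -/
theorem mem_normalizer_closure {S : Set Γ} {g : Γ}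
    (h1 : ∀ a ∈ S, g * a * g⁻¹ ∈ Subgroup.closure S)
    (h2 : ∀ a ∈ S, g⁻¹ * a * g ∈ Subgroup.closure S) :
    ∀ u ∈ Subgroup.closure S, g * u * g⁻¹ ∈ Subgroup.closure S ∧
      g⁻¹ * u * g ∈ Subgroup.closure S := by
  intro u hu
  have k1 : Subgroup.closure S ≤ (Subgroup.closure S).comap (MulAut.conj g).toMonoidHom :=
    (Subgroup.closure_le _).2 fun a ha => by simpa using h1 a ha
  have k2 : Subgroup.closure S ≤ (Subgroup.closure S).comap (MulAut.conj g⁻¹).toMonoidHom :=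
    (Subgroup.closure_le _).2 fun a ha => by simpa using h2 a ha
  exact ⟨by simpa using k1 hu, by simpa using k2 hu⟩

variable (s n) in
/-- The subgroup generated by the `pureGen s n i`. -/
def combSubgroup : Subgroup Γ := Subgroup.closure (pureGen s n '' {i | i < n})

include hb hc in
theorem gen_conj_combSubgroup {j : ℕ} (hj : j + 1 < n) :
    ∀ u ∈ combSubgroup s n, s j * u * (s j)⁻¹ ∈ combSubgroup s n ∧
      (s j)⁻¹ * u * s j ∈ combSubgroup s n := by
  have key : ∀ i < n, s j * pureGen s n i * (s j)⁻¹ ∈ combSubgroup s n ∧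
      (s j)⁻¹ * pureGen s n i * s j ∈ combSubgroup s n := by
    intro i hi
    have hmem : ∀ i < n, pureGen s n i ∈ combSubgroup s n :=
      fun i hi => Subgroup.subset_closure ⟨i, hi, rfl⟩
    have hcomm : s j * pureGen s n i = pureGen s n i * s j →
        s j * pureGen s n i * (s j)⁻¹ ∈ combSubgroup s n ∧
          (s j)⁻¹ * pureGen s n i * s j ∈ combSubgroup s n := by
      intro h
      refine ⟨by rw [h, mul_inv_cancel_right]; exact hmem i hi, ?_⟩
      rw [mul_assoc, ← h, inv_mul_cancel_left]; exact hmem i hi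
    have e1 := pureGen_conj_succ hb hc hj
    have e2 := pureGen_mul_comm hb hc hj
    rcases lt_trichotomy i j with h | rfl | h
    · exact hcomm (pureGen_comm_gt hb hc hj h)
    · constructor
      · have : s i * pureGen s n i * (s i)⁻¹ =
            (pureGen s n i)⁻¹ * (pureGen s n (i + 1) * pureGen s n i) := by
          calc _ = (s i * pureGen s n (i + 1) * (s i)⁻¹)⁻¹ *
                (s i * (pureGen s n (i + 1) * pureGen s n i)) * (s i)⁻¹ := by group
            _ = _ := by rw [e1, e2]; group
        rw [this]
        exact mul_mem (inv_mem (hmem i hi)) (mul_mem (hmem _ hj) (hmem i hi))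
      · rw [← e1]
        convert hmem _ hj using 1
        group
    · rcases Nat.eq_or_lt_of_le h with rfl | h
      · refine ⟨by rw [show j.succ = j + 1 from rfl, e1]; exact hmem j (by omega), ?_⟩
        have : (s j)⁻¹ * pureGen s n (j + 1) * s j =
            pureGen s n (j + 1) * pureGen s n j * (pureGen s n (j + 1))⁻¹ := by
          calc _ = (s j)⁻¹ * (pureGen s n (j + 1) * pureGen s n j * s j) *
                ((s j)⁻¹ * (pureGen s n j)⁻¹ * s j) := by group
            _ = _ := by rw [← e2, ← e1]; group
        rw [show j.succ = j + 1 from rfl, this]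
        exact mul_mem (mul_mem (hmem _ hj) (hmem _ (by omega))) (inv_mem (hmem _ hj))
      · exact hcomm (pureGen_comm_lt hc hi h)
  exact mem_normalizer_closure (by rintro _ ⟨i, hi, rfl⟩; exact (key i hi).1)
    (by rintro _ ⟨i, hi, rfl⟩; exact (key i hi).2)

include hb hc in
theorem conj_combSubgroup {h : Γ} (hh : h ∈ Subgroup.closure (s '' {j | j + 1 < n})) :
    ∀ u ∈ combSubgroup s n, h⁻¹ * u * h ∈ combSubgroup s n := by
  induction hh using Subgroup.closure_induction'' with
  | mem x hx => obtain ⟨j, hj, rfl⟩ := hx; exact fun u hu => (gen_conj_combSubgroup hb hc hj u hu).2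
  | inv_mem x hx =>
    obtain ⟨j, hj, rfl⟩ := hx
    exact fun u hu => by simpa using (gen_conj_combSubgroup hb hc hj u hu).1
  | one => simp
  | mul x y _ _ hx hy =>
    intro u hu
    have := hy _ (hx u hu)
    rwa [show (x * y)⁻¹ * u * (x * y) = y⁻¹ * (x⁻¹ * u * x) * y by group]

include hb hc in
/-- Combing off the last strand of a braid. -/
theorem exists_comb {g : Γ} (hg : g ∈ Subgroup.closure (s '' {j | j < n})) :
    ∃ p ≤ n, ∃ h ∈ Subgroup.closure (s '' {j | j + 1 < n}), ∃ u ∈ combSubgroup s n,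
      g = strandChain s n p * h * u := by
  have hs : ∀ j, j + 1 < n → s j ∈ Subgroup.closure (s '' {j | j + 1 < n}) :=
    fun j hj => Subgroup.subset_closure ⟨j, hj, rfl⟩
  have hu : ∀ i < n, pureGen s n i ∈ combSubgroup s n :=
    fun i hi => Subgroup.subset_closure ⟨i, hi, rfl⟩
  induction hg using Subgroup.closure_induction_left with
  | one => exact ⟨n, le_rfl, 1, one_mem _, 1, one_mem _, by simp [strandChain_self]⟩
  | mul_left x hx y _ ih =>
    obtain ⟨j, hj, rfl⟩ := hx
    obtain ⟨p, hp, h, hh, u, hu', rfl⟩ := ih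
    change j < n at hj
    rcases lt_trichotomy (j + 1) p with hjp | rfl | hjp
    · refine ⟨p, hp, s j * h, mul_mem (hs j (by omega)) hh, u, hu', ?_⟩
      rw [← mul_assoc, ← mul_assoc, strandChain_comm hc hp hjp]; group
    · exact ⟨j, by omega, h, hh, u, hu', by rw [strandChain_of_lt s hj]; group⟩
    · rcases Nat.eq_or_lt_of_le hjp with hjp | hjp
      -- With `c_p` the chain and `A_p` the pure braid, `s_p c_p = s_p² c_{p+1} = c_{p+1} A_p`; then
      -- `A_p` is conjugated past `h`, which normalizes the comb subgroup.
      · obtain rfl : p = j := by omega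
        refine ⟨p + 1, hj, h, hh, _, mul_mem (conj_combSubgroup hb hc hh _ (hu p hj)) hu', ?_⟩
        rw [strandChain_of_lt s hj, pureGen]; group
      · obtain ⟨j, rfl⟩ : ∃ i, j = i + 1 := ⟨j - 1, by omega⟩
        refine ⟨p, hp, s j * h, mul_mem (hs j hj) hh, u, hu', ?_⟩
        rw [← mul_assoc, ← mul_assoc, strandChain_shift hb hc hj (by omega)]; group
  | inv_mul_cancel x hx y _ ih =>
    obtain ⟨j, hj, rfl⟩ := hx
    obtain ⟨p, hp, h, hh, u, hu', rfl⟩ := ih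
    change j < n at hj
    rcases lt_trichotomy (j + 1) p with hjp | rfl | hjp
    · refine ⟨p, hp, (s j)⁻¹ * h, mul_mem (inv_mem (hs j (by omega))) hh, u, hu', ?_⟩
      have : Commute (s j) (strandChain s n p) := strandChain_comm hc hp hjp
      rw [← mul_assoc, ← mul_assoc, this.inv_left.eq]; group
    -- Now `s_j⁻¹ c_{j+1} = c_j A_j⁻¹`: the chain gets longer at the cost of a pure factor.
    · refine ⟨j, by omega, h, hh, _, mul_mem (conj_combSubgroup hb hc hh _
        (inv_mem (hu j hj))) hu', ?_⟩
      rw [strandChain_of_lt s hj, pureGen]; group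
    · rcases Nat.eq_or_lt_of_le hjp with hjp | hjp
      · obtain rfl : p = j := by omega
        exact ⟨p + 1, hj, h, hh, u, hu', by rw [strandChain_of_lt s hj]; group⟩
      · obtain ⟨j, rfl⟩ : ∃ i, j = i + 1 := ⟨j - 1, by omega⟩
        refine ⟨p, hp, (s j)⁻¹ * h, mul_mem (inv_mem (hs j hj)) hh, u, hu', ?_⟩
        have := strandChain_shift hb hc hj (show p ≤ j by omega)
        have : (s (j + 1))⁻¹ * strandChain s n p = strandChain s n p * (s j)⁻¹ := by
          rw [inv_mul_eq_iff_eq_mul, ← mul_assoc, this, mul_inv_cancel_right]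
        rw [← mul_assoc, ← mul_assoc, this]; group

end Combing

/-! ## Augmented racks and their braid group actions -/

/-- A set with an action of a group `G` and an equivariant map to `G`, which acts on itself by
conjugation. -/
structure AugRack (G Y : Type*) [Group G] [MulAction G Y] where
  /-- The augmentation. -/
  deg : Y → G
  deg_smul : ∀ g y, deg (g • y) = g * deg y * g⁻¹

namespace AugRack

variable {G Y : Type*} [Group G] [MulAction G Y] (R : AugRack G Y)

/-- The crossing of the entries in positions `j` and `j + 1` of a sequence. -/
def cross (j : ℕ) : Equiv.Perm (ℕ → Y) where
  toFun w i := if i = j then R.deg (w j) • w (j + 1) else if i = j + 1 then w j else w i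
  invFun w i :=
    if i = j then w (j + 1) else if i = j + 1 then (R.deg (w (j + 1)))⁻¹ • w j else w i
  left_inv w := by
    funext i
    by_cases h1 : i = j
    · simp [h1]
    · by_cases h2 : i = j + 1 <;> simp [h1, h2]
  right_inv w := by
    funext i
    by_cases h1 : i = j
    · simp [h1]
    · by_cases h2 : i = j + 1 <;> simp [h1, h2]

theorem cross_apply (j : ℕ) (w : ℕ → Y) (i : ℕ) : R.cross j w i =
    if i = j then R.deg (w j) • w (j + 1) else if i = j + 1 then w j else w i := rfl

theorem cross_inv_apply (j : ℕ) (w : ℕ → Y) (i : ℕ) : (R.cross j)⁻¹ w i =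
    if i = j then w (j + 1) else if i = j + 1 then (R.deg (w (j + 1)))⁻¹ • w j else w i := rfl

theorem cross_left (j : ℕ) (w : ℕ → Y) : R.cross j w j = R.deg (w j) • w (j + 1) := by
  simp [cross_apply]

theorem cross_right (j : ℕ) (w : ℕ → Y) : R.cross j w (j + 1) = w j := by
  simp [cross_apply]

theorem cross_of_ne {i j : ℕ} (w : ℕ → Y) (h1 : i ≠ j) (h2 : i ≠ j + 1) : R.cross j w i = w i := by
  simp [cross_apply, h1, h2]

/-- In position `j` both sides are `deg (w j) * deg (w (j + 1))` acting on `w (j + 2)`; this is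
where equivariance of the degree is needed. -/
theorem cross_braid (j : ℕ) : R.cross j * R.cross (j + 1) * R.cross j =
    R.cross (j + 1) * R.cross j * R.cross (j + 1) := by
  ext w i
  simp only [Equiv.Perm.mul_apply]
  have f1 : j + 1 + 1 ≠ j := by omega
  have f2 : j ≠ j + 1 + 1 := by omega
  by_cases h1 : i = j
  · subst h1
    simp [cross_apply, smul_smul, R.deg_smul, f1, f2]
  by_cases h2 : i = j + 1
  · subst h2
    simp [cross_apply, f1, f2]
  by_cases h3 : i = j + 1 + 1
  · subst h3
    simp [cross_apply, f1, f2]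
  · simp [cross_apply, h1, h2, h3]

theorem cross_comm {i j : ℕ} (h : i + 1 < j) : R.cross i * R.cross j = R.cross j * R.cross i := by
  ext w l
  simp only [Equiv.Perm.mul_apply]
  have a1 : i ≠ j := by omega
  have a2 : i + 1 ≠ j := by omega
  have a3 : i ≠ j + 1 := by omega
  by_cases h1 : l = i
  · subst h1; simp [cross_apply, a1, a2, a3]
  by_cases h2 : l = i + 1
  · subst h2; simp [cross_apply, a1, a2, a3]
  by_cases h3 : l = j
  · subst h3; simp [cross_apply, a1.symm, a2.symm, a3.symm]
  by_cases h4 : l = j + 1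
  · subst h4; simp [cross_apply, a1.symm, a2.symm, a3.symm]
  · simp [cross_apply, h1, h2, h3, h4]

/-- The action of the braid group `B_n` on the first `n` entries of sequences. -/
def seqAct (n : ℕ) : BraidGroup n →* Equiv.Perm (ℕ → Y) :=
  braidLift n R.cross (fun j _ => R.cross_braid j) (fun _ _ h _ => R.cross_comm h)

theorem seqAct_gen {n j : ℕ} (h : j + 1 < n) : R.seqAct n (gen n j) = R.cross j :=
  braidLift_gen _ _ _ _ h

/-- Infinite sequences let the braid groups for all `n` act on one set; the price is keeping track
of the inert tail. -/
theorem seqAct_of_le {n : ℕ} (β : BraidGroup n) (w : ℕ → Y) {i : ℕ} (hi : n ≤ i) :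
    R.seqAct n β w i = w i := by
  induction β using braid_induction generalizing w with
  | one => simp
  | of_gen j hj => rw [seqAct_gen R hj, cross_of_ne R w (by omega) (by omega)]
  | mul β γ h1 h2 => rw [map_mul, Equiv.Perm.mul_apply, h1, h2]
  | inv β h => rw [← h (R.seqAct n β⁻¹ w), ← Equiv.Perm.mul_apply, ← map_mul]; simp

/-- Crossings only use the action of degrees, so `f` need not come with a homomorphism of groups.
This covers projections of `G × Q`, evaluation of free strands, and the inclusion of letters into
words. -/
theorem seqAct_map {G' Y' : Type*} [Group G'] [MulAction G' Y'] (R' : AugRack G' Y')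
    {f : Y → Y'} (hf : ∀ y z, f (R.deg y • z) = R'.deg (f y) • f z) {n : ℕ} (β : BraidGroup n)
    (w : ℕ → Y) : R'.seqAct n β (f ∘ w) = f ∘ R.seqAct n β w := by
  induction β using braid_induction generalizing w with
  | one => simp
  | of_gen j hj =>
    rw [seqAct_gen R hj, seqAct_gen R' hj]
    funext i
    simp only [cross_apply, Function.comp]
    split_ifs <;> simp [hf]
  | mul β γ h1 h2 => rw [map_mul, map_mul, Equiv.Perm.mul_apply, h2, h1]; rfl
  | inv β h =>
    apply (R'.seqAct n β).injective
    rw [h, ← Equiv.Perm.mul_apply, ← map_mul, ← Equiv.Perm.mul_apply, ← map_mul]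
    simp

/-- Invariant functions of the entries are permuted. -/
theorem seqAct_label {L : Type*} {f : Y → L} (hf : ∀ (g : G) y, f (g • y) = f y) {n : ℕ}
    (β : BraidGroup n) (w : ℕ → Y) (i : Fin n) :
    f (R.seqAct n β w (toPerm n β i)) = f (w i) := by
  induction β using braid_induction generalizing w i with
  | one => simp
  | of_gen j hj =>
    rw [seqAct_gen R hj, toPerm_gen hj, cross_apply, adj_val hj]
    by_cases h1 : (i : ℕ) = j
    · simp [h1]
    by_cases h2 : (i : ℕ) = j + 1
    · simp [h2, hf]
    · simp [h1, h2]
  | mul β γ h1 h2 =>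
    rw [map_mul, map_mul, Equiv.Perm.mul_apply, Equiv.Perm.mul_apply, h1, h2]
  | inv β h =>
    rw [← h, ← Equiv.Perm.mul_apply, ← map_mul, ← Equiv.Perm.mul_apply, ← map_mul]
    simp

end AugRack

/-! ## Free strands over a group -/

/-- The free `G`-set on the labels `ℕ`. -/
@[ext]
structure Strand (G : Type*) where
  /-- The position in the group. -/
  val : G
  /-- The label. -/
  label : ℕ

namespace Strand

variable {G : Type*} [Group G]

instance : MulAction G (Strand G) where
  smul g z := ⟨g * z.val, z.label⟩
  one_smul z := by ext <;> simp [HSMul.hSMul]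
  mul_smul g h z := by ext <;> simp [HSMul.hSMul, mul_assoc]

@[simp] theorem smul_val (g : G) (z : Strand G) : (g • z).val = g * z.val := rfl
@[simp] theorem smul_label (g : G) (z : Strand G) : (g • z).label = z.label := rfl

/-- The augmented rack in which the strand `(1, i)` has degree `t i`. -/
def rack (t : ℕ → G) : AugRack G (Strand G) where
  deg z := z.val * t z.label * z.val⁻¹
  deg_smul g z := by simp [mul_assoc]

theorem rack_deg (t : ℕ → G) (z : Strand G) : (rack t).deg z = z.val * t z.label * z.val⁻¹ := rfl

variable (G) in
/-- The sequence of the strands in their initial positions. -/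
def base : ℕ → Strand G := fun i => ⟨1, i⟩

/-- Labels are invariant under the group, so they are merely permuted. -/
theorem toPerm_eq_one {n : ℕ} (t : ℕ → G) {β : BraidGroup n}
    (h : (rack t).seqAct n β (base G) = base G) : toPerm n β = 1 := by
  ext i
  have := (rack t).seqAct_label (f := Strand.label) (by simp) β (base G) i
  rw [h] at this
  simpa [base] using this

end Strand

/-! ## Detecting finite quotients of braid groups -/

/-- The inclusion `B_n → B_{n+1}` of the braids which leave the last strand alone. -/
def inclBraid (n : ℕ) : BraidGroup n →* BraidGroup (n + 1) :=
  braidLift n (gen (n + 1)) (fun _ _ => gen_braid (by omega)) (fun _ _ h _ => gen_comm h)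

theorem inclBraid_gen {n j : ℕ} (h : j + 1 < n) : inclBraid n (gen n j) = gen (n + 1) j :=
  braidLift_gen _ _ _ _ h

theorem AugRack.seqAct_inclBraid {G Y : Type*} [Group G] [MulAction G Y] (R : AugRack G Y)
    (n : ℕ) (β : BraidGroup n) : R.seqAct (n + 1) (inclBraid n β) = R.seqAct n β := by
  have : (R.seqAct (n + 1)).comp (inclBraid n) = R.seqAct n := braidHom_ext fun j hj => by
    rw [MonoidHom.comp_apply, inclBraid_gen hj, R.seqAct_gen hj, R.seqAct_gen (by omega)]
  exact DFunLike.congr_fun this β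

/-- The inverses of the generators of `B_n`. -/
def genInv (n j : ℕ) : BraidGroup n := (gen n j)⁻¹

theorem genInv_braid {n j : ℕ} (h : j + 2 < n) :
    genInv n j * genInv n (j + 1) * genInv n j =
      genInv n (j + 1) * genInv n j * genInv n (j + 1) := by
  have := congrArg (·⁻¹) (gen_braid h)
  simpa [genInv, mul_assoc] using this

theorem genInv_comm {n i j : ℕ} (h : i + 1 < j) :
    genInv n i * genInv n j = genInv n j * genInv n i := by
  have := congrArg (·⁻¹) (gen_comm (n := n) h)
  simpa [genInv] using this.symm

theorem closure_genInv (n : ℕ) :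
    Subgroup.closure (genInv (n + 1) '' {j | j < n}) = ⊤ := by
  rw [eq_top_iff, ← closure_gen, Subgroup.closure_le]
  rintro _ ⟨j, hj, rfl⟩
  rw [SetLike.mem_coe, ← inv_mem_iff]
  exact Subgroup.subset_closure ⟨j, by simpa using hj, rfl⟩

theorem mem_range_inclBraid {n : ℕ} {h : BraidGroup (n + 1)}
    (hh : h ∈ Subgroup.closure (genInv (n + 1) '' {j | j + 1 < n})) :
    ∃ β, inclBraid n β = h := by
  have : Subgroup.closure (genInv (n + 1) '' {j | j + 1 < n}) ≤ (inclBraid n).range := by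
    rw [Subgroup.closure_le]
    rintro _ ⟨j, hj, rfl⟩
    exact ⟨(gen n j)⁻¹, by rw [map_inv, inclBraid_gen hj]; rfl⟩
  exact this hh

theorem toPerm_genInv {n j : ℕ} (h : j + 1 < n) : toPerm n (genInv n j) = adj n j := by
  rw [genInv, map_inv, toPerm_gen h, adj_inv]

/-- The other two factors of a combed braid fix the last position, so `p` can be read off from the
permutation of the braid. -/
theorem toPerm_strandChain {n p : ℕ} (hp : p ≤ n) :
    ((toPerm (n + 1) (strandChain (genInv (n + 1)) n p) (Fin.last n) : Fin (n + 1)) : ℕ) = p := by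
  induction hp using Nat.decreasingInduction with
  | self => simp [strandChain_self]
  | of_succ p hp ih =>
    rw [strandChain_of_lt _ hp, map_mul, toPerm_genInv (by omega), Equiv.Perm.mul_apply,
      adj_val (by omega), ih]
    simp

theorem toPerm_pureGen {n i : ℕ} (hi : i < n) :
    toPerm (n + 1) (pureGen (genInv (n + 1)) n i) = 1 := by
  have : adj (n + 1) i * adj (n + 1) i = 1 := mul_eq_one_iff_eq_inv.2 (adj_inv _ _).symm
  rw [pureGen, map_mul, map_mul, map_mul, toPerm_genInv (by omega), this, map_inv]
  simp

theorem toPerm_combSubgroup {n : ℕ} {u : BraidGroup (n + 1)}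
    (hu : u ∈ combSubgroup (genInv (n + 1)) n) : toPerm (n + 1) u = 1 := by
  have : combSubgroup (genInv (n + 1)) n ≤ (toPerm (n + 1)).ker := by
    rw [combSubgroup, Subgroup.closure_le]
    rintro _ ⟨i, hi, rfl⟩
    exact toPerm_pureGen hi
  exact this hu

theorem toPerm_inclBraid_last {n : ℕ} (β : BraidGroup n) :
    toPerm (n + 1) (inclBraid n β) (Fin.last n) = Fin.last n := by
  induction β using braid_induction with
  | one => simp
  | of_gen j hj =>
    ext
    rw [inclBraid_gen hj, toPerm_gen (by omega), adj_val (by omega)]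
    simp only [Fin.val_last]
    split_ifs <;> omega
  | mul β γ h1 h2 => rw [map_mul, map_mul, Equiv.Perm.mul_apply, h2, h1]
  | inv β h => rw [map_inv, map_inv, Equiv.Perm.inv_eq_iff_eq, h]

/-- The base sequence of the first `n` strands with a strand `z` inserted in position `p`. -/
def insertStrand {G : Type*} [Group G] (p : ℕ) (z : Strand G) (i : ℕ) : Strand G :=
  if i < p then ⟨1, i⟩ else if i = p then z else if i ≤ z.label then ⟨1, i - 1⟩ else ⟨1, i⟩

/-! ### Combing braids acting on an inserted last strand -/

section

variable {G : Type*} [Group G] {t : ℕ → G} {n : ℕ}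

open Strand

/-- An inverse crossing moves the right-hand entry to the left unchanged and acts on the other one
by its inverse degree, which is `1` for the last strand. -/
theorem seqAct_genInv_insertStrand (ht : t n = 1) {j : ℕ} (hj : j < n) (g : G) :
    (rack t).seqAct (n + 1) (genInv (n + 1) j) (insertStrand (j + 1) ⟨g, n⟩) =
      insertStrand j ⟨g, n⟩ := by
  rw [genInv, map_inv, AugRack.seqAct_gen _ (by omega)]
  funext i
  rw [AugRack.cross_inv_apply]
  simp only [insertStrand, rack_deg]
  rcases lt_trichotomy i j with h | rfl | h
  · simp [h, h.ne, show i ≠ j + 1 by omega, show i < j + 1 by omega]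
  · simp
  · by_cases h2 : i = j + 1
    · subst h2
      simp [ht, hj]
    · simp [h2, h.not_gt, h.ne', show ¬ i < j + 1 by omega]

theorem seqAct_strandChain_insertStrand (ht : t n = 1) {p : ℕ} (hp : p ≤ n) (g : G) :
    (rack t).seqAct (n + 1) (strandChain (genInv (n + 1)) n p) (insertStrand n ⟨g, n⟩) =
      insertStrand p ⟨g, n⟩ := by
  induction hp using Nat.decreasingInduction with
  | self => simp [strandChain_self]
  | of_succ p hp ih =>
    rw [strandChain_of_lt _ hp, map_mul, Equiv.Perm.mul_apply, ih,
      seqAct_genInv_insertStrand ht hp]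

/-- The chain and the first crossing with strand `i` are free of charge. In the second crossing
strand `i` moves back to the left and acts on the last strand by its inverse degree, so the group
coordinate of the last strand records the pure braid. -/
theorem seqAct_pureGen_insertStrand (ht : t n = 1) {i : ℕ} (hi : i < n) (g : G) :
    (rack t).seqAct (n + 1) (pureGen (genInv (n + 1)) n i) (insertStrand n ⟨g, n⟩) =
      insertStrand n ⟨(t i)⁻¹ * g, n⟩ := by
  rw [pureGen, map_mul, map_mul, map_inv, Equiv.Perm.mul_apply, Equiv.Perm.mul_apply,
    Equiv.Perm.inv_eq_iff_eq, seqAct_strandChain_insertStrand ht hi,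
    seqAct_strandChain_insertStrand ht hi, map_mul, Equiv.Perm.mul_apply,
    seqAct_genInv_insertStrand ht hi, genInv, map_inv, AugRack.seqAct_gen _ (by omega)]
  funext l
  rw [AugRack.cross_inv_apply]
  rcases lt_trichotomy l i with h | rfl | h
  · simp [insertStrand, h, h.ne, show l ≠ i + 1 by omega, show l < i + 1 by omega]
  · simp [insertStrand, hi]
  · by_cases h2 : l = i + 1
    · subst h2
      ext <;> simp [insertStrand, rack_deg, show i + 1 ≤ n by omega]
    · simp [insertStrand, h2, h.not_gt, h.ne', show ¬ l < i + 1 by omega]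

theorem insertStrand_last_one : insertStrand n (⟨1, n⟩ : Strand G) = base G := by
  funext i
  simp only [insertStrand, base]
  split_ifs with h1 h2 h3 <;> first | rfl | (subst h2; rfl) | omega

end

open Strand in
/-- A homomorphism from `B_n` to a finite group is detected by an augmented rack over a finite
group. -/
theorem exists_detecting_rack (n : ℕ) {Q : Type v} [Group Q] (φ : BraidGroup n →* Q) :
    ∃ (G : Type v) (_ : Group G) (t : ℕ → G), (Finite Q → Finite G) ∧ (∀ i ≥ n, t i = 1) ∧
      ∀ β, (rack t).seqAct n β (base G) = base G → φ β = 1 := by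
  induction n with
  | zero =>
    refine ⟨Q, inferInstance, fun _ => 1, id, fun _ _ => rfl, fun β _ => ?_⟩
    have := braidGroup_subsingleton (n := 0) (by omega)
    rw [Subsingleton.elim β 1, map_one]
  | succ n ih =>
    obtain ⟨G, _, t, hfin, ht, hdet⟩ := ih (φ.comp (inclBraid n))
    -- Combing uses the inverse generators because these move the last strand, of degree `1`, to the
    -- left without any effect on the entries.
    set s := genInv (n + 1) with hs
    -- The first component handles the braid on `n` strands by induction. The second is chosen so
    -- that `pureGen s n i` multiplies the last strand by an element with `Q`-component `φ (pureGen
    -- s n i)`.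
    let t' : ℕ → G × Q := fun i => if i < n then (t i, (φ (pureGen s n i))⁻¹) else 1
    have ht' : t' n = 1 := by simp [t']
    refine ⟨G × Q, inferInstance, t', fun h => have := hfin h; inferInstance,
      fun i hi => by simp [t', show ¬ i < n by omega], fun β hβ => ?_⟩
    have hperm := toPerm_eq_one _ hβ
    have hmem : β ∈ Subgroup.closure (s '' {j | j < n}) := by rw [hs, closure_genInv]; trivial
    have hb : ∀ j, j + 1 < n → s j * s (j + 1) * s j = s (j + 1) * s j * s (j + 1) :=
      fun j hj => genInv_braid (by omega)
    have hc : ∀ i j, i + 1 < j → j < n → s i * s j = s j * s i := fun i j h _ => genInv_comm h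
    obtain ⟨p, hp, h, hh, u, hu, rfl⟩ := exists_comb hb hc hmem
    obtain ⟨γ, rfl⟩ := mem_range_inclBraid hh
    -- A braid fixing the base sequence has trivial permutation, so the chain in its combed form is
    -- trivial.
    have hpn : p = n := by
      have h1 := congrArg (fun π : Equiv.Perm (Fin (n + 1)) => (π (Fin.last n) : ℕ)) hperm
      simp only [map_mul, Equiv.Perm.mul_apply, toPerm_combSubgroup hu, Equiv.Perm.one_apply,
        toPerm_inclBraid_last] at h1
      rwa [hs, toPerm_strandChain hp] at h1
    subst hpn
    rw [strandChain_self, one_mul] at hβ ⊢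
    -- The comb subgroup moves only the last strand, by left translations whose `Q`-component is the
    -- value of `φ`.
    have key : ∃ c : G × Q, c.2 = φ u ∧ ∀ g : G × Q,
        (rack t').seqAct (p + 1) u (insertStrand p ⟨g, p⟩) = insertStrand p ⟨c * g, p⟩ := by
      clear hβ hperm hmem
      induction hu using Subgroup.closure_induction with
      | mem x hx =>
        obtain ⟨i, hi, rfl⟩ := hx
        change i < p at hi
        refine ⟨(t' i)⁻¹, by simp [t', hi], fun g => seqAct_pureGen_insertStrand ht' hi g⟩
      | one => exact ⟨1, by simp, by simp⟩
      | mul x y _ _ hx hy =>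
        obtain ⟨c, hc, hx⟩ := hx
        obtain ⟨d, hd, hy⟩ := hy
        exact ⟨c * d, by simp [hc, hd], fun g => by
          rw [map_mul, Equiv.Perm.mul_apply, hy, hx, mul_assoc]⟩
      | inv x _ hx =>
        obtain ⟨c, hc, hx⟩ := hx
        exact ⟨c⁻¹, by simp [hc], fun g => by
          rw [map_inv, Equiv.Perm.inv_eq_iff_eq, hx, mul_inv_cancel_left]⟩
    obtain ⟨c, hc, hu'⟩ := key
    have hu1 := hu' 1
    rw [insertStrand_last_one, mul_one] at hu1
    rw [map_mul, Equiv.Perm.mul_apply, hu1, AugRack.seqAct_inclBraid] at hβ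
    -- The remaining factor leaves position `p` alone, so the last strand must already be back at
    -- `1`.
    have hc1 : c = 1 := by
      have := congrFun hβ p
      rw [AugRack.seqAct_of_le _ _ _ le_rfl] at this
      simpa [insertStrand, base] using this
    rw [hc1, insertStrand_last_one] at hβ
    have hγ : φ (inclBraid p γ) = 1 := by
      refine hdet γ ?_
      -- Projecting `G × Q` to `G` turns the degrees `t'` into `t`; for labels beyond the range of
      -- `t` this needs the clause `t i = 1` in the induction hypothesis.
      have h1 := AugRack.seqAct_map (rack t') (rack t) (f := fun z => ⟨z.val.1, z.label⟩)
        (fun y z => by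
          have : (t' y.label).1 = t y.label := by
            simp only [t']
            split_ifs with h
            · rfl
            · rw [ht _ (by omega)]; rfl
          ext <;> simp [rack_deg, this]) γ (base (G × Q))
      rw [hβ] at h1
      exact h1
    rw [map_mul, hγ, one_mul, ← hc, hc1]
    rfl

/-- A braid which fixes the base sequence of free strands fixes all sequences of the same degrees. -/
theorem seqAct_eq_of_base {n : ℕ} {G Y : Type*} [Group G] [MulAction G Y] (R : AugRack G Y)
    (w : ℕ → Y) {t : ℕ → G} (ht : ∀ i, t i = R.deg (w i)) {β : BraidGroup n}
    (h : (Strand.rack t).seqAct n β (Strand.base G) = Strand.base G) : R.seqAct n β w = w := by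
  -- The strand with coordinate `g` and label `i` is sent to `g • w i`, which carries the base
  -- sequence to `w`.
  have h2 := AugRack.seqAct_map (Strand.rack t) R
    (f := fun z => z.val • w z.label) (fun y z => by
      simp only [Strand.rack_deg, Strand.smul_val, Strand.smul_label, ht, R.deg_smul, mul_smul])
    β (Strand.base G)
  rw [h] at h2
  have h3 : (fun z : Strand G => z.val • w z.label) ∘ Strand.base G = w := by
    funext i; simp [Strand.base]
  rwa [h3] at h2

/-- The braids which fix the base sequence of free strands. -/
def baseStabilizer {G : Type*} [Group G] (n : ℕ) (t : ℕ → G) : Subgroup (BraidGroup n) :=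
  (MulAction.stabilizer (Equiv.Perm (ℕ → Strand G)) (Strand.base G)).comap
    ((Strand.rack t).seqAct n)

theorem mem_baseStabilizer {G : Type*} [Group G] {n : ℕ} {t : ℕ → G} {β : BraidGroup n} :
    β ∈ baseStabilizer n t ↔ (Strand.rack t).seqAct n β (Strand.base G) = Strand.base G := Iff.rfl

/-- The image of the base sequence is determined by finite data: the permutation, which fixes the
labels, and the `n` group coordinates. -/
theorem finiteIndex_baseStabilizer {G : Type*} [Group G] [Finite G] (n : ℕ) (t : ℕ → G) :
    (baseStabilizer n t).FiniteIndex := by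
  let f : BraidGroup n → Equiv.Perm (Fin n) × (Fin n → G) := fun β =>
    (toPerm n β, fun i => ((Strand.rack t).seqAct n β (Strand.base G) i).val)
  have hf : ∀ β γ, f β = f γ → β⁻¹ * γ ∈ baseStabilizer n t := by
    intro β γ h
    rw [mem_baseStabilizer, map_mul, map_inv, Equiv.Perm.mul_apply, Equiv.Perm.inv_eq_iff_eq]
    funext i
    by_cases hi : i < n
    · ext
      · exact (congrFun (congrArg Prod.snd h) ⟨i, hi⟩).symm
      · have h1 : toPerm n β = toPerm n γ := congrArg Prod.fst h
        obtain ⟨j, hj⟩ := (toPerm n β).surjective ⟨i, hi⟩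
        have h2 := fun δ => (Strand.rack t).seqAct_label (f := Strand.label) (by simp) δ
          (Strand.base G) j
        have h3 := h2 β
        have h4 := h2 γ
        rw [hj] at h3
        rw [← h1, hj] at h4
        exact h4.trans h3.symm
    · rw [AugRack.seqAct_of_le _ _ _ (by omega), AugRack.seqAct_of_le _ _ _ (by omega)]
  have : Finite (BraidGroup n ⧸ baseStabilizer n t) := by
    refine Finite.of_injective (fun q => f q.out) fun q r h => ?_
    rw [← q.out_eq', ← r.out_eq']
    exact QuotientGroup.eq.2 (hf _ _ h)
  exact Subgroup.finiteIndex_of_finite_quotient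

/-- The constant extension by `1` of a finite sequence in a group. -/
def extendOne {G : Type*} [One G] {n : ℕ} (t : Fin n → G) (i : ℕ) : G :=
  if h : i < n then t ⟨i, h⟩ else 1

/-- Braid groups act through a common finite quotient on all augmented racks over a finite group. -/
theorem exists_finiteIndex_seqAct_eq (n : ℕ) (G : Type*) [Group G] [Finite G] :
    ∃ K : Subgroup (BraidGroup n), K.FiniteIndex ∧ ∀ β ∈ K,
      ∀ (Y : Type v) [MulAction G Y] (R : AugRack G Y) (w : ℕ → Y), (∀ i ≥ n, R.deg (w i) = 1) →
        R.seqAct n β w = w := by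
  -- Only finitely many degree sequences occur, as the degrees beyond the first `n` are trivial;
  -- hence `Y` may be infinite.
  refine ⟨⨅ t : Fin n → G, baseStabilizer n (extendOne t),
    Subgroup.finiteIndex_iInf fun t => finiteIndex_baseStabilizer n _, ?_⟩
  intro β hβ Y _ R w hw
  have hβ' := Subgroup.mem_iInf.1 hβ fun i => R.deg (w i)
  refine seqAct_eq_of_base R w (fun i => ?_) (mem_baseStabilizer.1 hβ')
  rw [extendOne]
  split_ifs with h
  · rfl
  · exact (hw _ (by omega)).symm

/-! ## The braided Hopf algebra of words in an augmented rack -/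

section Words

variable {G X : Type*} [Group G] [MulAction G X]

instance : MulDistribMulAction G (FreeMonoid X) where
  smul g w := FreeMonoid.map (g • ·) w
  one_smul w := by
    change FreeMonoid.map _ w = w
    simp only [one_smul]
    exact DFunLike.congr_fun FreeMonoid.map_id w
  mul_smul g h w := by
    change FreeMonoid.map _ w = FreeMonoid.map _ (FreeMonoid.map _ w)
    simp [FreeMonoid.map_map, Function.comp_def, mul_smul]
  smul_mul g a b := map_mul (FreeMonoid.map _) a b
  smul_one g := map_one (FreeMonoid.map _)

@[simp] theorem smul_of (g : G) (x : X) : g • FreeMonoid.of x = FreeMonoid.of (g • x) :=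
  FreeMonoid.map_of _ x

namespace AugRack

variable (R : AugRack G X)

/-- The degree of a word is the product of the degrees of its letters. -/
def degHom : FreeMonoid X →* G := FreeMonoid.lift R.deg

@[simp] theorem degHom_of (x : X) : R.degHom (FreeMonoid.of x) = R.deg x := by simp [degHom]

theorem degHom_mul (v w : FreeMonoid X) : R.degHom (v * w) = R.degHom v * R.degHom w :=
  map_mul _ v w

@[simp] theorem degHom_smul (g : G) (w : FreeMonoid X) :
    R.degHom (g • w) = g * R.degHom w * g⁻¹ := by
  induction w using FreeMonoid.inductionOn' with
  | one => simp
  | of_mul x w ih => simp [smul_mul', ih, R.deg_smul, mul_assoc]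

/-- The augmented rack of words. -/
def words : AugRack G (FreeMonoid X) where
  deg := R.degHom
  deg_smul := R.degHom_smul

end AugRack

/-- The tensor algebra on the vector space with basis an augmented rack, with its basis of words. -/
def WordAlg (k : Type*) [Field k] (_ : AugRack G X) : Type _ := MonoidAlgebra k (FreeMonoid X)

namespace WordAlg

variable {k : Type*} [Field k] {R : AugRack G X}

noncomputable instance : Ring (WordAlg k R) := inferInstanceAs (Ring (MonoidAlgebra k _))
noncomputable instance : Algebra k (WordAlg k R) := inferInstanceAs (Algebra k (MonoidAlgebra k _))

variable (k R) in
/-- The basis of words. -/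
noncomputable def wordBasis : Module.Basis (FreeMonoid X) k (WordAlg k R) := MonoidAlgebra.basis _ k

variable (k R) in
/-- The monomial of a word. -/
noncomputable def word : FreeMonoid X →* WordAlg k R := MonoidAlgebra.of k _

theorem wordBasis_apply (w : FreeMonoid X) : wordBasis k R w = word k R w := rfl

section

variable {M : Type*} [AddCommMonoid M] [Module k M]

/-- The linear extension of a function on words. -/
noncomputable def lin (f : FreeMonoid X → M) : WordAlg k R →ₗ[k] M := (wordBasis k R).constr k f

@[simp] theorem lin_word (f : FreeMonoid X → M) (w : FreeMonoid X) :
    lin (R := R) f (word k R w) = f w := by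
  rw [← wordBasis_apply]; simp [lin]

theorem hom_ext {f g : WordAlg k R →ₗ[k] M} (h : ∀ w, f (word k R w) = g (word k R w)) : f = g :=
  (wordBasis k R).ext h

theorem hom_ext₂ {f g : WordAlg k R ⊗[k] WordAlg k R →ₗ[k] M}
    (h : ∀ v w, f (word k R v ⊗ₜ word k R w) = g (word k R v ⊗ₜ word k R w)) : f = g :=
  TensorProduct.ext (hom_ext fun v => hom_ext fun w => h v w)

theorem hom_ext₃ {f g : (WordAlg k R ⊗[k] WordAlg k R) ⊗[k] WordAlg k R →ₗ[k] M}
    (h : ∀ u v w, f ((word k R u ⊗ₜ word k R v) ⊗ₜ word k R w) =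
      g ((word k R u ⊗ₜ word k R v) ⊗ₜ word k R w)) : f = g :=
  TensorProduct.ext (hom_ext₂ fun u v => hom_ext fun w => h u v w)

end

/-- The action of the group on words, by algebra maps. -/
noncomputable def act (g : G) : WordAlg k R →ₐ[k] WordAlg k R :=
  MonoidAlgebra.mapDomainAlgHom k k (MulDistribMulAction.toMonoidHom (FreeMonoid X) g)

@[simp] theorem act_word (g : G) (w : FreeMonoid X) :
    act g (word k R w) = word k R (g • w) := by
  change MonoidAlgebra.mapDomainAlgHom k k _ (MonoidAlgebra.of k _ w) = MonoidAlgebra.of k _ _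
  simp

variable (k R) in
/-- The braiding `v ⊗ w ↦ |v| w ⊗ v`. -/
noncomputable def braidMap : WordAlg k R ⊗[k] WordAlg k R →ₗ[k] WordAlg k R ⊗[k] WordAlg k R :=
  TensorProduct.lift (lin fun v => lin fun w => word k R (R.degHom v • w) ⊗ₜ word k R v)

@[simp] theorem braidMap_word (v w : FreeMonoid X) :
    braidMap k R (word k R v ⊗ₜ word k R w) = word k R (R.degHom v • w) ⊗ₜ word k R v := by
  simp [braidMap]

variable (k R) in
/-- The inverse braiding. -/
noncomputable def braidInv : WordAlg k R ⊗[k] WordAlg k R →ₗ[k] WordAlg k R ⊗[k] WordAlg k R :=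
  TensorProduct.lift (lin fun v => lin fun w => word k R w ⊗ₜ word k R ((R.degHom w)⁻¹ • v))

@[simp] theorem braidInv_word (v w : FreeMonoid X) :
    braidInv k R (word k R v ⊗ₜ word k R w) = word k R w ⊗ₜ word k R ((R.degHom w)⁻¹ • v) := by
  simp [braidInv]

variable (k R) in
/-- The braiding of the algebra of words. -/
noncomputable def braiding : Braiding k (WordAlg k R) where
  σ := LinearEquiv.ofLinearMap (braidMap k R) (braidInv k R)
    (hom_ext₂ fun v w => by simp) (hom_ext₂ fun v w => by simp)
  braid_eq := by
    apply hom_ext₃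
    intro u v w
    simp [applyRight, smul_smul]

@[simp] theorem braiding_word (v w : FreeMonoid X) :
    (braiding k R).σ (word k R v ⊗ₜ word k R w) = word k R (R.degHom v • w) ⊗ₜ word k R v :=
  braidMap_word v w

variable (k R) in
/-- Multiplication by `x ⊗ 1 + 1 ⊗ x` from the left, in the braided tensor square. -/
noncomputable def comulOp (x : X) : Module.End k (WordAlg k R ⊗[k] WordAlg k R) :=
  (LinearMap.mulLeft k (word k R (.of x))).rTensor _ +
    TensorProduct.map (act (R.deg x)).toLinearMap (LinearMap.mulLeft k (word k R (.of x)))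

@[simp] theorem comulOp_tmul (x : X) (a b : WordAlg k R) : comulOp k R x (a ⊗ₜ b) =
    (word k R (.of x) * a) ⊗ₜ b + act (R.deg x) a ⊗ₜ (word k R (.of x) * b) := by
  simp [comulOp]

variable (k R) in
/-- The comultiplication for which the letters are primitive. -/
noncomputable def comulMap : WordAlg k R →ₗ[k] WordAlg k R ⊗[k] WordAlg k R :=
  lin fun w => FreeMonoid.lift (comulOp k R) w (1 ⊗ₜ 1)

@[simp] theorem comulMap_one : comulMap k R 1 = 1 ⊗ₜ 1 := by
  rw [← map_one (word k R), comulMap, lin_word, map_one, Module.End.one_apply]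
  simp only [map_one]

theorem comulMap_mul (x : X) (a : WordAlg k R) :
    comulMap k R (word k R (.of x) * a) = comulOp k R x (comulMap k R a) := by
  have : comulMap k R ∘ₗ LinearMap.mulLeft k (word k R (.of x)) =
      comulOp k R x ∘ₗ comulMap k R := hom_ext fun w => by
    rw [LinearMap.comp_apply, LinearMap.comp_apply, LinearMap.mulLeft_apply, ← map_mul (word k R),
      comulMap, lin_word, lin_word, map_mul, Module.End.mul_apply, FreeMonoid.lift_eval_of]
  exact LinearMap.congr_fun this a

variable (k R) in
/-- The counit. -/
noncomputable def counitMap : WordAlg k R →ₐ[k] k :=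
  MonoidAlgebra.lift k k _ (FreeMonoid.lift fun _ => 0)

@[simp] theorem counitMap_of (x : X) : counitMap k R (word k R (.of x)) = 0 := by
  change MonoidAlgebra.lift k k _ _ (MonoidAlgebra.of k _ _) = 0
  rw [MonoidAlgebra.lift_of]
  simp

@[simp] theorem counitMap_act (g : G) (a : WordAlg k R) : counitMap k R (act g a) = counitMap k R a := by
  have : (counitMap k R).toLinearMap ∘ₗ (act g).toLinearMap = (counitMap k R).toLinearMap :=
    hom_ext fun w => by
      simp only [LinearMap.comp_apply, AlgHom.toLinearMap_apply]
      induction w using FreeMonoid.inductionOn' with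
      | one => simp
      | of_mul x w ih => rw [map_mul, map_mul, map_mul, map_mul]; simp
  exact LinearMap.congr_fun this a

/-- A letter entering the second tensor factor acts on the first one by its degree, so compatibility
with the braiding and coassociativity both rest on this equivariance. -/
theorem comulMap_act (g : G) (a : WordAlg k R) : comulMap k R (act g a) =
    TensorProduct.map (act g).toLinearMap (act g).toLinearMap (comulMap k R a) := by
  have h1 : ∀ x t, comulOp k R (g • x) (TensorProduct.map (act g).toLinearMap (act g).toLinearMap t)
      = TensorProduct.map (act g).toLinearMap (act g).toLinearMap (comulOp k R x t) := by
    intro x t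
    refine LinearMap.congr_fun (f := comulOp k R (g • x) ∘ₗ TensorProduct.map _ _)
      (g := TensorProduct.map _ _ ∘ₗ comulOp k R x) (hom_ext₂ fun v w => ?_) t
    simp [← map_mul, smul_smul, R.deg_smul, smul_mul']
  have : comulMap k R ∘ₗ (act g).toLinearMap =
      TensorProduct.map (act g).toLinearMap (act g).toLinearMap ∘ₗ comulMap k R :=
    hom_ext fun w => by
      simp only [LinearMap.comp_apply, AlgHom.toLinearMap_apply]
      induction w using FreeMonoid.inductionOn' with
      | one => simp
      | of_mul x w ih =>
        rw [map_mul, map_mul, act_word, smul_of, comulMap_mul, ih, h1, comulMap_mul]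
  exact LinearMap.congr_fun this a

theorem word_induction {P : WordAlg k R → Prop} (one : P 1)
    (mul_of : ∀ x a, P a → P (word k R (.of x) * a)) (w : FreeMonoid X) : P (word k R w) := by
  induction w using FreeMonoid.inductionOn' with
  | one => simpa using one
  | of_mul x w ih => rw [map_mul]; exact mul_of x _ ih

variable (k R) in
/-- The operator on the triple tensor product by which a letter contributes to the iterated
comultiplication. -/
noncomputable def comulOp₃ (x : X) : Module.End k (WordAlg k R ⊗[k] (WordAlg k R ⊗[k] WordAlg k R)) :=
  (LinearMap.mulLeft k (word k R (.of x))).rTensor _ +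
    TensorProduct.map (act (R.deg x)).toLinearMap (comulOp k R x)

/-- Both iterated coproducts turn left multiplication by a letter into the same operator `comulOp₃`,
and they agree on `1`. -/
theorem comulMap_coassoc : (TensorProduct.assoc k (WordAlg k R) (WordAlg k R) (WordAlg k R)).toLinearMap ∘ₗ
    (comulMap k R).rTensor (WordAlg k R) ∘ₗ comulMap k R =
      (comulMap k R).lTensor (WordAlg k R) ∘ₗ comulMap k R := by
  have h1 : ∀ x t, (comulMap k R).lTensor (WordAlg k R) (comulOp k R x t) =
      comulOp₃ k R x ((comulMap k R).lTensor (WordAlg k R) t) := by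
    intro x t
    induction t with
    | zero => simp
    | add s t hs ht => simp [hs, ht]
    | tmul a b => simp [comulOp₃, comulMap_mul]
  have h2 : ∀ x t, TensorProduct.assoc k (WordAlg k R) (WordAlg k R) (WordAlg k R)
      ((comulMap k R).rTensor (WordAlg k R) (comulOp k R x t)) =
      comulOp₃ k R x (TensorProduct.assoc k (WordAlg k R) (WordAlg k R) (WordAlg k R)
        ((comulMap k R).rTensor (WordAlg k R) t)) := by
    intro x t
    induction t with
    | zero => simp
    | add s t hs ht => simp [hs, ht]
    | tmul a b =>
      simp only [comulOp_tmul, map_add, LinearMap.rTensor_tmul, comulMap_mul, comulMap_act]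
      induction comulMap k R a with
      | zero => simp
      | add s t hs ht =>
        simp only [map_add, TensorProduct.add_tmul, ← hs, ← ht]
        abel
      | tmul c d =>
        simp [comulOp₃, TensorProduct.add_tmul, TensorProduct.tmul_add, add_assoc]
  apply hom_ext
  intro w
  simp only [LinearMap.comp_apply, LinearEquiv.coe_coe]
  refine word_induction (P := fun a => TensorProduct.assoc k _ _ _
    ((comulMap k R).rTensor (WordAlg k R) (comulMap k R a)) =
    (comulMap k R).lTensor (WordAlg k R) (comulMap k R a)) (by simp) (fun x a ih => ?_) w
  rw [comulMap_mul, h1, h2, ih]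

noncomputable instance : Coalgebra k (WordAlg k R) where
  comul := comulMap k R
  counit := (counitMap k R).toLinearMap
  coassoc := comulMap_coassoc
  rTensor_counit_comp_comul := by
    -- The counit kills the summand with the letter in the first factor, and it does not see the
    -- group action in the other summand.
    have h : ∀ x t, (counitMap k R).toLinearMap.rTensor (WordAlg k R) (comulOp k R x t) =
        (LinearMap.mulLeft k (word k R (.of x))).lTensor k
          ((counitMap k R).toLinearMap.rTensor (WordAlg k R) t) := by
      intro x t
      induction t with
      | zero => simp
      | add s t hs ht => simp [hs, ht]
      | tmul a b => simp
    apply hom_ext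
    intro w
    refine word_induction (P := fun a => (counitMap k R).toLinearMap.rTensor (WordAlg k R)
      (comulMap k R a) = 1 ⊗ₜ a) (by simp) (fun x a ih => ?_) w
    rw [comulMap_mul, h, ih, LinearMap.lTensor_tmul, LinearMap.mulLeft_apply]
  lTensor_counit_comp_comul := by
    have h : ∀ x t, (counitMap k R).toLinearMap.lTensor (WordAlg k R) (comulOp k R x t) =
        (LinearMap.mulLeft k (word k R (.of x))).rTensor k
          ((counitMap k R).toLinearMap.lTensor (WordAlg k R) t) := by
      intro x t
      induction t with
      | zero => simp
      | add s t hs ht => simp [hs, ht]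
      | tmul a b => simp
    apply hom_ext
    intro w
    refine word_induction (P := fun a => (counitMap k R).toLinearMap.lTensor (WordAlg k R)
      (comulMap k R a) = a ⊗ₜ 1) (by simp) (fun x a ih => ?_) w
    rw [comulMap_mul, h, ih, LinearMap.rTensor_tmul, LinearMap.mulLeft_apply]

theorem comul_eq : Coalgebra.comul (R := k) (A := WordAlg k R) = comulMap k R := rfl
theorem counit_eq : Coalgebra.counit (R := k) (A := WordAlg k R) = (counitMap k R).toLinearMap := rfl

theorem isPrimitive_of (x : X) : IsPrimitive k (word k R (.of x)) := by
  rw [IsPrimitive, comul_eq, ← mul_one (word k R (.of x)), comulMap_mul, comulMap_one]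
  simp

variable (k R) in
/-- The antipode. -/
noncomputable def antipodeMap : WordAlg k R →ₗ[k] WordAlg k R :=
  lin fun w => FreeMonoid.lift (M := Module.End k (WordAlg k R)) (fun x =>
    -(LinearMap.mulRight k (word k R (.of x)) ∘ₗ (act (R.deg x)).toLinearMap)) w 1

theorem antipodeMap_one : antipodeMap k R 1 = 1 := by
  rw [← map_one (word k R), antipodeMap, lin_word, map_one (FreeMonoid.lift _), Module.End.one_apply,
    map_one]

theorem antipodeMap_mul (x : X) (a : WordAlg k R) : antipodeMap k R (word k R (.of x) * a) =
    -(act (R.deg x) (antipodeMap k R a) * word k R (.of x)) := by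
  have : antipodeMap k R ∘ₗ LinearMap.mulLeft k (word k R (.of x)) =
      -(LinearMap.mulRight k (word k R (.of x)) ∘ₗ (act (R.deg x)).toLinearMap) ∘ₗ
        antipodeMap k R := hom_ext fun w => by
    rw [LinearMap.comp_apply, LinearMap.neg_apply, LinearMap.comp_apply, LinearMap.mulLeft_apply,
      ← map_mul (word k R), antipodeMap, lin_word, lin_word, map_mul (FreeMonoid.lift _), Module.End.mul_apply,
      FreeMonoid.lift_eval_of]
    rfl
  exact LinearMap.congr_fun this a

theorem act_act (g h : G) (a : WordAlg k R) : act g (act h a) = act (g * h) a := by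
  have : (act g).toLinearMap ∘ₗ (act h).toLinearMap = (act (k := k) (R := R) (g * h)).toLinearMap :=
    hom_ext fun w => by simp [mul_smul]
  exact LinearMap.congr_fun this a

theorem antipodeMap_act (g : G) (a : WordAlg k R) :
    antipodeMap k R (act g a) = act g (antipodeMap k R a) := by
  have : antipodeMap k R ∘ₗ (act g).toLinearMap = (act g).toLinearMap ∘ₗ antipodeMap k R :=
    hom_ext fun w => by
      simp only [LinearMap.comp_apply, AlgHom.toLinearMap_apply]
      refine word_induction (P := fun a => antipodeMap k R (act g a) = act g (antipodeMap k R a))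
        (by simp [antipodeMap_one]) (fun x a ih => ?_) w
      rw [map_mul, act_word, smul_of, antipodeMap_mul, ih, antipodeMap_mul, map_neg, map_mul,
        act_word, smul_of, act_act, act_act, R.deg_smul, inv_mul_cancel_right]
  exact LinearMap.congr_fun this a

/-- The two summands of `comulOp k R x t` cancel for every tensor `t`, so the induction hypothesis
is not needed. -/
theorem antipode_left (a : WordAlg k R) : LinearMap.mul' k (WordAlg k R)
    ((antipodeMap k R).rTensor (WordAlg k R) (comulMap k R a)) =
      algebraMap k _ (counitMap k R a) := by
  have h : ∀ x t, LinearMap.mul' k (WordAlg k R)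
      ((antipodeMap k R).rTensor (WordAlg k R) (comulOp k R x t)) = 0 := by
    intro x t
    induction t with
    | zero => simp
    | add s t hs ht => simp [hs, ht]
    | tmul a b => simp [antipodeMap_mul, antipodeMap_act, mul_assoc]
  have : LinearMap.mul' k (WordAlg k R) ∘ₗ (antipodeMap k R).rTensor (WordAlg k R) ∘ₗ comulMap k R =
      Algebra.linearMap k _ ∘ₗ (counitMap k R).toLinearMap := hom_ext fun w =>
    word_induction (P := fun a => LinearMap.mul' k (WordAlg k R)
      ((antipodeMap k R).rTensor (WordAlg k R) (comulMap k R a)) =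
        algebraMap k _ (counitMap k R a)) (by simp [antipodeMap_one])
      (fun x a _ => by rw [comulMap_mul, h]; simp) w
  exact LinearMap.congr_fun this a

/-- Here `comulOp k R x` becomes the braided commutator with `x`, which vanishes because by
induction the other entry is a scalar. -/
theorem antipode_right (a : WordAlg k R) : LinearMap.mul' k (WordAlg k R)
    ((antipodeMap k R).lTensor (WordAlg k R) (comulMap k R a)) =
      algebraMap k _ (counitMap k R a) := by
  have h : ∀ x t, LinearMap.mul' k (WordAlg k R)
      ((antipodeMap k R).lTensor (WordAlg k R) (comulOp k R x t)) =
      word k R (.of x) * LinearMap.mul' k (WordAlg k R)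
        ((antipodeMap k R).lTensor (WordAlg k R) t) -
      act (R.deg x) (LinearMap.mul' k (WordAlg k R)
        ((antipodeMap k R).lTensor (WordAlg k R) t)) * word k R (.of x) := by
    intro x t
    induction t with
    | zero => simp
    | add s t hs ht => simp only [map_add, hs, ht, mul_add, add_mul]; abel
    | tmul a b => simp [antipodeMap_mul, mul_assoc, sub_eq_add_neg]
  have : LinearMap.mul' k (WordAlg k R) ∘ₗ (antipodeMap k R).lTensor (WordAlg k R) ∘ₗ comulMap k R =
      Algebra.linearMap k _ ∘ₗ (counitMap k R).toLinearMap := hom_ext fun w =>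
    word_induction (P := fun a => LinearMap.mul' k (WordAlg k R)
      ((antipodeMap k R).lTensor (WordAlg k R) (comulMap k R a)) =
        algebraMap k _ (counitMap k R a)) (by simp [antipodeMap_one])
      (fun x a ih => by
        rw [comulMap_mul, h, ih]
        simp [← Algebra.commutes]) w
  exact LinearMap.congr_fun this a

/-! ### Compatibility of the coproduct of words with the braiding and the product -/

theorem braiding_comul_left (v w : FreeMonoid X) :
    (TensorProduct.assoc k (WordAlg k R) (WordAlg k R) (WordAlg k R)).symm
      (word k R (R.degHom v • w) ⊗ₜ comulMap k R (word k R v)) =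
    (braiding k R).σ.toLinearMap.rTensor (WordAlg k R) (applyRight (braiding k R).σ.toLinearMap
      (comulMap k R (word k R v) ⊗ₜ word k R w)) := by
  induction v using FreeMonoid.inductionOn' with
  | one =>
    have := braiding_word (k := k) (R := R) 1 w
    simp only [map_one, one_smul] at this
    simp [applyRight, this]
  | of_mul x v ih =>
    have h : ∀ t, (braiding k R).σ.toLinearMap.rTensor (WordAlg k R)
        (applyRight (braiding k R).σ.toLinearMap (comulOp k R x t ⊗ₜ word k R w)) =
        ((TensorProduct.assoc k _ _ _).symm.toLinearMap ∘ₗ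
          TensorProduct.map (act (R.deg x)).toLinearMap (comulOp k R x) ∘ₗ
          (TensorProduct.assoc k _ _ _).toLinearMap)
        ((braiding k R).σ.toLinearMap.rTensor (WordAlg k R)
          (applyRight (braiding k R).σ.toLinearMap (t ⊗ₜ word k R w))) := by
      intro t
      refine LinearMap.congr_fun (f := (braiding k R).σ.toLinearMap.rTensor (WordAlg k R) ∘ₗ
        applyRight (braiding k R).σ.toLinearMap ∘ₗ
        (TensorProduct.mk k _ _).flip (word k R w) ∘ₗ comulOp k R x) (g := (((TensorProduct.assoc k _ _ _).symm.toLinearMap ∘ₗ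
          TensorProduct.map (act (R.deg x)).toLinearMap (comulOp k R x) ∘ₗ
          (TensorProduct.assoc k _ _ _).toLinearMap) ∘ₗ
        (braiding k R).σ.toLinearMap.rTensor (WordAlg k R) ∘ₗ
        applyRight (braiding k R).σ.toLinearMap ∘ₗ
        (TensorProduct.mk k _ _).flip (word k R w))) (hom_ext₂ fun a b => ?_) t
      simp [applyRight, TensorProduct.tmul_add, -map_mul, ← map_mul (word k R), R.degHom_mul,
        smul_smul, mul_assoc]
    rw [map_mul (word k R), comulMap_mul, h, ← ih]
    simp [mul_smul]

theorem braiding_comul_right (v w : FreeMonoid X) :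
    comulMap k R (word k R (R.degHom v • w)) ⊗ₜ word k R v =
    applyRight (braiding k R).σ.toLinearMap ((braiding k R).σ.toLinearMap.rTensor (WordAlg k R)
      ((TensorProduct.assoc k (WordAlg k R) (WordAlg k R) (WordAlg k R)).symm
        (word k R v ⊗ₜ comulMap k R (word k R w)))) := by
  have h : ∀ t, applyRight (braiding k R).σ.toLinearMap
      ((braiding k R).σ.toLinearMap.rTensor (WordAlg k R)
      ((TensorProduct.assoc k (WordAlg k R) (WordAlg k R) (WordAlg k R)).symm
        (word k R v ⊗ₜ t))) =
      TensorProduct.map (act (R.degHom v)).toLinearMap (act (R.degHom v)).toLinearMap t ⊗ₜ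
        word k R v := by
    intro t
    refine LinearMap.congr_fun (f := applyRight (braiding k R).σ.toLinearMap ∘ₗ
      (braiding k R).σ.toLinearMap.rTensor (WordAlg k R) ∘ₗ
      (TensorProduct.assoc k (WordAlg k R) (WordAlg k R) (WordAlg k R)).symm.toLinearMap ∘ₗ
      TensorProduct.mk k _ _ (word k R v)) (g := (TensorProduct.mk k _ _).flip (word k R v) ∘ₗ
        TensorProduct.map (act (R.degHom v)).toLinearMap (act (R.degHom v)).toLinearMap)
      (hom_ext₂ fun a b => ?_) t
    simp [applyRight]
  rw [h, ← comulMap_act, act_word]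

/-- The map `B` is the product of the braided tensor square. Left multiplication by `x ⊗ 1 + 1 ⊗ x`
commutes with right multiplications there (`h2`), so induction on the first word applies. -/
theorem braided_comul_mul : Coalgebra.comul (R := k) (A := WordAlg k R) ∘ₗ
    LinearMap.mul' k (WordAlg k R) =
    TensorProduct.map (LinearMap.mul' k (WordAlg k R)) (LinearMap.mul' k (WordAlg k R)) ∘ₗ
      (TensorProduct.assoc k _ _ (WordAlg k R ⊗[k] WordAlg k R)).symm.toLinearMap ∘ₗ
      ((TensorProduct.assoc k _ _ _).toLinearMap ∘ₗ
        (braiding k R).σ.toLinearMap.rTensor (WordAlg k R) ∘ₗ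
        (TensorProduct.assoc k _ _ _).symm.toLinearMap).lTensor (WordAlg k R) ∘ₗ
      (TensorProduct.assoc k _ _ (WordAlg k R ⊗[k] WordAlg k R)).toLinearMap ∘ₗ
      TensorProduct.map (Coalgebra.comul (R := k) (A := WordAlg k R))
        (Coalgebra.comul (R := k) (A := WordAlg k R)) := by
  set B := TensorProduct.map (LinearMap.mul' k (WordAlg k R)) (LinearMap.mul' k (WordAlg k R)) ∘ₗ
      (TensorProduct.assoc k _ _ (WordAlg k R ⊗[k] WordAlg k R)).symm.toLinearMap ∘ₗ
      ((TensorProduct.assoc k _ _ _).toLinearMap ∘ₗ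
        (braiding k R).σ.toLinearMap.rTensor (WordAlg k R) ∘ₗ
        (TensorProduct.assoc k _ _ _).symm.toLinearMap).lTensor (WordAlg k R) ∘ₗ
      (TensorProduct.assoc k _ _ (WordAlg k R ⊗[k] WordAlg k R)).toLinearMap with hB
  have hBw : ∀ a b c d, B ((word k R a ⊗ₜ word k R b) ⊗ₜ (word k R c ⊗ₜ word k R d)) =
      word k R (a * R.degHom b • c) ⊗ₜ word k R (b * d) := by
    intro a b c d
    simp [hB, map_mul]
  have h1 : ∀ t, B ((1 ⊗ₜ 1) ⊗ₜ t) = t := fun t => by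
    refine LinearMap.congr_fun (f := B ∘ₗ TensorProduct.mk k _ _ (1 ⊗ₜ 1)) (g := LinearMap.id)
      (hom_ext₂ fun c d => ?_) t
    have := hBw 1 1 c d
    simpa using this
  have h2 : ∀ x s t, B (comulOp k R x s ⊗ₜ t) = comulOp k R x (B (s ⊗ₜ t)) := fun x s t => by
    have : B ∘ₗ (comulOp k R x).rTensor _ = comulOp k R x ∘ₗ B :=
      TensorProduct.ext (hom_ext₂ fun a b => hom_ext₂ fun c d => by
        simp [hBw, TensorProduct.add_tmul, -map_mul, ← map_mul (word k R), R.degHom_mul, smul_mul', mul_smul,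
          mul_assoc])
    exact LinearMap.congr_fun this (s ⊗ₜ t)
  have h3 : ∀ v b, comulMap k R (word k R v * b) =
      B (comulMap k R (word k R v) ⊗ₜ comulMap k R b) := by
    intro v b
    refine word_induction (P := fun a => comulMap k R (a * b) =
      B (comulMap k R a ⊗ₜ comulMap k R b)) (by simp [h1]) (fun x a ih => ?_) v
    rw [mul_assoc, comulMap_mul, ih, comulMap_mul, h2]
  apply hom_ext₂
  intro v w
  exact h3 v (word k R w)

variable (k R) in
/-- The braided Hopf algebra of words in an augmented rack. -/
noncomputable def hopf : BraidedHopfAlgebra k (WordAlg k R) where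
  toBraiding := braiding k R
  braid_mul_left := hom_ext₃ fun u v w => by
    simp [applyRight, -map_mul, ← map_mul (word k R), R.degHom_mul, mul_smul]
  braid_mul_right := hom_ext₃ fun u v w => by
    simp [applyRight, ← map_mul, smul_mul']
  braid_one_left a := by
    refine LinearMap.congr_fun (f := (braiding k R).σ.toLinearMap ∘ₗ TensorProduct.mk k _ _ 1)
      (g := (TensorProduct.mk k _ _).flip 1) (hom_ext fun w => ?_) a
    simpa using braiding_word (k := k) (R := R) 1 w
  braid_one_right a := by
    refine LinearMap.congr_fun (f := (braiding k R).σ.toLinearMap ∘ₗ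
      (TensorProduct.mk k _ _).flip 1) (g := TensorProduct.mk k _ _ 1) (hom_ext fun w => ?_) a
    simpa using braiding_word (k := k) (R := R) w 1
  braid_comul_left := hom_ext₂ fun v w => by
    simpa [comul_eq] using braiding_comul_left v w
  braid_comul_right := hom_ext₂ fun v w => by
    simpa [comul_eq] using braiding_comul_right v w
  braid_counit_left := hom_ext₂ fun v w => by
    -- Either `v` is empty and acts trivially, or its counit is zero.
    have : counitMap k R (word k R v) • word k R (R.degHom v • w) =
        counitMap k R (word k R v) • word k R w := by
      induction v using FreeMonoid.inductionOn' with
      | one => simp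
      | of_mul x v _ => simp
    simpa [counit_eq] using this
  braid_counit_right := hom_ext₂ fun v w => by
    have := counitMap_act (k := k) (R := R) (R.degHom v) (word k R w)
    rw [act_word] at this
    simp [counit_eq, this]
  comul_mul := braided_comul_mul
  comul_one := comulMap_one
  counit_mul := map_mul (counitMap k R)
  counit_one := map_one (counitMap k R)
  exists_antipode := ⟨antipodeMap k R, LinearMap.ext antipode_left, LinearMap.ext antipode_right⟩

end WordAlg

end Words

/-! ## A recursion for the elements `𝔖_{p,q}` -/

/-- The inclusion `B_n → B_{n+1}` of the braids which leave the first strand alone. -/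
def shiftBraid (n : ℕ) : BraidGroup n →* BraidGroup (n + 1) :=
  braidLift n (fun j => gen (n + 1) (j + 1)) (fun _ _ => gen_braid (by omega))
    (fun _ _ h _ => gen_comm (by omega))

theorem shiftBraid_gen {n j : ℕ} (h : j + 1 < n) : shiftBraid n (gen n j) = gen (n + 1) (j + 1) :=
  braidLift_gen _ _ _ _ h

section

variable {n : ℕ}

/-- The permutation which sends the first position to `x` and is `τ` on the remaining ones. -/
def movePerm (x : Fin (n + 1)) (τ : Equiv.Perm (Fin n)) : Equiv.Perm (Fin (n + 1)) :=
  x.cycleRange⁻¹ * Equiv.Perm.decomposeFin.symm (0, τ)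

theorem movePerm_symm_self (x : Fin (n + 1)) (τ : Equiv.Perm (Fin n)) :
    (movePerm x τ).symm x = 0 := by
  rw [Equiv.symm_apply_eq, movePerm, Equiv.Perm.mul_apply,
    Equiv.Perm.decomposeFin_symm_apply_zero]
  simp [Equiv.Perm.inv_def]

theorem movePerm_symm_succAbove (x : Fin (n + 1)) (τ : Equiv.Perm (Fin n)) (i : Fin n) :
    (movePerm x τ).symm (x.succAbove i) = (τ.symm i).succ := by
  rw [Equiv.symm_apply_eq, movePerm, Equiv.Perm.mul_apply,
    Equiv.Perm.decomposeFin_symm_apply_succ]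
  simp [Equiv.Perm.inv_def]

theorem movePerm_zero (x : Fin (n + 1)) (τ : Equiv.Perm (Fin n)) : movePerm x τ 0 = x := by
  rw [← movePerm_symm_self x τ, Equiv.apply_symm_apply]

theorem movePerm_injective (x : Fin (n + 1)) : Function.Injective (movePerm (n := n) x) := by
  intro τ τ' h
  have := Equiv.Perm.decomposeFin.symm.injective (mul_left_cancel h)
  exact (Prod.ext_iff.1 this).2

theorem exists_movePerm (τ : Equiv.Perm (Fin (n + 1))) : ∃ τ', movePerm (τ 0) τ' = τ := by
  obtain ⟨⟨y, τ'⟩, h⟩ := Equiv.Perm.decomposeFin.symm.surjective ((τ 0).cycleRange * τ)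
  have hy : y = 0 := by
    rw [← Equiv.Perm.decomposeFin_symm_apply_zero y τ', h]
    simp
  subst hy
  exact ⟨τ', by rw [movePerm, h, inv_mul_cancel_left]⟩

theorem invCount_eq_zero {p : ℕ} {τ : Equiv.Perm (Fin n)} (h : IsUnshuffle p τ) {v : Fin n}
    (hv : (v : ℕ) < p) : invCount τ v = 0 := by
  rw [invCount, Finset.card_eq_zero, Finset.filter_eq_empty_iff]
  rintro u - ⟨h1, h2⟩
  exact lt_asymm h2 (h u v h1 (Or.inl hv))

theorem invCount_movePerm_self (x : Fin (n + 1)) (τ : Equiv.Perm (Fin n)) :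
    invCount (movePerm x τ) x = x := by
  rw [invCount, ← card_val_lt (n := n + 1) x.2.le]
  congr 1
  ext u
  simp only [Finset.mem_filter, Finset.mem_univ, true_and, movePerm_symm_self, Fin.lt_def]
  refine ⟨fun h => h.1, fun h => ⟨h, ?_⟩⟩
  obtain ⟨w, hw⟩ := Fin.exists_succAbove_eq (x := u) (y := x) (by rintro rfl; omega)
  rw [← hw, movePerm_symm_succAbove]
  simp

theorem invCount_movePerm_succ (x : Fin (n + 1)) (τ : Equiv.Perm (Fin n)) (v : Fin n)
    (hv : (x : ℕ) ≤ v) : invCount (movePerm x τ) v.succ = invCount τ v := by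
  have hs : ∀ u : Fin n, (x.succAbove u : Fin (n + 1)) < v.succ ↔ u < v := by
    intro u
    rw [Fin.succAbove]
    split_ifs with h
    · simp only [Fin.lt_def, Fin.val_castSucc, Fin.val_succ] at h ⊢; omega
    · simp only [Fin.lt_def, Fin.val_succ] at h ⊢; omega
  have hv' : v.succ = x.succAbove v := by
    rw [Fin.succAbove_of_le_castSucc]
    simpa [Fin.le_def] using hv
  rw [invCount, invCount]
  symm
  apply Finset.card_bij (fun u _ => x.succAbove u)
  · intro u hu
    simp only [Finset.mem_filter, Finset.mem_univ, true_and] at hu ⊢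
    rw [hs, hv', movePerm_symm_succAbove, movePerm_symm_succAbove, Fin.succ_lt_succ_iff]
    exact hu
  · intro u _ u' _ h
    exact Fin.succAbove_right_injective h
  · intro u hu
    simp only [Finset.mem_filter, Finset.mem_univ, true_and] at hu
    have hux : u ≠ x := by
      rintro rfl
      rw [movePerm_symm_self] at hu
      simp at hu
    obtain ⟨w, rfl⟩ := Fin.exists_succAbove_eq hux
    rw [hs, hv', movePerm_symm_succAbove, movePerm_symm_succAbove, Fin.succ_lt_succ_iff] at hu
    exact ⟨w, by simpa using hu, rfl⟩

/-- The part of the reduced word of a permutation which belongs to the value `v`. -/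
def wordPart (τ : Equiv.Perm (Fin n)) (v : ℕ) : List ℕ :=
  if h : v < n then (List.range (invCount τ ⟨v, h⟩)).map fun t => v - 1 - t else []

theorem reducedWord_eq_flatMap (τ : Equiv.Perm (Fin n)) :
    reducedWord τ = (List.range n).flatMap (wordPart τ) := by
  rw [← List.map_coe_finRange_eq_range, List.flatMap_map]
  simp [reducedWord, wordPart]

/-- The value `x` stands first, so it is inverted with all `p` smaller values and contributes the
initial block. Values below it contribute nothing by assumption, and values above it keep their
inversions while all indices rise by one. -/
theorem reducedWord_movePerm {p : ℕ} (x : Fin (n + 1)) (hx : (x : ℕ) = p)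
    {τ : Equiv.Perm (Fin n)} (h : ∀ v : Fin n, (v : ℕ) < p → invCount τ v = 0)
    (h' : ∀ v : Fin (n + 1), (v : ℕ) < p → invCount (movePerm x τ) v = 0) :
    reducedWord (movePerm x τ) =
      (List.range p).map (fun t => p - 1 - t) ++ (reducedWord τ).map (· + 1) := by
  have hp : p ≤ n := by omega
  obtain ⟨q, rfl⟩ := Nat.exists_eq_add_of_le hp
  have e1 : (List.range p).flatMap (wordPart τ) = [] := by
    rw [List.flatMap_eq_nil_iff]
    intro v hv
    rw [List.mem_range] at hv
    rw [wordPart, dif_pos (by omega), h _ hv]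
    rfl
  have e2 : (List.range p).flatMap (wordPart (movePerm x τ)) = [] := by
    rw [List.flatMap_eq_nil_iff]
    intro v hv
    rw [List.mem_range] at hv
    rw [wordPart, dif_pos (by omega), h' _ hv]
    rfl
  have e3 : List.range (p + q + 1) =
      List.range p ++ [p] ++ (List.range q).map (fun t => p + 1 + t) := by
    rw [show p + q + 1 = p + 1 + q by omega, List.range_add, List.range_succ]
  rw [reducedWord_eq_flatMap, reducedWord_eq_flatMap, e3, List.range_add, List.flatMap_append,
    List.flatMap_append, List.flatMap_append, e1, e2, List.nil_append, List.nil_append]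
  congr 1
  · have hx' : x = ⟨p, by omega⟩ := Fin.ext hx
    rw [List.flatMap_singleton, wordPart, dif_pos (by omega), ← hx', invCount_movePerm_self, hx]
  · rw [List.flatMap_map, List.flatMap_map, List.map_flatMap]
    congr 1
    funext t
    by_cases ht : t < q
    · have h1 := invCount_movePerm_succ x τ ⟨p + t, by omega⟩ (by simp [hx])
      rw [wordPart, wordPart, dif_pos (by omega), dif_pos (by omega), List.map_map]
      have h2 : (⟨p + 1 + t, by omega⟩ : Fin (p + q + 1)) =
          (⟨p + t, by omega⟩ : Fin (p + q)).succ := Fin.ext (by simp; omega)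
      rw [h2, h1]
      apply List.map_congr_left
      intro s hs
      rw [List.mem_range] at hs
      -- This bound keeps the subtraction `v - 1 - t` from being truncated.
      have := invCount_le τ ⟨p + t, by omega⟩
      simp only [Function.comp] at this ⊢
      omega
    · rw [wordPart, wordPart, dif_neg (by omega), dif_neg (by omega)]
      rfl

theorem reducedWord_lt (τ : Equiv.Perm (Fin n)) : ∀ j ∈ reducedWord τ, j + 1 < n := by
  intro j hj
  simp only [reducedWord, List.mem_flatMap, List.mem_map, List.mem_range] at hj
  obtain ⟨v, -, t, ht, rfl⟩ := hj
  have := invCount_le τ v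
  omega

theorem matsumotoLift_movePerm {p : ℕ} (x : Fin (n + 1)) (hx : (x : ℕ) = p)
    {τ : Equiv.Perm (Fin n)} (h : ∀ v : Fin n, (v : ℕ) < p → invCount τ v = 0)
    (h' : ∀ v : Fin (n + 1), (v : ℕ) < p → invCount (movePerm x τ) v = 0) :
    matsumotoLift (movePerm x τ) = fatRight (n + 1) p 0 * shiftBraid n (matsumotoLift τ) := by
  rw [matsumotoLift, reducedWord_movePerm x hx h h', List.map_append, List.prod_append,
    matsumotoLift, map_list_prod, List.map_map, List.map_map, List.map_map, fatRight]
  congr 2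
  · apply List.map_congr_left
    intro t _
    simp
  · apply List.map_congr_left
    intro j hj
    exact (shiftBraid_gen (reducedWord_lt τ j hj)).symm

theorem isUnshuffle_movePerm_zero {p : ℕ} (τ : Equiv.Perm (Fin n)) :
    IsUnshuffle (p + 1) (movePerm 0 τ) ↔ IsUnshuffle p τ := by
  have hs : ∀ i : Fin n, (movePerm 0 τ).symm i.succ = (τ.symm i).succ := fun i => by
    rw [← movePerm_symm_succAbove]; rfl
  constructor
  · intro h i j hij hp
    have := h i.succ j.succ (by simpa using hij) (by simpa using hp)
    rwa [hs, hs, Fin.succ_lt_succ_iff] at this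
  · intro h i j hij hp
    induction j using Fin.cases with
    | zero => simp at hij
    | succ j =>
      induction i using Fin.cases with
      | zero => rw [movePerm_symm_self, hs]; simp
      | succ i =>
        rw [hs, hs, Fin.succ_lt_succ_iff]
        exact h i j (by simpa using hij) (by simpa using hp)

theorem isUnshuffle_movePerm {p : ℕ} (x : Fin (n + 1)) (hx : (x : ℕ) = p)
    (τ : Equiv.Perm (Fin n)) : IsUnshuffle p (movePerm x τ) ↔ IsUnshuffle p τ := by
  have hval : ∀ i : Fin n, ((x.succAbove i : Fin (n + 1)) : ℕ) = if (i : ℕ) < p then (i : ℕ)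
      else i + 1 := by
    intro i
    rw [Fin.succAbove]
    simp only [Fin.lt_def, Fin.val_castSucc, hx]
    split_ifs <;> simp
  have hlt : ∀ i j : Fin n, x.succAbove i < x.succAbove j ↔ i < j :=
    fun i j => Fin.succAbove_lt_succAbove_iff
  constructor
  · intro h i j hij hp
    have := h (x.succAbove i) (x.succAbove j) ((hlt i j).2 hij)
      (by rw [hval, hval]; split_ifs <;> omega)
    rwa [movePerm_symm_succAbove, movePerm_symm_succAbove, Fin.succ_lt_succ_iff] at this
  · intro h i j hij hp
    by_cases hj : j = x
    · subst hj
      rw [Fin.lt_def] at hij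
      omega
    obtain ⟨j, rfl⟩ := Fin.exists_succAbove_eq hj
    rw [movePerm_symm_succAbove]
    by_cases hi : i = x
    · subst hi
      rw [movePerm_symm_self]
      simp
    obtain ⟨i, rfl⟩ := Fin.exists_succAbove_eq hi
    rw [movePerm_symm_succAbove, Fin.succ_lt_succ_iff]
    rw [hval, hval] at hp
    refine h i j ((hlt i j).1 hij) ?_
    split_ifs at hp <;> omega

/-- A smaller value in the same block would have to stand before the first position, so the value
there is the least of its block. -/
theorem apply_zero_of_isUnshuffle {p : ℕ} {τ : Equiv.Perm (Fin (n + 1))} (h : IsUnshuffle p τ)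
    (h0 : τ 0 ≠ 0) : ((τ 0 : Fin (n + 1)) : ℕ) = p := by
  by_contra hne
  rcases lt_or_gt_of_ne hne with hlt | hlt
  · have := h 0 (τ 0) (Fin.pos_iff_ne_zero.2 h0) (Or.inl hlt)
    simp at this
  · have := h ⟨p, by omega⟩ (τ 0) hlt (Or.inr le_rfl)
    simp at this

theorem isUnshuffle_zero {τ : Equiv.Perm (Fin n)} (h : IsUnshuffle 0 τ) : τ = 1 := by
  have h1 : StrictMono τ.symm := fun i j hij => h i j hij (Or.inr (Nat.zero_le _))
  have h2 : τ.symm = 1 := by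
    ext i
    rw [Equiv.Perm.one_apply, StrictMono.range_inj h1 strictMono_id |>.1 (by simp)]
    rfl
  have : τ⁻¹ = 1 := h2
  simpa using this

variable (k : Type*) [Field k]

theorem matsumotoLift_one : matsumotoLift (1 : Equiv.Perm (Fin n)) = 1 := by
  have : reducedWord (1 : Equiv.Perm (Fin n)) = [] :=
    List.eq_nil_of_length_eq_zero (Nat.le_zero.1 (length_reducedWord_le 1 [] rfl))
  simp [matsumotoLift, this]

variable (n) in
theorem shuffleSum_zero : shuffleSum k n 0 = 1 := by
  classical
  rw [shuffleSum, Finset.sum_eq_single_of_mem 1, matsumotoLift_one, map_one]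
  · simp only [Finset.mem_filter, Finset.mem_univ, true_and]
    exact fun i j h _ => h
  · intro τ hτ h1
    exact absurd (isUnshuffle_zero (Finset.mem_filter.1 hτ).2) h1

variable (n) in
theorem shuffleSum_self : shuffleSum k n n = 1 := by
  classical
  have : shuffleSum k n n = shuffleSum k n 0 := by
    have : ∀ τ : Equiv.Perm (Fin n), IsUnshuffle n τ ↔ IsUnshuffle 0 τ := fun τ =>
      ⟨fun h i j hij _ => h i j hij (Or.inl j.2), fun h i j hij _ => h i j hij (Or.inr (zero_le))⟩
    simp only [shuffleSum]
    exact Finset.sum_congr (Finset.filter_congr fun τ _ => this τ) fun _ _ => rfl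
  rw [this, shuffleSum_zero]

/-- The inclusion of group algebras induced by `shiftBraid`. -/
noncomputable def shiftAlg (n : ℕ) :
    MonoidAlgebra k (BraidGroup n) →ₐ[k] MonoidAlgebra k (BraidGroup (n + 1)) :=
  MonoidAlgebra.mapDomainAlgHom k k (shiftBraid n)

theorem shiftAlg_of (β : BraidGroup n) :
    shiftAlg k n (MonoidAlgebra.of k _ β) = MonoidAlgebra.of k _ (shiftBraid n β) := by
  simp [shiftAlg]

/-- Splitting the unshuffles according to the image of the first position. -/
theorem shuffleSum_succ (n p : ℕ) : shuffleSum k (n + 1) (p + 1) = shiftAlg k n (shuffleSum k n p) +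
    if p + 1 ≤ n then MonoidAlgebra.of k _ (fatRight (n + 1) (p + 1) 0) *
      shiftAlg k n (shuffleSum k n (p + 1)) else 0 := by
  classical
  rw [shuffleSum, ← Finset.sum_filter_add_sum_filter_not _ (fun τ : Equiv.Perm _ => τ 0 = 0)]
  congr 1
  · rw [shuffleSum, map_sum]
    symm
    apply Finset.sum_nbij (movePerm 0)
    · intro τ hτ
      simp only [Finset.mem_filter, Finset.mem_univ, true_and] at hτ ⊢
      exact ⟨(isUnshuffle_movePerm_zero τ).2 hτ, movePerm_zero 0 τ⟩
    · exact (movePerm_injective 0).injOn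
    · intro τ hτ
      simp only [Finset.coe_filter, Finset.mem_filter, Finset.mem_univ, true_and] at hτ
      obtain ⟨τ', h⟩ := exists_movePerm τ
      change IsUnshuffle (p + 1) τ ∧ τ 0 = 0 at hτ
      rw [hτ.2] at h
      refine ⟨τ', ?_, h⟩
      simp only [Finset.coe_filter, Finset.mem_univ, true_and]
      change IsUnshuffle p τ'
      rw [← isUnshuffle_movePerm_zero, h]
      exact hτ.1
    · intro τ _
      rw [shiftAlg_of, matsumotoLift_movePerm (p := 0) 0 rfl (by simp) (by simp), fatRight_zero,
        one_mul]
  · split_ifs with hp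
    · set x : Fin (n + 1) := ⟨p + 1, by omega⟩ with hx
      rw [shuffleSum, map_sum, Finset.mul_sum]
      symm
      apply Finset.sum_nbij (movePerm x)
      · intro τ hτ
        simp only [Finset.mem_filter, Finset.mem_univ, true_and] at hτ ⊢
        refine ⟨(isUnshuffle_movePerm x rfl τ).2 hτ, ?_⟩
        rw [movePerm_zero]
        simp [hx, Fin.ext_iff]
      · exact (movePerm_injective x).injOn
      · intro τ hτ
        simp only [Finset.coe_filter, Finset.mem_filter, Finset.mem_univ, true_and] at hτ
        change IsUnshuffle (p + 1) τ ∧ ¬ τ 0 = 0 at hτ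
        obtain ⟨τ', h⟩ := exists_movePerm τ
        have h0 : τ 0 = x := Fin.ext (apply_zero_of_isUnshuffle hτ.1 hτ.2)
        rw [h0] at h
        refine ⟨τ', ?_, h⟩
        simp only [Finset.coe_filter, Finset.mem_univ, true_and]
        change IsUnshuffle (p + 1) τ'
        rw [← isUnshuffle_movePerm x rfl, h]
        exact hτ.1
      · intro τ hτ
        simp only [Finset.mem_filter, Finset.mem_univ, true_and] at hτ
        rw [shiftAlg_of, ← map_mul, matsumotoLift_movePerm (p := p + 1) x rfl
          (fun v hv => invCount_eq_zero hτ hv)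
          (fun v hv => invCount_eq_zero ((isUnshuffle_movePerm x rfl τ).2 hτ) hv)]
    -- If `p + 1` exceeds `n`, the second block is empty and no unshuffle moves the first position.
    · apply Finset.sum_eq_zero
      intro τ hτ
      simp only [Finset.mem_filter, Finset.mem_univ, true_and] at hτ
      have := apply_zero_of_isUnshuffle hτ.1 hτ.2
      have := (τ 0).2
      omega

end

/-! ## Tensor powers and strands -/

section Cons

variable {k : Type*} [Field k] {V : Type*} [AddCommGroup V] [Module k V] {n : ℕ}

/-- The action of the group algebra of the braid group on a tensor power. -/
noncomputable def Braiding.actLin (c : Braiding k V) (n : ℕ) :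
    MonoidAlgebra k (BraidGroup n) →ₐ[k] Module.End k (⨂[k] _ : Fin n, V) :=
  MonoidAlgebra.lift k _ _ (LinearEquiv.automorphismGroup.toLinearMapMonoidHom.comp (c.action n))

theorem Braiding.actLin_of (c : Braiding k V) (β : BraidGroup n) (t : ⨂[k] _ : Fin n, V) :
    c.actLin n (MonoidAlgebra.of k _ β) t = c.action n β t := by
  rw [actLin, MonoidAlgebra.lift_of]; rfl

theorem Braiding.action_gen (c : Braiding k V) {j : ℕ} (h : j + 1 < n) :
    c.action n (gen n j) = c.crossing n j :=
  braidLift_gen _ _ _ _ h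

theorem Braiding.crossing_tprod (c : Braiding k V) {j : ℕ} (h : j + 1 < n) (a : Fin n → V) :
    c.crossing n j (PiTensorProduct.tprod k a) =
      insertPair a ⟨j, by omega⟩ ⟨j + 1, h⟩ (by simp)
        (c.σ (a ⟨j, by omega⟩ ⊗ₜ a ⟨j + 1, h⟩)) := by
  rw [crossing, dif_pos h]
  exact applyAt_tprod _ _ _ _ _

variable (k V n) in
/-- Tensoring with a vector from the left. -/
noncomputable def consMap : V →ₗ[k] (⨂[k] _ : Fin n, V) →ₗ[k] ⨂[k] _ : Fin (n + 1), V :=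
  (PiTensorProduct.lift (R := k) (s := fun _ : Fin n => V)).toLinearMap ∘ₗ
    (PiTensorProduct.tprod k (s := fun _ : Fin (n + 1) => V)).curryLeft

@[simp] theorem consMap_tprod (x : V) (b : Fin n → V) :
    consMap k V n x (PiTensorProduct.tprod k b) =
      PiTensorProduct.tprod k (Fin.cons x b : Fin (n + 1) → V) := by
  simp [consMap]

theorem hom_ext_cons {M : Type*} [AddCommMonoid M] [Module k M]
    {f g : (⨂[k] _ : Fin (n + 1), V) →ₗ[k] M}
    (h : ∀ x b, f (consMap k V n x (PiTensorProduct.tprod k b)) =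
      g (consMap k V n x (PiTensorProduct.tprod k b))) : f = g := by
  apply PiTensorProduct.ext
  ext a
  have := h (a 0) (Fin.tail a)
  rw [consMap_tprod, Fin.cons_self_tail] at this
  exact this

theorem insertPair_cons (x : V) (b : Fin n → V) (i j : Fin n) (h : i ≠ j) (t : V ⊗[k] V) :
    insertPair (Fin.cons x b : Fin (n + 1) → V) i.succ j.succ
      (fun e => h (Fin.succ_injective _ e)) t = consMap k V n x (insertPair b i j h t) := by
  induction t with
  | zero => simp
  | add s t hs ht => simp [hs, ht]
  | tmul y z => rw [insertPair_tmul, insertPair_tmul, consMap_tprod, Fin.cons_update, Fin.cons_update]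

theorem crossing_consMap (c : Braiding k V) {j : ℕ} (h : j + 1 < n) (x : V)
    (t : ⨂[k] _ : Fin n, V) :
    c.crossing (n + 1) (j + 1) (consMap k V n x t) = consMap k V n x (c.crossing n j t) := by
  have : (c.crossing (n + 1) (j + 1)).toLinearMap ∘ₗ consMap k V n x =
      consMap k V n x ∘ₗ (c.crossing n j).toLinearMap := by
    apply PiTensorProduct.ext
    ext b
    simp only [LinearMap.compMultilinearMap_apply, LinearMap.comp_apply, LinearEquiv.coe_coe,
      consMap_tprod, c.crossing_tprod h, c.crossing_tprod (show j + 1 + 1 < n + 1 by omega)]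
    exact insertPair_cons x b ⟨j, by omega⟩ ⟨j + 1, h⟩ (by simp) _
  exact LinearMap.congr_fun this t

theorem action_shiftBraid (c : Braiding k V) (β : BraidGroup n) (x : V)
    (t : ⨂[k] _ : Fin n, V) :
    c.action (n + 1) (shiftBraid n β) (consMap k V n x t) = consMap k V n x (c.action n β t) := by
  induction β using braid_induction generalizing t with
  | one => simp
  | of_gen j hj =>
    rw [shiftBraid_gen hj, c.action_gen hj, c.action_gen (by omega), crossing_consMap c hj]
  | mul β γ h1 h2 => simp only [map_mul, LinearEquiv.mul_apply, h1, h2]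
  | inv β h =>
    apply (c.action (n + 1) (shiftBraid n β)).injective
    rw [h, ← LinearEquiv.mul_apply, ← LinearEquiv.mul_apply, ← map_mul, ← map_mul, ← map_mul]
    simp

theorem actLin_shiftAlg (c : Braiding k V) (z : MonoidAlgebra k (BraidGroup n)) (x : V)
    (t : ⨂[k] _ : Fin n, V) :
    c.actLin (n + 1) (shiftAlg k n z) (consMap k V n x t) = consMap k V n x (c.actLin n z t) := by
  induction z using MonoidAlgebra.induction_on with
  | of β => rw [shiftAlg_of, c.actLin_of, c.actLin_of, action_shiftBraid]
  | add y z hy hz => simp only [map_add, LinearMap.add_apply, hy, hz]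
  | smul r z hz => simp only [map_smul, LinearMap.smul_apply, hz]

variable (k V n) in
/-- Tensoring with a tensor of order two from the left. -/
noncomputable def consTwo :
    V ⊗[k] V →ₗ[k] (⨂[k] _ : Fin n, V) →ₗ[k] ⨂[k] _ : Fin (n + 2), V :=
  TensorProduct.lift ((LinearMap.llcomp k _ _ _).compl₁₂ (consMap k V (n + 1)) (consMap k V n))

@[simp] theorem consTwo_tmul (x y : V) (t : ⨂[k] _ : Fin n, V) :
    consTwo k V n (x ⊗ₜ y) t = consMap k V (n + 1) x (consMap k V n y t) := rfl

/-- With `crossing_consMap` this describes the braid action through the decomposition of a tensor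
power into a first factor and the rest, which all later inductions use. -/
theorem crossing_zero_consMap (c : Braiding k V) (x y : V) (t : ⨂[k] _ : Fin n, V) :
    c.crossing (n + 2) 0 (consMap k V (n + 1) x (consMap k V n y t)) =
      consTwo k V n (c.σ (x ⊗ₜ y)) t := by
  have : (c.crossing (n + 2) 0).toLinearMap ∘ₗ consTwo k V n (x ⊗ₜ y) =
      consTwo k V n (c.σ (x ⊗ₜ y)) := by
    apply PiTensorProduct.ext
    ext b
    simp only [LinearMap.compMultilinearMap_apply, LinearMap.comp_apply, LinearEquiv.coe_coe,
      consTwo_tmul, consMap_tprod, c.crossing_tprod (show 0 + 1 < n + 2 by omega)]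
    change insertPair _ _ _ _ (c.σ (x ⊗ₜ y)) = _
    induction c.σ (x ⊗ₜ y) with
    | zero => simp
    | add s t hs ht => simp only [map_add, LinearMap.add_apply, hs, ht]
    | tmul u v =>
      rw [insertPair_tmul, consTwo_tmul, consMap_tprod, consMap_tprod]
      congr 1
      funext i
      refine Fin.cases ?_ (fun i => Fin.cases ?_ (fun i => ?_) i) i
      · rw [Function.update_of_ne (by simp)]
        exact Function.update_self _ _ _
      · exact Function.update_self _ _ _
      · rw [Function.update_of_ne (by simp [Fin.ext_iff]),
          Function.update_of_ne (by simp [Fin.ext_iff])]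
        rfl
  exact LinearMap.congr_fun this t

/-- The first strand crosses its neighbour and then continues as the first of the remaining `n`
strands. -/
theorem shiftBraid_fatRight {n p : ℕ} (h : p + 1 ≤ n) :
    shiftBraid n (fatRight n p 0) * gen (n + 1) 0 = fatRight (n + 1) (p + 1) 0 := by
  induction p with
  | zero => simp [fatRight]
  | succ p ih =>
    rw [fatRight_succ, map_mul, mul_assoc, ih (by omega), fatRight_succ _ (p + 1),
      shiftBraid_gen (by omega)]
    congr 2

end Cons

/-! ## The coproduct of a product of primitive elements -/

section Primitive

variable {k : Type*} [Field k] {A : Type*} [Ring A] [Algebra k A] {n : ℕ}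

variable (k A n) in
/-- The `n`-fold multiplication. -/
noncomputable def mulMap : (⨂[k] _ : Fin n, A) →ₗ[k] A :=
  PiTensorProduct.lift (MultilinearMap.mkPiAlgebraFin k n A)

@[simp] theorem mulMap_tprod (a : Fin n → A) :
    mulMap k A n (PiTensorProduct.tprod k a) = (List.ofFn a).prod := by
  simp [mulMap]

variable (k A n) in
/-- Multiply the first `p` factors and the remaining factors separately. -/
noncomputable def splitMap (p : ℕ) : (⨂[k] _ : Fin n, A) →ₗ[k] A ⊗[k] A :=
  PiTensorProduct.lift ((MultilinearMap.mkPiAlgebraFin k n (A ⊗[k] A)).compLinearMap fun i =>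
    if (i : ℕ) < p then (Algebra.TensorProduct.includeLeft (R := k) (S := k)).toLinearMap
    else Algebra.TensorProduct.includeRight.toLinearMap)

theorem splitMap_tprod (p : ℕ) (a : Fin n → A) :
    splitMap k A n p (PiTensorProduct.tprod k a) =
      (List.ofFn fun i : Fin n => if (i : ℕ) < p then a i ⊗ₜ[k] (1 : A) else 1 ⊗ₜ a i).prod := by
  rw [splitMap, PiTensorProduct.lift.tprod, MultilinearMap.compLinearMap_apply,
    MultilinearMap.mkPiAlgebraFin_apply]
  congr 2
  funext i
  split_ifs <;> rfl

theorem splitMap_succ_consMap (p : ℕ) (x : A) (t : ⨂[k] _ : Fin n, A) :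
    splitMap k A (n + 1) (p + 1) (consMap k A n x t) = (x ⊗ₜ 1) * splitMap k A n p t := by
  refine LinearMap.congr_fun (f := splitMap k A (n + 1) (p + 1) ∘ₗ consMap k A n x)
    (g := LinearMap.mulLeft k (x ⊗ₜ 1) ∘ₗ splitMap k A n p) (PiTensorProduct.ext ?_) t
  ext b
  simp [splitMap_tprod]

theorem splitMap_zero (t : ⨂[k] _ : Fin n, A) :
    splitMap k A n 0 t = 1 ⊗ₜ mulMap k A n t := by
  refine LinearMap.congr_fun (f := splitMap k A n 0)
    (g := TensorProduct.mk k A A 1 ∘ₗ mulMap k A n) (PiTensorProduct.ext ?_) t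
  ext b
  have := map_list_prod (Algebra.TensorProduct.includeRight (R := k) (A := A) (B := A)) (List.ofFn b)
  simp only [Algebra.TensorProduct.includeRight_apply, List.map_ofFn] at this
  simp [splitMap_tprod, this, Function.comp_def]

theorem splitMap_of_le {p : ℕ} (hp : n ≤ p) (t : ⨂[k] _ : Fin n, A) :
    splitMap k A n p t = mulMap k A n t ⊗ₜ 1 := by
  refine LinearMap.congr_fun (f := splitMap k A n p)
    (g := (TensorProduct.mk k A A).flip 1 ∘ₗ mulMap k A n) (PiTensorProduct.ext ?_) t
  ext b
  have := map_list_prod (Algebra.TensorProduct.includeLeft (R := k) (S := k) (A := A) (B := A))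
    (List.ofFn b)
  simp only [Algebra.TensorProduct.includeLeft_apply, List.map_ofFn] at this
  have h : ∀ i : Fin n, (i : ℕ) < p := fun i => by omega
  simp [splitMap_tprod, this, Function.comp_def, h]

variable [Coalgebra k A] (H : BraidedHopfAlgebra k A)

namespace BraidedHopfAlgebra

/-- Multiplication by `1 ⊗ x` from the left, in the braided tensor square. -/
noncomputable def rightOp (x : A) : A ⊗[k] A →ₗ[k] A ⊗[k] A :=
  TensorProduct.lift ((LinearMap.mul k (A ⊗[k] A)).compl₁₂
    (H.σ.toLinearMap ∘ₗ TensorProduct.mk k A A x) (TensorProduct.mk k A A 1))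

@[simp] theorem rightOp_tmul (x u v : A) :
    H.rightOp x (u ⊗ₜ v) = H.σ (x ⊗ₜ u) * (1 ⊗ₜ v) := by
  simp [rightOp]

/-- This is multiplicativity of `Δ` for `x ⊗ 1 + 1 ⊗ x`. The first summand crosses only a unit, so
there the braided product is the ordinary product of `A ⊗ A`. -/
theorem comul_mul_of_isPrimitive {x : A} (hx : IsPrimitive k x) (m : A) :
    Coalgebra.comul (R := k) (x * m) =
      (x ⊗ₜ 1) * Coalgebra.comul (R := k) m + H.rightOp x (Coalgebra.comul (R := k) m) := by
  have h := LinearMap.congr_fun H.comul_mul (x ⊗ₜ m)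
  rw [LinearMap.comp_apply, LinearMap.mul'_apply] at h
  rw [h]
  simp only [LinearMap.comp_apply, TensorProduct.map_tmul]
  rw [hx]
  induction Coalgebra.comul (R := k) m with
  | zero => simp
  | add s t hs ht =>
    simp only [TensorProduct.tmul_add, map_add, mul_add, hs, ht]
    abel
  | tmul u v =>
    simp only [TensorProduct.add_tmul, map_add, LinearEquiv.coe_coe, TensorProduct.assoc_tmul,
      LinearMap.lTensor_tmul, LinearMap.comp_apply, TensorProduct.assoc_symm_tmul,
      LinearMap.rTensor_tmul, H.braid_one_left, rightOp_tmul]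
    congr 1
    · simp
    · induction H.σ (x ⊗ₜ u) with
      | zero => simp
      | add s t hs ht =>
        simp only [TensorProduct.add_tmul, TensorProduct.tmul_add, map_add, add_mul, hs, ht]
      | tmul a b => simp

theorem braid_mul_tmul (x y u : A) : H.σ (x ⊗ₜ (y * u)) =
    (LinearMap.mul' k A).rTensor A (applyRight H.σ.toLinearMap (H.σ (x ⊗ₜ y) ⊗ₜ u)) := by
  have := LinearMap.congr_fun H.braid_mul_right ((x ⊗ₜ y) ⊗ₜ u)
  simpa using this

/-- The operator `y ⊗ x ↦ (y ⊗ 1)(1 ⊗ x)` in the braided tensor square. -/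
noncomputable def pairOp : A ⊗[k] A →ₗ[k] A ⊗[k] A →ₗ[k] A ⊗[k] A :=
  TensorProduct.lift (LinearMap.mk₂ k
    (fun y x => LinearMap.mulLeft k (y ⊗ₜ 1) ∘ₗ H.rightOp x)
    (fun y y' x => by ext; simp [TensorProduct.add_tmul, add_mul])
    (fun c y x => by ext; simp [← TensorProduct.smul_tmul'])
    (fun y x x' => by ext; simp [TensorProduct.add_tmul, add_mul, mul_add])
    (fun c y x => by ext; simp [← TensorProduct.smul_tmul']))

@[simp] theorem pairOp_tmul (y x : A) (w : A ⊗[k] A) :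
    H.pairOp (y ⊗ₜ x) w = (y ⊗ₜ 1) * H.rightOp x w := rfl

/-- In the braided square `(1 ⊗ x)(y ⊗ 1)` is `σ (x ⊗ y)`; the identity comes from compatibility of
`σ` with the product in its second argument. -/
theorem pairOp_braid (x y : A) (w : A ⊗[k] A) :
    H.pairOp (H.σ (x ⊗ₜ y)) w = H.rightOp x ((y ⊗ₜ 1) * w) := by
  induction w with
  | zero => simp
  | add s t hs ht => simp [hs, ht, mul_add]
  | tmul u v =>
    rw [Algebra.TensorProduct.tmul_mul_tmul, one_mul, rightOp_tmul, braid_mul_tmul]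
    induction H.σ (x ⊗ₜ y) with
    | zero => simp
    | add s t hs ht => simp only [map_add, LinearMap.add_apply, TensorProduct.add_tmul, add_mul, hs, ht]
    | tmul a b =>
      rw [pairOp_tmul, rightOp_tmul, ← mul_assoc]
      congr 1
      simp only [applyRight, LinearMap.comp_apply, LinearEquiv.coe_coe, TensorProduct.assoc_tmul,
        LinearMap.lTensor_tmul]
      induction H.σ (b ⊗ₜ u) with
      | zero => simp
      | add s t hs ht => simp only [TensorProduct.tmul_add, map_add, mul_add, hs, ht]
      | tmul c d => simp

/-- Carrying `x` past the product of `p` factors is the same as carrying it past them one at a time;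
each induction step passes one factor with `pairOp_braid`. -/
theorem splitMap_fatRight {p : ℕ} (hp : p ≤ n) (x : A) (t : ⨂[k] _ : Fin n, A) :
    splitMap k A (n + 1) p (H.action (n + 1) (fatRight (n + 1) p 0) (consMap k A n x t)) =
      H.rightOp x (splitMap k A n p t) := by
  induction p generalizing n x with
  | zero =>
    have h : mulMap k A (n + 1) (consMap k A n x t) = x * mulMap k A n t := by
      refine LinearMap.congr_fun (f := mulMap k A (n + 1) ∘ₗ consMap k A n x)
        (g := LinearMap.mulLeft k x ∘ₗ mulMap k A n) (PiTensorProduct.ext ?_) t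
      ext b
      simp
    rw [fatRight_zero, map_one, LinearEquiv.coe_one, id, splitMap_zero, splitMap_zero, h,
      rightOp_tmul, H.braid_one_right]
    simp
  | succ p ih =>
    obtain ⟨m, rfl⟩ : ∃ m, n = m + 1 := ⟨n - 1, by omega⟩
    refine LinearMap.congr_fun (f := splitMap k A (m + 1 + 1) (p + 1) ∘ₗ
      (H.action (m + 1 + 1) (fatRight (m + 1 + 1) (p + 1) 0)).toLinearMap ∘ₗ consMap k A (m + 1) x)
      (g := H.rightOp x ∘ₗ splitMap k A (m + 1) (p + 1)) (hom_ext_cons fun y b => ?_) t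
    simp only [LinearMap.comp_apply, LinearEquiv.coe_coe]
    generalize PiTensorProduct.tprod k b = s
    rw [splitMap_succ_consMap, ← pairOp_braid, ← shiftBraid_fatRight (by omega), map_mul,
      LinearEquiv.mul_apply, H.action_gen (by omega), crossing_zero_consMap]
    induction H.σ (x ⊗ₜ y) with
    | zero => simp
    | add u v hu hv => simp only [map_add, LinearMap.add_apply, hu, hv]
    | tmul a b =>
      rw [consTwo_tmul, action_shiftBraid, splitMap_succ_consMap, ih (by omega), pairOp_tmul]

/-- The coproduct of a product of primitive elements. -/
theorem comul_mulMap_tprod (a : Fin n → A) (ha : ∀ i, IsPrimitive k (a i)) :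
    Coalgebra.comul (R := k) (mulMap k A n (PiTensorProduct.tprod k a)) =
      ∑ p ∈ Finset.range (n + 1),
        splitMap k A n p (H.actLin n (shuffleSum k n p) (PiTensorProduct.tprod k a)) := by
  induction n with
  | zero =>
    rw [Finset.sum_range_one, shuffleSum_zero, map_one, Module.End.one_apply, splitMap_zero]
    simp [H.comul_one]
  | succ n ih =>
    obtain ⟨x, b, rfl⟩ : ∃ x b, a = Fin.cons x b := ⟨a 0, Fin.tail a, (Fin.cons_self_tail a).symm⟩
    have hx : IsPrimitive k x := ha 0
    have hb := ih b fun i => ha i.succ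
    have hmul : mulMap k A (n + 1) (PiTensorProduct.tprod k (Fin.cons x b : Fin (n + 1) → A)) =
        x * mulMap k A n (PiTensorProduct.tprod k b) := by simp
    rw [hmul, H.comul_mul_of_isPrimitive hx, hb, ← consMap_tprod]
    generalize PiTensorProduct.tprod k b = t
    set g := fun p => splitMap k A n p (H.actLin n (shuffleSum k n p) t) with hg
    have h0 : splitMap k A (n + 1) 0 (H.actLin (n + 1) (shuffleSum k (n + 1) 0)
        (consMap k A n x t)) = H.rightOp x (g 0) := by
      rw [hg]
      simp only [shuffleSum_zero, map_one, Module.End.one_apply]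
      rw [← splitMap_fatRight H (Nat.zero_le n), fatRight_zero, map_one]
      rfl
    -- The two terms of `shuffleSum_succ` are the choices for `x`: to stay in the left tensor
    -- factor, or to cross `p + 1` entries into the right one.
    have h1 : ∀ p, splitMap k A (n + 1) (p + 1) (H.actLin (n + 1) (shuffleSum k (n + 1) (p + 1))
        (consMap k A n x t)) = (x ⊗ₜ 1) * g p + if p + 1 ≤ n then H.rightOp x (g (p + 1)) else 0 := by
      intro p
      rw [shuffleSum_succ, map_add, LinearMap.add_apply, map_add, actLin_shiftAlg,
        splitMap_succ_consMap]
      congr 1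
      split_ifs with h
      · rw [map_mul, Module.End.mul_apply, actLin_shiftAlg, Braiding.actLin_of,
          splitMap_fatRight H h]
      · simp
    rw [Finset.sum_range_succ' _ (n + 1), h0, Finset.sum_congr rfl fun p _ => h1 p, Finset.sum_add_distrib,
      ← Finset.mul_sum, map_sum, add_assoc]
    congr 1
    change ∑ p ∈ Finset.range (n + 1), H.rightOp x (g p) = _
    rw [Finset.sum_range_succ', Finset.sum_range_succ _ n, if_neg (by omega), add_zero]
    congr 1
    apply Finset.sum_congr rfl
    intro p hp
    rw [Finset.mem_range] at hp
    rw [if_pos (by omega)]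

/-! ### Tensor products of primitive elements are stable under the braiding -/

variable (k A) in
/-- The map with kernel the primitive elements. -/
noncomputable def primDefect : A →ₗ[k] A ⊗[k] A :=
  Coalgebra.comul (R := k) - (TensorProduct.mk k A A).flip 1 - TensorProduct.mk k A A 1

theorem isPrimitive_iff_mem_ker {x : A} : IsPrimitive k x ↔ x ∈ LinearMap.ker (primDefect k A) := by
  rw [LinearMap.mem_ker, primDefect, IsPrimitive]
  simp only [LinearMap.sub_apply, LinearMap.flip_apply, TensorProduct.mk_apply]
  rw [sub_sub, sub_eq_zero]

/-- The braiding moves `y` to the left. Compatibility of `Δ` with `σ`, applied to `Δ y = y ⊗ 1 + 1 ⊗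
y`, shows that the left factor of `σ (x ⊗ y)` is again primitive. -/
theorem rTensor_primDefect_braid {x y : A} (hy : IsPrimitive k y) :
    (primDefect k A).rTensor A (H.σ (x ⊗ₜ y)) = 0 := by
  have h := LinearMap.congr_fun H.braid_comul_right (x ⊗ₜ y)
  simp only [LinearMap.comp_apply, LinearMap.lTensor_tmul, LinearEquiv.coe_coe] at h
  rw [hy] at h
  simp only [TensorProduct.tmul_add, map_add, TensorProduct.assoc_symm_tmul,
    LinearMap.rTensor_tmul, LinearEquiv.coe_coe, H.braid_one_right] at h
  have h1 : ∀ t : A ⊗[k] A, applyRight H.σ.toLinearMap (t ⊗ₜ 1) =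
      ((TensorProduct.mk k A A).flip 1).rTensor A t := by
    intro t
    induction t with
    | zero => simp
    | add s t hs ht => simp only [TensorProduct.add_tmul, map_add, hs, ht]
    | tmul a b => simp [applyRight, H.braid_one_right]
  have h2 : applyRight H.σ.toLinearMap ((1 ⊗ₜ x) ⊗ₜ y) =
      (TensorProduct.mk k A A 1).rTensor A (H.σ (x ⊗ₜ y)) := by
    simp only [applyRight, LinearMap.comp_apply, LinearEquiv.coe_coe, TensorProduct.assoc_tmul,
      LinearMap.lTensor_tmul]
    induction H.σ (x ⊗ₜ y) with
    | zero => simp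
    | add s t hs ht => simp only [TensorProduct.tmul_add, map_add, hs, ht]
    | tmul a b => simp
  rw [h1, h2] at h
  rw [primDefect, LinearMap.rTensor_sub, LinearMap.rTensor_sub, LinearMap.sub_apply,
    LinearMap.sub_apply, h]
  abel

theorem lTensor_primDefect_braid {x y : A} (hx : IsPrimitive k x) :
    (primDefect k A).lTensor A (H.σ (x ⊗ₜ y)) = 0 := by
  have h := LinearMap.congr_fun H.braid_comul_left (x ⊗ₜ y)
  simp only [LinearMap.comp_apply, LinearMap.rTensor_tmul, LinearEquiv.coe_coe] at h
  rw [hx] at h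
  have h1 : H.σ.toLinearMap.rTensor A (applyRight H.σ.toLinearMap ((x ⊗ₜ[k] 1) ⊗ₜ[k] y)) =
      H.σ (x ⊗ₜ y) ⊗ₜ 1 := by
    simp [applyRight, H.braid_one_left]
  have h2 : H.σ.toLinearMap.rTensor A (applyRight H.σ.toLinearMap ((1 ⊗ₜ[k] x) ⊗ₜ[k] y)) =
      ((TensorProduct.mk k A A).flip 1).rTensor A (H.σ (x ⊗ₜ y)) := by
    simp only [applyRight, LinearMap.comp_apply, LinearEquiv.coe_coe, TensorProduct.assoc_tmul,
      LinearMap.lTensor_tmul]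
    induction H.σ (x ⊗ₜ y) with
    | zero => simp
    | add s t hs ht => simp only [TensorProduct.tmul_add, map_add, hs, ht]
    | tmul a b => simp [H.braid_one_left]
  have h3 : ∀ t : A ⊗[k] A, (TensorProduct.assoc k A A A).symm
      ((primDefect k A).lTensor A t) = (TensorProduct.assoc k A A A).symm
        ((Coalgebra.comul (R := k) (A := A)).lTensor A t) - (t ⊗ₜ 1 +
        ((TensorProduct.mk k A A).flip 1).rTensor A t) := by
    intro t
    induction t with
    | zero => simp
    | add s t hs ht =>
      simp only [TensorProduct.add_tmul, map_add, hs, ht]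
      abel
    | tmul a b => simp [primDefect, sub_sub]
  rw [TensorProduct.add_tmul, map_add, map_add, h1, h2] at h
  apply (TensorProduct.assoc k A A A).symm.injective
  rw [h3, h, sub_self, map_zero]

/-- Over a field `(ker f ⊗ V) ∩ (V ⊗ ker f) = ker f ⊗ ker f`. Flatness lifts the tensor to either
side, and a linear retraction onto `ker f` in the second factor leaves it unchanged. -/
theorem exists_of_rTensor_lTensor_eq_zero {V W : Type*} [AddCommGroup V] [Module k V]
    [AddCommGroup W] [Module k W] (f : V →ₗ[k] W) (t : V ⊗[k] V)
    (h1 : f.rTensor V t = 0) (h2 : f.lTensor V t = 0) :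
    ∃ s : LinearMap.ker f ⊗[k] LinearMap.ker f,
      TensorProduct.map (LinearMap.ker f).subtype (LinearMap.ker f).subtype s = t := by
  obtain ⟨s₁, rfl⟩ := (Module.Flat.rTensor_exact V (LinearMap.exact_subtype_ker_map f) t).1 h1
  obtain ⟨s₂, hs₂⟩ := (Module.Flat.lTensor_exact V (LinearMap.exact_subtype_ker_map f) _).1 h2
  obtain ⟨π, hπ⟩ := LinearMap.exists_leftInverse_of_injective (LinearMap.ker f).subtype
    (Submodule.ker_subtype _)
  refine ⟨π.lTensor _ s₁, ?_⟩
  have h3 : (((LinearMap.ker f).subtype ∘ₗ π).lTensor V)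
      ((LinearMap.ker f).subtype.lTensor V s₂) = (LinearMap.ker f).subtype.lTensor V s₂ := by
    rw [← LinearMap.comp_apply, ← LinearMap.lTensor_comp, LinearMap.comp_assoc, hπ,
      LinearMap.comp_id]
  rw [hs₂] at h3
  have h4 : ∀ s : LinearMap.ker f ⊗[k] V,
      TensorProduct.map (LinearMap.ker f).subtype (LinearMap.ker f).subtype (π.lTensor _ s) =
        ((LinearMap.ker f).subtype ∘ₗ π).lTensor V ((LinearMap.ker f).subtype.rTensor V s) := by
    intro s
    induction s with
    | zero => simp
    | add s t hs ht => simp only [map_add, hs, ht]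
    | tmul a b => simp
  rw [h4, h3]

variable (k A n) in
/-- The span of the tensor products of primitive elements. -/
noncomputable def primTensors : Submodule k (⨂[k] _ : Fin n, A) :=
  Submodule.span k {t | ∃ a : Fin n → A, (∀ i, IsPrimitive k (a i)) ∧
    t = PiTensorProduct.tprod k a}

theorem tprod_mem_primTensors {a : Fin n → A} (ha : ∀ i, IsPrimitive k (a i)) :
    PiTensorProduct.tprod k a ∈ primTensors k A n :=
  Submodule.subset_span ⟨a, ha, rfl⟩

theorem crossing_mem_primTensors {j : ℕ} (hj : j + 1 < n) {t : ⨂[k] _ : Fin n, A}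
    (ht : t ∈ primTensors k A n) : H.crossing n j t ∈ primTensors k A n := by
  induction ht using Submodule.span_induction with
  | zero => simp
  | add s t _ _ hs ht => rw [map_add]; exact add_mem hs ht
  | smul c t _ ht => rw [map_smul]; exact Submodule.smul_mem _ _ ht
  | mem t ht =>
    obtain ⟨a, ha, rfl⟩ := ht
    rw [H.crossing_tprod hj]
    obtain ⟨s, hs⟩ := exists_of_rTensor_lTensor_eq_zero (primDefect k A) _
      (H.rTensor_primDefect_braid (x := a ⟨j, by omega⟩) (ha ⟨j + 1, hj⟩))
      (H.lTensor_primDefect_braid (ha ⟨j, by omega⟩))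
    rw [← hs]
    clear hs
    induction s with
    | zero => simp
    | add s t hs ht => rw [map_add, map_add]; exact add_mem hs ht
    | tmul x y =>
      rw [TensorProduct.map_tmul, insertPair_tmul]
      apply tprod_mem_primTensors
      intro i
      rw [Function.update_apply, Function.update_apply]
      split_ifs
      · exact isPrimitive_iff_mem_ker.2 y.2
      · exact isPrimitive_iff_mem_ker.2 x.2
      · exact ha i

theorem action_mem_primTensors (hH : H.FinitelyBraided) (β : BraidGroup n)
    {t : ⨂[k] _ : Fin n, A} (ht : t ∈ primTensors k A n) :
    H.action n β t ∈ primTensors k A n := by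
  induction β using braid_induction generalizing t with
  | one => simpa using ht
  | of_gen j hj => rw [H.action_gen hj]; exact H.crossing_mem_primTensors hj ht
  | mul β γ h1 h2 => rw [map_mul, LinearEquiv.mul_apply]; exact h1 (h2 ht)
  | inv β h =>
    -- Stability under `σ` alone does not give stability under `σ⁻¹`; since a positive power of `β`
    -- acts trivially, `β⁻¹` acts as a nonnegative power of `β`.
    obtain ⟨m, hm, -, hβ⟩ := Subgroup.exists_pow_mem_of_index_ne_zero (hH n).index_ne_zero β
    obtain ⟨m, rfl⟩ : ∃ l, m = l + 1 := ⟨m - 1, by omega⟩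
    have hinv : H.action n β⁻¹ = H.action n β ^ m := by
      rw [map_inv, inv_eq_iff_mul_eq_one, ← pow_succ', ← map_pow]
      exact hβ
    rw [hinv]
    clear hinv hβ hm
    induction m with
    | zero => simpa using ht
    | succ m ih => rw [pow_succ', LinearEquiv.mul_apply]; exact h ih

theorem actLin_mem_primTensors (hH : H.FinitelyBraided) (z : MonoidAlgebra k (BraidGroup n))
    {t : ⨂[k] _ : Fin n, A} (ht : t ∈ primTensors k A n) :
    H.actLin n z t ∈ primTensors k A n := by
  induction z using MonoidAlgebra.induction_on with
  | of β => rw [Braiding.actLin_of]; exact H.action_mem_primTensors hH β ht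
  | add y z hy hz => rw [map_add]; exact add_mem hy hz
  | smul r z hz => rw [map_smul]; exact Submodule.smul_mem _ _ hz

/-- The linear extension is needed because `z · (a_1 ⊗ ⋯ ⊗ a_n)` is no longer a pure tensor. -/
theorem comul_mulMap {t : ⨂[k] _ : Fin n, A} (ht : t ∈ primTensors k A n) :
    Coalgebra.comul (R := k) (mulMap k A n t) =
      ∑ p ∈ Finset.range (n + 1), splitMap k A n p (H.actLin n (shuffleSum k n p) t) := by
  induction ht using Submodule.span_induction with
  | zero => simp
  | add s t _ _ hs ht => simp only [map_add, hs, ht, Finset.sum_add_distrib]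
  | smul c t _ ht => simp only [map_smul, ht, Finset.smul_sum]
  | mem t ht => obtain ⟨a, ha, rfl⟩ := ht; exact H.comul_mulMap_tprod a ha

/-- Elements of the group algebra annihilated by the `𝔖_{p,q}` preserve primitive elements. -/
theorem isPrimitive_mulMap (hH : H.FinitelyBraided) (hn : 1 < n)
    {z : MonoidAlgebra k (BraidGroup n)}
    (hz : ∀ p ∈ Finset.Ioo 0 n, H.actLin n (shuffleSum k n p * z) = 0) {a : Fin n → A}
    (ha : ∀ i, IsPrimitive k (a i)) :
    IsPrimitive k (mulMap k A n (H.actLin n z (PiTensorProduct.tprod k a))) := by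
  rw [IsPrimitive, H.comul_mulMap (H.actLin_mem_primTensors hH z (tprod_mem_primTensors ha)),
    Finset.sum_range_succ, ← Finset.sum_subset (s₁ := {0})]
  · rw [Finset.sum_singleton, shuffleSum_zero, shuffleSum_self, map_one, Module.End.one_apply,
      splitMap_zero, splitMap_of_le le_rfl, add_comm]
  · simp; omega
  · intro p hp h0
    have := hz p (by simp at hp h0 ⊢; omega)
    rw [← Module.End.mul_apply, ← map_mul, this]
    simp

end BraidedHopfAlgebra

end Primitive

/-! ## The braid group action on words -/

namespace WordAlg

variable {G X : Type*} [Group G] [MulAction G X] {k : Type*} [Field k] {R : AugRack G X} {n : ℕ}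

variable (k R n) in
/-- The tensor product of the first `n` words of a sequence. -/
noncomputable def wordTensor (w : ℕ → FreeMonoid X) : ⨂[k] _ : Fin n, WordAlg k R :=
  PiTensorProduct.tprod k fun i : Fin n => word k R (w i)

/-- Braids permute the basis of word tensors, so the linear action is governed by the augmented rack
of words. -/
theorem crossing_wordTensor {j : ℕ} (hj : j + 1 < n) (w : ℕ → FreeMonoid X) :
    (hopf k R).crossing n j (wordTensor k R n w) = wordTensor k R n (R.words.cross j w) := by
  rw [wordTensor, Braiding.crossing_tprod _ hj]
  change insertPair _ _ _ _ ((braiding k R).σ _) = _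
  rw [braiding_word, insertPair_tmul, wordTensor]
  congr 1
  funext i
  rw [AugRack.cross_apply, Function.update_apply, Function.update_apply]
  by_cases h1 : (i : ℕ) = j
  · rw [if_neg (by simp [Fin.ext_iff, h1]), if_pos (Fin.ext h1), if_pos h1]; rfl
  by_cases h2 : (i : ℕ) = j + 1
  · rw [if_pos (Fin.ext h2), if_neg h1, if_pos h2]
  · rw [if_neg (by simp [Fin.ext_iff, h2]), if_neg (by simp [Fin.ext_iff, h1]), if_neg h1,
      if_neg h2]

theorem action_wordTensor (β : BraidGroup n) (w : ℕ → FreeMonoid X) :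
    (hopf k R).action n β (wordTensor k R n w) = wordTensor k R n (R.words.seqAct n β w) := by
  induction β using braid_induction generalizing w with
  | one => simp
  | of_gen j hj => rw [Braiding.action_gen _ hj, R.words.seqAct_gen hj, crossing_wordTensor hj]
  | mul β γ h1 h2 => rw [map_mul, map_mul, LinearEquiv.mul_apply, h2, h1]; rfl
  | inv β h =>
    apply ((hopf k R).action n β).injective
    rw [h, ← LinearEquiv.mul_apply, ← map_mul, ← Equiv.Perm.mul_apply, ← map_mul]
    simp

theorem wordTensor_hom_ext {M : Type*} [AddCommMonoid M] [Module k M]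
    {f g : (⨂[k] _ : Fin n, WordAlg k R) →ₗ[k] M}
    (h : ∀ w : ℕ → FreeMonoid X, (∀ i ≥ n, w i = 1) →
      f (wordTensor k R n w) = g (wordTensor k R n w)) : f = g := by
  apply PiTensorProduct.ext
  refine Module.Basis.ext_multilinear (fun _ => wordBasis k R) fun v => ?_
  have := h (fun i => if h : i < n then v ⟨i, h⟩ else 1) fun i hi => dif_neg (by omega)
  simpa [wordTensor, wordBasis_apply] using this

/-- There are infinitely many words, but their degrees lie in the finite group `G`, so one finite
index subgroup fixes all their sequences. -/
theorem finitelyBraided [Finite G] : (hopf k R).FinitelyBraided := by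
  intro n
  obtain ⟨K, hK, h⟩ := exists_finiteIndex_seqAct_eq n G
  refine Subgroup.finiteIndex_of_le (H := K) fun β hβ => ?_
  rw [MonoidHom.mem_ker]
  apply LinearEquiv.toLinearMap_injective
  refine wordTensor_hom_ext fun w hw => ?_
  rw [LinearEquiv.coe_coe, action_wordTensor, h β hβ _ R.words w fun i hi => ?_]
  · rfl
  · rw [hw i hi]; exact map_one R.degHom

/-- The word formed by the first `n` letters of a sequence. -/
def toWord (n : ℕ) (s : ℕ → X) : FreeMonoid X := (List.ofFn fun i : Fin n => FreeMonoid.of (s i)).prod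

theorem toWord_injective {s s' : ℕ → X} (h : toWord n s = toWord n s') {i : ℕ} (hi : i < n) :
    s i = s' i := by
  have key : ∀ l : List X, (l.map FreeMonoid.of).prod = FreeMonoid.ofList l := by
    intro l
    induction l with
    | nil => rfl
    | cons x l ih => rw [List.map_cons, List.prod_cons, ih]; rfl
  have key' : ∀ s : ℕ → X, toWord n s = FreeMonoid.ofList (List.ofFn fun i : Fin n => s i) := by
    intro s
    rw [← key, List.map_ofFn]; rfl
  rw [key', key'] at h
  exact congrFun (List.ofFn_injective (FreeMonoid.ofList.injective h)) ⟨i, hi⟩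

variable (k R n) in
/-- The tensor product of the first `n` letters of a sequence. -/
noncomputable def letterTensor (s : ℕ → X) : ⨂[k] _ : Fin n, WordAlg k R :=
  wordTensor k R n (FreeMonoid.of ∘ s)

theorem letterTensor_mem (s : ℕ → X) :
    letterTensor k R n s ∈ BraidedHopfAlgebra.primTensors k (WordAlg k R) n :=
  BraidedHopfAlgebra.tprod_mem_primTensors fun _ => isPrimitive_of _

theorem action_letterTensor (β : BraidGroup n) (s : ℕ → X) :
    (hopf k R).action n β (letterTensor k R n s) = letterTensor k R n (R.seqAct n β s) := by
  rw [letterTensor, action_wordTensor, letterTensor]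
  congr 1
  refine R.seqAct_map R.words (fun y z => ?_) β s
  change _ = R.degHom _ • _
  simp

theorem mulMap_letterTensor (s : ℕ → X) :
    mulMap k (WordAlg k R) n (letterTensor k R n s) = word k R (toWord n s) := by
  rw [letterTensor, wordTensor, mulMap_tprod, toWord, map_list_prod, List.map_ofFn]
  rfl

theorem word_injective : Function.Injective (word k R) := (wordBasis k R).injective

/-- The length of the left word identifies `p`, which lets the individual terms of the coproduct
formula be separated, and concatenation recovers the whole word. -/
theorem splitMap_letterTensor (p : ℕ) (s : ℕ → X) :
    ∃ v w, splitMap k (WordAlg k R) n p (letterTensor k R n s) = word k R v ⊗ₜ word k R w ∧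
      v * w = toWord n s ∧ v.length = min p n := by
  induction n generalizing p s with
  | zero => exact ⟨1, 1, by simp [letterTensor, wordTensor, splitMap_tprod,
      Algebra.TensorProduct.one_def], by simp [toWord], by simp⟩
  | succ n ih =>
    cases p with
    | zero => exact ⟨1, _, by rw [splitMap_zero, mulMap_letterTensor, map_one], one_mul _, by simp⟩
    | succ p =>
      obtain ⟨v, w, h1, h2, h3⟩ := ih p fun i => s (i + 1)
      refine ⟨.of (s 0) * v, w, ?_, ?_, ?_⟩
      · have : letterTensor k R (n + 1) s = consMap k _ n (word k R (.of (s 0)))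
            (letterTensor k R n fun i => s (i + 1)) := by
          rw [letterTensor, wordTensor, letterTensor, wordTensor, consMap_tprod]
          congr 1
          funext i
          refine Fin.cases rfl (fun i => ?_) i
          simp
        rw [this, splitMap_succ_consMap, h1, map_mul]
        simp
      · rw [mul_assoc, h2]
        simp [toWord]
      · rw [FreeMonoid.length_mul, h3, FreeMonoid.length_of]
        omega

end WordAlg

/-! ## Levels of the profinite operad and actions -/

section Level

variable {k : Type*} [Field k] {n : ℕ}

theorem toLevel_of (N : FinQuot n) (β : BraidGroup n) :
    toLevel k N (MonoidAlgebra.of k _ β) = MonoidAlgebra.of k _ (β : BraidGroup n ⧸ N.toSubgroup) := by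
  simp [toLevel]

theorem toLevel_surjective (N : FinQuot n) : Function.Surjective (toLevel k N) := by
  intro x
  induction x using MonoidAlgebra.induction_on with
  | of q =>
    obtain ⟨β, rfl⟩ := QuotientGroup.mk_surjective q
    exact ⟨_, toLevel_of N β⟩
  | add x y hx hy =>
    obtain ⟨x, rfl⟩ := hx
    obtain ⟨y, rfl⟩ := hy
    exact ⟨x + y, map_add _ _ _⟩
  | smul r x hx =>
    obtain ⟨x, rfl⟩ := hx
    exact ⟨r • x, map_smul _ _ _⟩

theorem transition_toLevel {N N' : FinQuot n} (h : N ≤ N') (z : MonoidAlgebra k (BraidGroup n)) :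
    transition k h (toLevel k N z) = toLevel k N' z := by
  induction z using MonoidAlgebra.induction_on with
  | of β => rw [toLevel_of, toLevel_of]; simp [transition]; rfl
  | add x y hx hy => simp only [map_add, hx, hy]
  | smul r x hx => simp only [map_smul, hx]

variable {V : Type*} [AddCommGroup V] [Module k V]

theorem Braiding.lift_toLevel (c : Braiding k V) {P : FinQuot n}
    (hP : P.toSubgroup ≤ (c.action n).ker) (z : MonoidAlgebra k (BraidGroup n)) :
    (MonoidAlgebra.lift k _ _ (LinearEquiv.automorphismGroup.toLinearMapMonoidHom.comp
      (QuotientGroup.lift P.toSubgroup (c.action n) hP)) : BrAssLevel k n P →ₐ[k] _)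
      (toLevel k P z) = c.actLin n z := by
  induction z using MonoidAlgebra.induction_on with
  | of β =>
    rw [toLevel_of, MonoidAlgebra.lift_of]
    exact LinearMap.ext fun t => (Braiding.actLin_of c β t).symm
  | add x y hx hy => simp only [map_add, hx, hy]
  | smul r x hx => simp only [map_smul, hx]

theorem Braiding.actLin_eq_zero (c : Braiding k V) {P : FinQuot n}
    (hP : P.toSubgroup ≤ (c.action n).ker) {z : MonoidAlgebra k (BraidGroup n)}
    (hz : toLevel k P z = 0) : c.actLin n z = 0 := by
  rw [← Braiding.lift_toLevel c hP, hz, map_zero]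

theorem mem_brPrim (hn : 1 < n) {N : FinQuot n} {x : BrAssLevel k n N} :
    x ∈ brPrim k n N ↔ ∀ p ∈ Finset.Ioo 0 n, toLevel k N (shuffleSum k n p) * x = 0 := by
  rw [brPrim, if_pos hn]
  simp [Submodule.mem_iInf]

theorem brPrimStar_zero (N : FinQuot 0) : brPrimStar k 0 N = ⊥ := by
  rw [brPrimStar, if_neg (by omega), brPrim, if_neg (by omega)]

theorem monoidAlgebra_eq_smul_one {M : Type*} [Monoid M] [Subsingleton M] (x : MonoidAlgebra k M) :
    ∃ c : k, x = c • 1 := by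
  induction x using MonoidAlgebra.induction_on with
  | of q => exact ⟨1, by rw [Subsingleton.elim q 1, map_one, one_smul]⟩
  | add x y hx hy =>
    obtain ⟨c, rfl⟩ := hx
    obtain ⟨d, rfl⟩ := hy
    exact ⟨c + d, (add_smul _ _ _).symm⟩
  | smul r x hx =>
    obtain ⟨c, rfl⟩ := hx
    exact ⟨r * c, (mul_smul _ _ _).symm⟩

theorem brPrimStar_one (N : FinQuot 1) : brPrimStar k 1 N = ⊤ := by
  rw [brPrimStar, if_pos rfl, eq_top_iff]
  intro x _
  have := braidGroup_subsingleton (n := 1) le_rfl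
  have : Subsingleton (BraidGroup 1 ⧸ N.toSubgroup) := Quotient.instSubsingletonQuotient _
  obtain ⟨c, rfl⟩ := monoidAlgebra_eq_smul_one x
  exact Submodule.smul_mem _ _ (Submodule.mem_span_singleton_self 1)

theorem brPrimStar_of_lt (hn : 1 < n) (N : FinQuot n) : brPrimStar k n N = brPrim k n N := by
  rw [brPrimStar, if_neg (by omega)]

end Level

/-! ## Primitive operations and primitive elements -/

section Main

variable {k : Type*} [Field k] {n : ℕ}

theorem IsPrimitive.smul {A : Type*} [Ring A] [Algebra k A] [Coalgebra k A] {x : A}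
    (hx : IsPrimitive k x) (c : k) : IsPrimitive k (c • x) := by
  rw [IsPrimitive, map_smul, hx]
  simp [TensorProduct.smul_tmul']

/-- Primitive operations preserve primitive elements. -/
theorem BraidedHopfAlgebra.isPrimitive_of_mem {A : Type*} [Ring A] [Algebra k A] [Coalgebra k A]
    (H : BraidedHopfAlgebra k A) (hH : H.FinitelyBraided) {P : FinQuot n}
    (hP : P.toSubgroup ≤ (H.action n).ker) {z : MonoidAlgebra k (BraidGroup n)}
    (hz : toLevel k P z ∈ brPrimStar k n P) {a : Fin n → A} (ha : ∀ i, IsPrimitive k (a i)) :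
    IsPrimitive k (mulMap k A n (H.actLin n z (PiTensorProduct.tprod k a))) := by
  rcases lt_trichotomy n 1 with hn | rfl | hn
  · obtain rfl : n = 0 := by omega
    rw [brPrimStar_zero, Submodule.mem_bot] at hz
    rw [H.actLin_eq_zero hP hz]
    simp [IsPrimitive]
  · have := braidGroup_subsingleton (n := 1) le_rfl
    obtain ⟨c, rfl⟩ := monoidAlgebra_eq_smul_one z
    rw [map_smul, map_one, LinearMap.smul_apply, Module.End.one_apply, map_smul, mulMap_tprod]
    simpa using (ha 0).smul c
  · rw [brPrimStar_of_lt hn, mem_brPrim hn] at hz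
    refine H.isPrimitive_mulMap hH hn (fun p hp => H.actLin_eq_zero hP ?_) ha
    rw [map_mul, hz p hp]

theorem evaluate_eq {A : Type*} [Ring A] [Algebra k A] (c : Braiding k A)
    (hc : c.FinitelyBraided) (α : BrAssHat k n) (a : Fin n → A)
    {z : MonoidAlgebra k (BraidGroup n)} (hz : toLevel k (actionKernel c hc n) z = α.1 _) :
    evaluate c hc α a = mulMap k A n (c.actLin n z (PiTensorProduct.tprod k a)) := by
  rw [← c.lift_toLevel (P := actionKernel c hc n) le_rfl, hz]
  rfl

open WordAlg in
/-- The words in an augmented rack which detects a finite quotient of a braid group detect the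
primitive operations in this quotient. -/
theorem mem_brPrimStar_of_isPrimitive {G X : Type*} [Group G] [MulAction G X] {R : AugRack G X}
    {s : ℕ → X} {L : FinQuot n} (hL : ∀ β, R.seqAct n β s = s → β ∈ L.toSubgroup)
    (hH : (hopf k R).FinitelyBraided) {z : MonoidAlgebra k (BraidGroup n)} (hn : 0 < n)
    (hz : IsPrimitive k (mulMap k _ n ((hopf k R).actLin n z (letterTensor k R n s)))) :
    toLevel k L z ∈ brPrimStar k n L := by
  classical
  rcases Nat.eq_or_lt_of_le (show 1 ≤ n from hn) with rfl | hn
  · rw [brPrimStar_one]; trivial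
  rw [brPrimStar_of_lt hn, mem_brPrim hn]
  intro p hp
  rw [Finset.mem_Ioo] at hp
  -- A word in the orbit of `s` is decoded to the coset of a braid producing it. The choice is
  -- harmless: two braids giving the same word have the same effect on `s`, hence differ by an
  -- element of `L`.
  let Ψ : FreeMonoid X → BrAssLevel k n L := fun l =>
    if h : ∃ β, toWord n (R.seqAct n β s) = l then toLevel k L (MonoidAlgebra.of k _ h.choose) else 0
  have hΨ : ∀ β, Ψ (toWord n (R.seqAct n β s)) = toLevel k L (MonoidAlgebra.of k _ β) := by
    intro β
    have h : ∃ γ, toWord n (R.seqAct n γ s) = toWord n (R.seqAct n β s) := ⟨β, rfl⟩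
    simp only [Ψ, dif_pos h]
    rw [toLevel_of, toLevel_of]
    congr 1
    refine QuotientGroup.eq.2 (hL _ ?_)
    rw [map_mul, map_inv, Equiv.Perm.mul_apply, Equiv.Perm.inv_eq_iff_eq]
    funext i
    by_cases hi : i < n
    · exact (toWord_injective h.choose_spec hi).symm
    · rw [R.seqAct_of_le _ _ (by omega), R.seqAct_of_le _ _ (by omega)]
  -- This functional extracts the part whose left factor has length `p` and decodes the concatenated
  -- word.
  let κ : WordAlg k R ⊗[k] WordAlg k R →ₗ[k] BrAssLevel k n L :=
    TensorProduct.lift (lin fun v => lin fun w => if v.length = p then Ψ (v * w) else 0)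
  have hκ : ∀ v w, κ (word k R v ⊗ₜ word k R w) = if v.length = p then Ψ (v * w) else 0 := by
    intro v w
    simp [κ]
  have key : ∀ q ≤ n, ∀ y : MonoidAlgebra k (BraidGroup n),
      κ (splitMap k _ n q ((hopf k R).actLin n y (letterTensor k R n s))) =
        if q = p then toLevel k L y else 0 := by
    intro q hq y
    induction y using MonoidAlgebra.induction_on with
    | of β =>
      rw [Braiding.actLin_of, action_letterTensor]
      obtain ⟨v, w, h1, h2, h3⟩ := splitMap_letterTensor (k := k) (R := R) q (R.seqAct n β s)
      rw [h1, hκ, h2, hΨ, h3, min_eq_left hq]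
    | add x y hx hy =>
      simp only [map_add, LinearMap.add_apply, hx, hy]
      split_ifs <;> simp
    | smul r x hx =>
      simp only [map_smul, LinearMap.smul_apply, hx]
      split_ifs <;> simp
  -- Primitivity leaves only the parts of left length `n` and `0`, both killed by `κ` as `0 < p <
  -- n`; the coproduct formula evaluates the same expression to `𝔖_{p,q} z` at level `L`.
  rw [IsPrimitive, ← splitMap_zero, ← splitMap_of_le le_rfl] at hz
  have h1 := congrArg κ hz
  rw [map_add, key _ le_rfl, key _ (Nat.zero_le n), if_neg (by omega), if_neg (by omega)] at h1
  rw [splitMap_zero, splitMap_of_le le_rfl] at hz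
  have ht := (hopf k R).actLin_mem_primTensors hH z (letterTensor_mem s)
  rw [add_zero, (hopf k R).comul_mulMap ht, map_sum] at h1
  have h2 : ∀ q ∈ Finset.range (n + 1), κ (splitMap k _ n q ((hopf k R).actLin n (shuffleSum k n q)
      ((hopf k R).actLin n z (letterTensor k R n s)))) =
        if q = p then toLevel k L (shuffleSum k n p) * toLevel k L z else 0 := by
    intro q hq
    rw [← Module.End.mul_apply, ← map_mul, key q (Finset.mem_range_succ_iff.1 hq)]
    split_ifs with h
    · rw [h, map_mul]
    · rfl
  rwa [Finset.sum_congr rfl h2, Finset.sum_ite_eq', if_pos (by simp; omega)] at h1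

open WordAlg in
/-- Every finite quotient of a braid group is detected by a finitely braided word algebra. -/
theorem exists_detecting_wordAlg (k : Type*) [Field k] (n : ℕ) (L : FinQuot n) :
    ∃ (G : Type v) (_ : Group G) (t : ℕ → G) (_ : (hopf k (Strand.rack t)).FinitelyBraided),
      (∀ β, (Strand.rack t).seqAct n β (Strand.base G) = Strand.base G → β ∈ L.toSubgroup) ∧
      ((hopf k (Strand.rack t)).action n).ker ≤ L.toSubgroup := by
  -- The quotient is lifted to universe `v` so that the resulting algebra lives where the test
  -- algebras are quantified.
  obtain ⟨G, _, t, hG, -, h⟩ := exists_detecting_rack.{v} n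
    ((MulEquiv.ulift.symm : _ ≃* ULift.{v} (BraidGroup n ⧸ L.toSubgroup)).toMonoidHom.comp
      (QuotientGroup.mk' L.toSubgroup))
  have hL : ∀ β, (Strand.rack t).seqAct n β (Strand.base G) = Strand.base G →
      β ∈ L.toSubgroup := by
    intro β hβ
    have := h β hβ
    simpa using this
  have : Finite (BraidGroup n ⧸ L.toSubgroup) := Subgroup.finite_quotient_of_finiteIndex
  have := hG inferInstance
  refine ⟨G, _, t, finitelyBraided, hL, fun β hβ => hL β ?_⟩
  -- A braid acting trivially fixes the product of the base letters, and a word determines its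
  -- letters.
  have h1 := action_letterTensor (k := k) (R := Strand.rack t) β (Strand.base G)
  rw [MonoidHom.mem_ker.1 hβ] at h1
  have h2 := congrArg (mulMap k _ n) h1
  rw [LinearEquiv.coe_one, id, mulMap_letterTensor, mulMap_letterTensor] at h2
  funext i
  by_cases hi : i < n
  · exact (toWord_injective (word_injective h2) hi).symm
  · exact (Strand.rack t).seqAct_of_le _ _ (by omega)

end Main

section Main

variable {k : Type*} [Field k] {n : ℕ}

/-- Applying the counit to both tensor factors gives `c = c + c`. This settles arity `0`, where a
value is a scalar. -/
theorem isPrimitive_smul_one {A : Type*} [Ring A] [Algebra k A] [Coalgebra k A]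
    (H : BraidedHopfAlgebra k A) {c : k} (hc : IsPrimitive k (c • (1 : A))) :
    c = 0 := by
  have h := congrArg (TensorProduct.lid k k ∘ TensorProduct.map (Coalgebra.counit (R := k))
    (Coalgebra.counit (R := k) (A := A))) hc
  simpa [H.comul_one, H.counit_one, TensorProduct.smul_tmul'] using h

end Main

open WordAlg in
/-- An operation is primitive if and only if it preserves primitive elements. -/
theorem mem_elements_brPrimStar_iff (k : Type u) [Field k] (n : ℕ) (α : BrAssHat k n) :
    α ∈ (brPrimStar k).elements n ↔
      ∀ (A : Type (max u v)) [Ring A] [Algebra k A] [Coalgebra k A]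
        (H : BraidedHopfAlgebra k A) (hH : H.FinitelyBraided) (a : Fin n → A),
        (∀ i, IsPrimitive k (a i)) → IsPrimitive k (evaluate H.toBraiding hH α a) := by
  constructor
  · intro hα A _ _ _ H hH a ha
    obtain ⟨z, hz⟩ := toLevel_surjective (k := k) (actionKernel H.toBraiding hH n) (α.1 _)
    rw [evaluate_eq H.toBraiding hH α a hz]
    refine H.isPrimitive_of_mem hH (P := actionKernel H.toBraiding hH n) le_rfl ?_ ha
    rw [hz]
    exact hα _
  · intro h L
    obtain ⟨G, _, t, hH, hs, hL⟩ := exists_detecting_wordAlg.{v} k n L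
    obtain ⟨z, hz⟩ := toLevel_surjective (k := k) (actionKernel (hopf k _).toBraiding hH n) (α.1 _)
    -- The kernel of the action lies in `L`, so the representative `z` of the component that acts on
    -- the algebra also represents the component at `L`.
    have hz' : toLevel k L z = α.1 L := by
      rw [← α.2 _ L (show actionKernel (hopf k _).toBraiding hH n ≤ L from hL), ← hz,
        transition_toLevel]
    have := h _ (hopf k (Strand.rack t)) hH
      (fun i : Fin n => word k _ (FreeMonoid.of (Strand.base G i))) fun i => isPrimitive_of _
    rw [evaluate_eq _ hH α _ hz] at this
    rw [← hz']
    rcases Nat.eq_zero_or_pos n with rfl | hn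
    · have := braidGroup_subsingleton (n := 0) (by omega)
      obtain ⟨c, rfl⟩ := monoidAlgebra_eq_smul_one z
      rw [map_smul, map_one, LinearMap.smul_apply, Module.End.one_apply, map_smul,
        mulMap_tprod, List.ofFn_zero, List.prod_nil] at this
      rw [isPrimitive_smul_one (hopf k _) this, zero_smul, map_zero]
      exact Submodule.zero_mem _
    · exact mem_brPrimStar_of_isPrimitive hs hH hn this

/-! ## Cabling and words -/

/-- Replace the `n` entries of a sequence in the positions `i, …, i + n - 1` by their product. -/
def merge {M : Type*} [Monoid M] (n i : ℕ) (w : ℕ → M) : ℕ → M := fun j =>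
  if j < i then w j else if j = i then ((List.range n).map fun t => w (i + t)).prod
  else w (j + n - 1)

section merge

variable {M : Type*} [Monoid M] {n i : ℕ}

theorem merge_of_lt (w : ℕ → M) (j : ℕ) (h : j < i) : merge n i w j = w j := if_pos h

theorem merge_self (w : ℕ → M) : merge n i w i = ((List.range n).map fun t => w (i + t)).prod := by
  simp [merge]

theorem merge_of_gt (w : ℕ → M) (j : ℕ) (h : i < j) : merge n i w j = w (j + n - 1) := by
  rw [merge, if_neg (by omega), if_neg (by omega)]

theorem prod_merge {m : ℕ} (hi : i < m) (w : ℕ → M) :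
    ((List.range m).map (merge n i w)).prod = ((List.range (m + n - 1)).map w).prod := by
  obtain ⟨r, rfl⟩ : ∃ r, m = i + (1 + r) := ⟨m - i - 1, by omega⟩
  rw [show i + (1 + r) + n - 1 = i + (n + r) by omega]
  simp only [List.range_add, List.map_append, List.prod_append, List.map_map, List.range_one,
    List.map_cons, List.map_nil, List.prod_cons, List.prod_nil, mul_one, Function.comp_def,
    add_zero, merge_self]
  congr 2
  · exact List.map_congr_left fun j hj => merge_of_lt w j (List.mem_range.1 hj)
  · refine congrArg List.prod (List.map_congr_left fun j _ => ?_)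
    rw [merge_of_gt w _ (by omega)]
    congr 1
    omega

end merge

namespace AugRack

variable {G Y : Type*} [Group G] [MulAction G Y] (R : AugRack G Y)

theorem seqAct_fatLeft {N n j : ℕ} (h : j + n < N) (w : ℕ → Y) (x : ℕ) :
    R.seqAct N (fatLeft N n j) w x =
      if x = j then ((List.range n).map fun t => R.deg (w (j + t))).prod • w (j + n)
      else if j < x ∧ x ≤ j + n then w (x - 1) else w x := by
  induction n generalizing w x with
  | zero =>
    rw [fatLeft_zero, map_one, Equiv.Perm.one_apply]
    by_cases hx : x = j
    · simp [hx]
    · rw [if_neg hx, if_neg (by omega)]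
  | succ n ih =>
    rw [fatLeft_succ, map_mul, Equiv.Perm.mul_apply, ih (by omega), R.seqAct_gen (by omega)]
    by_cases hx : x = j
    · rw [if_pos hx, if_pos hx, cross_left, List.range_succ, List.map_append, List.prod_append,
        mul_smul]
      congr 1
      · refine congrArg List.prod (List.map_congr_left fun t ht => ?_)
        have := List.mem_range.1 ht
        rw [cross_of_ne _ _ (by omega) (by omega)]
      · simp [add_assoc]
    rw [if_neg hx, if_neg hx]
    by_cases h1 : j < x ∧ x ≤ j + n
    · rw [if_pos h1, if_pos (by omega), cross_of_ne _ _ (by omega) (by omega)]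
    rw [if_neg h1]
    by_cases h2 : x = j + n + 1
    · rw [h2, cross_right, if_pos (by omega)]; rfl
    · rw [cross_of_ne _ _ (by omega) (by omega), if_neg (by omega)]

theorem seqAct_fatRight {N n j : ℕ} (h : j + n < N) (w : ℕ → Y) (x : ℕ) :
    R.seqAct N (fatRight N n j) w x =
      if j ≤ x ∧ x < j + n then R.deg (w j) • w (x + 1) else if x = j + n then w j else w x := by
  induction n generalizing x with
  | zero =>
    rw [fatRight_zero, map_one, Equiv.Perm.one_apply, if_neg (by omega)]
    split_ifs with hx
    · simp [hx]
    · rfl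
  | succ n ih =>
    rw [fatRight_succ, map_mul, Equiv.Perm.mul_apply, R.seqAct_gen (by omega), cross_apply,
      ih (by omega), ih (by omega), ih (by omega),
      if_neg (show ¬(j ≤ j + n ∧ j + n < j + n) by omega), if_pos rfl,
      if_neg (show ¬(j ≤ j + n + 1 ∧ j + n + 1 < j + n) by omega),
      if_neg (show ¬j + n + 1 = j + n by omega)]
    by_cases h1 : x = j + n
    · rw [if_pos h1, if_pos (by omega), h1]
    rw [if_neg h1]
    by_cases h2 : x = j + n + 1
    · rw [if_pos h2, if_neg (by omega), if_pos (by omega)]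
    rw [if_neg h2, if_neg h1]
    by_cases h3 : j ≤ x ∧ x < j + n
    · rw [if_pos h3, if_pos (by omega)]
    · rw [if_neg h3, if_neg (by omega), if_neg (by omega)]

theorem seqAct_insertAt {m n : ℕ} (i : Fin m) (ρ : BraidGroup n) (w : ℕ → Y) :
    (fun t => R.seqAct (m + n - 1) (insertAt n i ρ) w (i + t)) =
      R.seqAct n ρ (fun t => w (i + t)) := by
  have hi := i.2
  induction ρ using braid_induction generalizing w with
  | one => simp
  | of_gen j hj =>
    rw [insertAt, braidLift_gen _ _ _ _ hj, R.seqAct_gen hj, R.seqAct_gen (by omega)]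
    funext t
    simp only [cross_apply, add_assoc, Nat.add_left_cancel_iff]
  | mul ρ ρ' h1 h2 =>
    simp only [map_mul, Equiv.Perm.mul_apply] at *
    rw [h1, h2]
  | inv ρ h =>
    apply (R.seqAct n ρ).injective
    rw [← h, ← Equiv.Perm.mul_apply (R.seqAct n ρ), ← map_mul]
    simp

theorem seqAct_insertAt_of_lt {m n : ℕ} (i : Fin m) (ρ : BraidGroup n) (w : ℕ → Y) {j : ℕ}
    (hj : j < i) : R.seqAct (m + n - 1) (insertAt n i ρ) w j = w j := by
  have hi := i.2
  induction ρ using braid_induction generalizing w with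
  | one => simp
  | of_gen t ht =>
    rw [insertAt, braidLift_gen _ _ _ _ ht, R.seqAct_gen (by omega),
      cross_of_ne _ _ (by omega) (by omega)]
  | mul ρ ρ' h1 h2 => rw [map_mul, map_mul, Equiv.Perm.mul_apply, h1, h2]
  | inv ρ h =>
    rw [← h (R.seqAct _ (insertAt n i ρ⁻¹) w), ← Equiv.Perm.mul_apply, ← map_mul, ← map_mul]
    simp

end AugRack

namespace AugRack

variable {G X : Type*} [Group G] [MulAction G X] (R : AugRack G X)

theorem degHom_list_prod (l : List (FreeMonoid X)) :
    R.degHom l.prod = (l.map R.degHom).prod := map_list_prod _ _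

theorem smul_list_prod (g : G) (l : List (FreeMonoid X)) :
    g • l.prod = (l.map fun w => g • w).prod :=
  map_list_prod (MulDistribMulAction.toMonoidHom (FreeMonoid X) g) l

/-- Concatenation is compatible with crossings because degrees multiply and the group acts by monoid
maps. The cases are those of `block`: the fat strand is on the left of the crossing, on its right,
or not involved. -/
theorem merge_seqAct_block {m n j : ℕ} (hj : j + 1 < m) (i : Fin m) (w : ℕ → FreeMonoid X) :
    merge n (adj m j i : Fin m) (R.words.seqAct (m + n - 1) (block (m + n - 1) n j i) w) =
      R.words.cross j (merge n i w) := by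
  have hi := i.2
  have hdeg : ∀ v, R.words.deg v = R.degHom v := fun _ => rfl
  rw [adj_val hj]
  generalize (i : ℕ) = i at *
  rw [block]
  funext x
  by_cases h1 : i = j
  · subst h1
    rw [if_pos rfl, if_pos rfl, cross_apply, merge_self, merge_of_gt _ (i + 1) (by omega)]
    rcases lt_trichotomy x (i + 1) with hx | rfl | hx
    · rw [merge_of_lt _ x hx, seqAct_fatLeft _ (by omega)]
      by_cases h2 : x = i
      · rw [if_pos h2, if_pos h2, hdeg, degHom_list_prod, List.map_map]
        congr 2
        omega
      · rw [if_neg h2, if_neg h2, if_neg (by omega), if_neg (by omega), merge_of_lt _ x (by omega)]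
    · rw [if_neg (by omega), if_pos rfl, merge_self]
      refine congrArg List.prod (List.map_congr_left fun t ht => ?_)
      have := List.mem_range.1 ht
      rw [seqAct_fatLeft _ (by omega), if_neg (by omega), if_pos (by omega)]
      congr 1
      omega
    · rw [merge_of_gt _ x hx, if_neg (by omega), if_neg (by omega), merge_of_gt _ x (by omega),
        seqAct_fatLeft _ (by omega), if_neg (by omega), if_neg (by omega)]
  rw [if_neg h1, if_neg h1]
  by_cases h2 : i = j + 1
  · subst h2
    rw [if_pos rfl, if_pos rfl, cross_apply, merge_self, merge_of_lt _ j (by omega)]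
    rcases lt_trichotomy x j with hx | rfl | hx
    · rw [merge_of_lt _ x hx, if_neg (by omega), if_neg (by omega), merge_of_lt _ x (by omega),
        seqAct_fatRight _ (by omega), if_neg (by omega), if_neg (by omega)]
    · rw [merge_self, if_pos rfl, smul_list_prod, List.map_map]
      refine congrArg List.prod (List.map_congr_left fun t ht => ?_)
      have := List.mem_range.1 ht
      rw [seqAct_fatRight _ (by omega), if_pos (by omega), Function.comp_apply]
      congr 2
      omega
    · rw [merge_of_gt _ x hx, if_neg (by omega), seqAct_fatRight _ (by omega), if_neg (by omega)]
      by_cases h3 : x = j + 1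
      · rw [if_pos (by omega), if_pos h3]
      · rw [if_neg (by omega), if_neg h3, merge_of_gt _ x (by omega)]
  rw [if_neg h2, if_neg h2]
  by_cases h3 : i < j
  · rw [if_pos h3, R.words.seqAct_gen (by omega), cross_apply, merge_of_gt _ j h3,
      merge_of_gt _ (j + 1) (by omega)]
    rcases lt_trichotomy x i with hx | rfl | hx
    · rw [merge_of_lt _ x hx, if_neg (by omega), if_neg (by omega), merge_of_lt _ x hx,
        cross_of_ne _ _ (by omega) (by omega)]
    · rw [merge_self, if_neg (by omega), if_neg (by omega), merge_self]
      refine congrArg List.prod (List.map_congr_left fun t ht => ?_)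
      have := List.mem_range.1 ht
      rw [cross_of_ne _ _ (by omega) (by omega)]
    · rw [merge_of_gt _ x hx, merge_of_gt _ x hx, cross_apply]
      by_cases h4 : x = j
      · rw [if_pos (by omega), if_pos h4]
        congr 2
        omega
      by_cases h5 : x = j + 1
      · rw [if_neg (by omega), if_pos (by omega), if_neg h4, if_pos h5]
      · rw [if_neg (by omega), if_neg (by omega), if_neg h4, if_neg h5]
  · rw [if_neg h3, R.words.seqAct_gen (by omega), cross_apply, merge_of_lt _ j (by omega),
      merge_of_lt _ (j + 1) (by omega)]
    rcases lt_trichotomy x i with hx | rfl | hx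
    · rw [merge_of_lt _ x hx, merge_of_lt _ x hx, cross_apply]
    · rw [merge_self, if_neg (by omega), if_neg (by omega), merge_self]
      refine congrArg List.prod (List.map_congr_left fun t ht => ?_)
      rw [cross_of_ne _ _ (by omega) (by omega)]
    · rw [merge_of_gt _ x hx, merge_of_gt _ x hx, if_neg (by omega), if_neg (by omega),
        cross_of_ne _ _ (by omega) (by omega)]

theorem fatten_one {m n : ℕ} (i : Fin m) : fatten n i 1 = 1 := by
  simp [fatten]

/-- Fattening a strand corresponds to acting on a product of consecutive words. -/
theorem merge_seqAct_fatten {m n : ℕ} (i : Fin m) (γ : BraidGroup m) (w : ℕ → FreeMonoid X) :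
    merge n (toPerm m γ i : Fin m) (R.words.seqAct (m + n - 1) (fatten n i γ) w) =
      R.words.seqAct m γ (merge n i w) := by
  induction γ using braid_induction generalizing i w with
  | one => simp [fatten_one]
  | of_gen j hj =>
    rw [fatten_gen hj, toPerm_gen hj, R.words.seqAct_gen hj, R.merge_seqAct_block hj]
  | mul γ γ' h1 h2 =>
    rw [fatten_mul, map_mul, map_mul, map_mul, Equiv.Perm.mul_apply, Equiv.Perm.mul_apply,
      Equiv.Perm.mul_apply, h1, h2]
  | inv γ h =>
    apply (R.words.seqAct m γ).injective
    rw [← h, ← Equiv.Perm.mul_apply, ← map_mul, ← Equiv.Perm.mul_apply, ← map_mul, ← fatten_mul,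
      ← Equiv.Perm.mul_apply, ← map_mul]
    simp [fatten_one]

/-- The product of the entries of a sequence acted on by a cabled braid. -/
theorem prod_seqAct_cabling {m n : ℕ} (i : Fin m) (γ : BraidGroup m) (ρ : BraidGroup n)
    (w : ℕ → FreeMonoid X) :
    ((List.range (m + n - 1)).map (R.words.seqAct (m + n - 1) (cabling i γ ρ) w)).prod =
      ((List.range m).map (R.words.seqAct m γ (Function.update (merge n i w) i
        ((List.range n).map (R.words.seqAct n ρ fun t => w (i + t))).prod))).prod := by
  rw [cabling, map_mul, Equiv.Perm.mul_apply, ← prod_merge (toPerm m γ i).2,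
    R.merge_seqAct_fatten]
  congr 3
  funext x
  rcases lt_trichotomy x i with hx | rfl | hx
  · rw [merge_of_lt _ x hx, seqAct_insertAt_of_lt _ _ _ _ hx, Function.update_of_ne (by omega),
      merge_of_lt _ x hx]
  · rw [merge_self, Function.update_self, ← seqAct_insertAt]
  · rw [merge_of_gt _ x hx, Function.update_of_ne (by omega), merge_of_gt _ x hx]
    by_cases hn : n = 0
    · subst hn
      have := braidGroup_subsingleton (n := 0) (by omega)
      rw [Subsingleton.elim ρ 1]
      simp
    have h1 := congrFun (R.words.seqAct_insertAt i ρ w) (x + n - 1 - i)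
    rw [R.words.seqAct_of_le ρ _ (by omega)] at h1
    rw [show x + n - 1 = i + (x + n - 1 - i) by omega]
    exact h1

end AugRack

/-! ### Operadic composition at finite levels -/

section Cabling

variable {k : Type*} [Field k] {m n : ℕ}

namespace WordAlg

variable {G X : Type*} [Group G] [MulAction G X] {R : AugRack G X}

theorem mulMap_wordTensor (w : ℕ → FreeMonoid X) :
    mulMap k (WordAlg k R) n (wordTensor k R n w) = word k R ((List.range n).map w).prod := by
  rw [wordTensor, mulMap_tprod, map_list_prod, List.map_map, ← List.map_coe_finRange_eq_range,
    List.map_map, List.ofFn_eq_map]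
  rfl

/-- The operadic composition of two operations, evaluated on letters. -/
theorem mulMap_cabling (i : Fin m) (γ : BraidGroup m) (ρ : BraidGroup n) (s : ℕ → X) :
    mulMap k _ (m + n - 1) ((hopf k R).action (m + n - 1) (cabling i γ ρ)
        (letterTensor k R (m + n - 1) s)) =
      mulMap k _ m ((hopf k R).action m γ (PiTensorProduct.tprod k (Function.update
        (fun j : Fin m => word k R (merge n i (FreeMonoid.of ∘ s) j)) i
        (mulMap k _ n ((hopf k R).action n ρ (letterTensor k R n fun t => s (i + t))))))) := by
  have h : letterTensor k R n (fun t => s (i + t)) =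
    wordTensor k R n fun t => (FreeMonoid.of ∘ s) (i + t) := rfl
  rw [h, letterTensor, action_wordTensor, action_wordTensor, mulMap_wordTensor, mulMap_wordTensor,
    R.prod_seqAct_cabling, ← mulMap_wordTensor, ← action_wordTensor, wordTensor]
  congr 3
  funext j
  rw [Function.update_apply, Function.update_apply]
  by_cases hj : j = i
  · rw [if_pos hj, if_pos (congrArg _ hj)]
  · rw [if_neg hj, if_neg fun h => hj (Fin.ext h)]

end WordAlg

section comp

variable {i : Fin m} {P : FinQuot m} {Q : FinQuot n} {L : FinQuot (m + n - 1)}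
  (h : CablingDescends i P Q L)

theorem comp_add_left (x x' : BrAssLevel k m P) (y : BrAssLevel k n Q) :
    comp i h (x + x') y = comp i h x y + comp i h x' y := by
  classical
  simp only [comp, MonoidAlgebra.coeff_add]
  rw [Finsupp.sum_add_index']
  · simp
  · simp [add_mul, Finsupp.sum_add]

theorem comp_smul_left (c : k) (x : BrAssLevel k m P) (y : BrAssLevel k n Q) :
    comp i h (c • x) y = c • comp i h x y := by
  simp only [comp, MonoidAlgebra.coeff_smul]
  rw [Finsupp.sum_smul_index' (by simp), Finsupp.smul_sum]
  simp only [Finsupp.smul_sum, MonoidAlgebra.smul_single, smul_eq_mul, mul_assoc]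

theorem comp_add_right (x : BrAssLevel k m P) (y y' : BrAssLevel k n Q) :
    comp i h x (y + y') = comp i h x y + comp i h x y' := by
  classical
  simp only [comp, MonoidAlgebra.coeff_add]
  rw [← Finsupp.sum_add]
  congr 1
  funext g a
  rw [Finsupp.sum_add_index']
  · simp
  · simp [mul_add]

theorem comp_smul_right (c : k) (x : BrAssLevel k m P) (y : BrAssLevel k n Q) :
    comp i h x (c • y) = c • comp i h x y := by
  simp only [comp, MonoidAlgebra.coeff_smul]
  rw [Finsupp.smul_sum]
  congr 1
  funext g a
  rw [Finsupp.sum_smul_index' (by simp), Finsupp.smul_sum]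
  simp only [MonoidAlgebra.smul_single, smul_eq_mul, mul_left_comm]

theorem comp_of (γ : BraidGroup m) (ρ : BraidGroup n) :
    comp i h (toLevel k P (MonoidAlgebra.of k _ γ)) (toLevel k Q (MonoidAlgebra.of k _ ρ)) =
      toLevel k L (MonoidAlgebra.of k _ (cabling i γ ρ)) := by
  rw [toLevel_of, toLevel_of, toLevel_of]
  simp only [comp, MonoidAlgebra.of_apply, MonoidAlgebra.coeff_single]
  rw [Finsupp.sum_single_index (by simp), Finsupp.sum_single_index (by simp), mul_one]
  rfl

open WordAlg in
/-- The composition of two operations is represented by an element of the group algebra which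
acts on letters as the composition. -/
theorem exists_comp_toLevel {G X : Type*} [Group G] [MulAction G X] (R : AugRack G X)
    (s : ℕ → X) (x : MonoidAlgebra k (BraidGroup m)) (y : MonoidAlgebra k (BraidGroup n)) :
    ∃ z, comp i h (toLevel k P x) (toLevel k Q y) = toLevel k L z ∧
      mulMap k _ (m + n - 1) ((hopf k R).actLin (m + n - 1) z
          (letterTensor k R (m + n - 1) s)) =
        mulMap k _ m ((hopf k R).actLin m x (PiTensorProduct.tprod k (Function.update
          (fun j : Fin m => word k R (merge n i (FreeMonoid.of ∘ s) j)) i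
          (mulMap k _ n ((hopf k R).actLin n y (letterTensor k R n fun t => s (i + t))))))) := by
  induction x using MonoidAlgebra.induction_on with
  | of γ =>
    induction y using MonoidAlgebra.induction_on with
    | of ρ =>
      refine ⟨_, comp_of h γ ρ, ?_⟩
      simp only [Braiding.actLin_of]
      exact mulMap_cabling i γ ρ s
    | add y y' hy hy' =>
      obtain ⟨z, h1, h2⟩ := hy
      obtain ⟨z', h1', h2'⟩ := hy'
      refine ⟨z + z', ?_, ?_⟩
      · rw [map_add, map_add, comp_add_right, h1, h1']
      · simp only [map_add, LinearMap.add_apply, MultilinearMap.map_update_add, h2, h2']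
    | smul r y hy =>
      obtain ⟨z, h1, h2⟩ := hy
      refine ⟨r • z, ?_, ?_⟩
      · rw [map_smul, map_smul, comp_smul_right, h1]
      · simp only [map_smul, LinearMap.smul_apply, MultilinearMap.map_update_smul, h2]
  | add x x' hx hx' =>
    obtain ⟨z, h1, h2⟩ := hx
    obtain ⟨z', h1', h2'⟩ := hx'
    refine ⟨z + z', ?_, ?_⟩
    · rw [map_add, map_add, comp_add_left, h1, h1']
    · simp only [map_add, LinearMap.add_apply, h2, h2']
  | smul r x hx =>
    obtain ⟨z, h1, h2⟩ := hx
    refine ⟨r • z, ?_, ?_⟩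
    · rw [map_smul, map_smul, comp_smul_left, h1]
    · simp only [map_smul, LinearMap.smul_apply, h2]

end comp

theorem CablingDescends.mono {i : Fin m} {P P' : FinQuot m} {Q Q' : FinQuot n}
    {L : FinQuot (m + n - 1)} (h : CablingDescends i P Q L) (hP : P' ≤ P) (hQ : Q' ≤ Q) :
    CablingDescends i P' Q' L :=
  fun γ γ' ρ ρ' h1 h2 => h γ γ' ρ ρ' (hP h1) (hQ h2)

open WordAlg in
/-- Every operadic composition restricts to the primitive operations. -/
theorem exists_comp_mem_brPrimStar (i : Fin m) (L : FinQuot (m + n - 1)) :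
    ∃ (P₀ : FinQuot m) (Q₀ : FinQuot n), ∀ P ≤ P₀, ∀ Q ≤ Q₀, ∃ h : CablingDescends i P Q L,
      ∀ x ∈ brPrimStar k m P, ∀ y ∈ brPrimStar k n Q,
        comp i h x y ∈ brPrimStar k (m + n - 1) L := by
  have hi := i.2
  obtain ⟨P₁, Q₁, h₁⟩ := exists_cablingDescends i L
  rcases Nat.eq_zero_or_pos n with rfl | hn
  -- Arity `0` is treated apart: there `y = 0`, while `m + n - 1` could be `0`, which the detection
  -- criterion excludes.
  · refine ⟨P₁, Q₁, fun P hP Q hQ => ⟨h₁.mono hP hQ, fun x _ y hy => ?_⟩⟩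
    rw [brPrimStar_zero, Submodule.mem_bot] at hy
    have := comp_smul_right (h₁.mono hP hQ) 0 x y
    rw [zero_smul, zero_smul] at this
    rw [hy, this]
    exact Submodule.zero_mem _
  obtain ⟨G, _, t, hH, hs, -⟩ := exists_detecting_wordAlg.{0} k (m + n - 1) L
  -- The subgroups are shrunk until both operations act on the algebra that detects level `L`.
  refine ⟨P₁ ⊓ actionKernel (hopf k (Strand.rack t)).toBraiding hH m,
    Q₁ ⊓ actionKernel (hopf k (Strand.rack t)).toBraiding hH n, fun P hP Q hQ =>
    ⟨h₁.mono (hP.trans inf_le_left) (hQ.trans inf_le_left), fun x hx y hy => ?_⟩⟩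
  obtain ⟨x, rfl⟩ := toLevel_surjective P x
  obtain ⟨y, rfl⟩ := toLevel_surjective Q y
  obtain ⟨z, h1, h2⟩ := exists_comp_toLevel (h₁.mono (hP.trans inf_le_left)
    (hQ.trans inf_le_left)) (Strand.rack t) (Strand.base G) x y
  rw [h1]
  refine mem_brPrimStar_of_isPrimitive hs hH (by omega) ?_
  rw [h2]
  -- The arguments of the outer operation are letters, except that argument `i` is the value of the
  -- inner operation on letters; all are primitive.
  refine (hopf k _).isPrimitive_of_mem hH (hP.trans inf_le_right) hx fun j => ?_
  rw [Function.update_apply]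
  split_ifs with hj
  · exact (hopf k _).isPrimitive_of_mem hH (hQ.trans inf_le_right) hy fun j => isPrimitive_of _
  · rcases lt_or_gt_of_ne (fun h => hj (Fin.ext h) : (j : ℕ) ≠ i) with h | h
    · rw [merge_of_lt _ _ h]; exact isPrimitive_of _
    · rw [merge_of_gt _ _ h]; exact isPrimitive_of _

end Cabling

/-! ## Strictness -/

section Strict

variable {k : Type*} [Field k] {n : ℕ}

theorem transition_mem_brPrimStar {N N' : FinQuot n} (h : N ≤ N') {x : BrAssLevel k n N}
    (hx : x ∈ brPrimStar k n N) : transition k h x ∈ brPrimStar k n N' := by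
  rcases lt_trichotomy n 1 with hn | rfl | hn
  · obtain rfl : n = 0 := by omega
    rw [brPrimStar_zero, Submodule.mem_bot] at hx ⊢
    rw [hx, map_zero]
  · rw [brPrimStar_one]; trivial
  · rw [brPrimStar_of_lt hn, mem_brPrim hn] at hx ⊢
    intro p hp
    rw [← transition_toLevel h, ← map_mul, hx p hp, map_zero]

/-- Kernels of left multiplications are right ideals. -/
theorem mul_mem_brPrimStar {N : FinQuot n} {x : BrAssLevel k n N} (hx : x ∈ brPrimStar k n N)
    (y : BrAssLevel k n N) : x * y ∈ brPrimStar k n N := by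
  rcases lt_trichotomy n 1 with hn | rfl | hn
  · obtain rfl : n = 0 := by omega
    rw [brPrimStar_zero, Submodule.mem_bot] at hx ⊢
    rw [hx, zero_mul]
  · rw [brPrimStar_one]; trivial
  · rw [brPrimStar_of_lt hn, mem_brPrim hn] at hx ⊢
    intro p hp
    rw [← mul_assoc, hx p hp, zero_mul]

/-- Averaging over the fibres of a surjection of finite groups. -/
theorem exists_transition_eq_one [CharZero k] {N N' : FinQuot n} (h : N ≤ N') :
    ∃ e : BrAssLevel k n N, transition k h e = 1 ∧
      ∀ u : BrAssLevel k n N, transition k h u = 0 → u * e = 0 := by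
  classical
  let f : BraidGroup n ⧸ N.toSubgroup →* BraidGroup n ⧸ N'.toSubgroup :=
    QuotientGroup.map _ _ (MonoidHom.id _) h
  have hf : ∀ g, transition k h (MonoidAlgebra.of k _ g) = MonoidAlgebra.of k _ (f g) := by
    intro g
    simp [transition, f]
  have : Finite (BraidGroup n ⧸ N.toSubgroup) := Subgroup.finite_quotient_of_finiteIndex
  have := Fintype.ofFinite f.ker
  -- Characteristic zero makes the average over the kernel possible.
  have hcard : (Fintype.card f.ker : k) ≠ 0 := Nat.cast_ne_zero.2 Fintype.card_ne_zero
  let e : BrAssLevel k n N := (Fintype.card f.ker : k)⁻¹ • ∑ g : f.ker, MonoidAlgebra.of k _ g.1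
  have he : ∀ g ∈ f.ker, MonoidAlgebra.of k _ g * e = e := by
    intro g hg
    simp only [e, mul_smul_comm, Finset.mul_sum, ← map_mul]
    congr 1
    exact Fintype.sum_equiv (Equiv.mulLeft (⟨g, hg⟩ : f.ker)) _ _ fun _ => rfl
  have hlift : ∀ q, ∃ g, f g = q := by
    intro q
    obtain ⟨β, rfl⟩ := QuotientGroup.mk_surjective q
    exact ⟨β, rfl⟩
  choose r hr using hlift
  -- Right multiplication by `e` depends only on the image in `k[B_n / N']`, because `e` absorbs
  -- `f.ker`. Factoring it through the transition map makes the vanishing on the kernel immediate.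
  let S : BrAssLevel k n N' →ₗ[k] BrAssLevel k n N :=
    (Finsupp.lift _ k _ fun q => MonoidAlgebra.of k _ (r q) * e) ∘ₗ
      (MonoidAlgebra.coeffLinearEquiv k).toLinearMap
  have hS : ∀ u, S (transition k h u) = u * e := by
    intro u
    induction u using MonoidAlgebra.induction_on with
    | of g =>
      rw [hf]
      have : S (MonoidAlgebra.of k _ (f g)) = MonoidAlgebra.of k _ (r (f g)) * e := by
        simp [S]
      have hg : g⁻¹ * r (f g) ∈ f.ker := by
        rw [MonoidHom.mem_ker, map_mul, map_inv, hr, inv_mul_cancel]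
      rw [this]
      nth_rw 2 [← he _ hg]
      rw [← mul_assoc, ← map_mul, mul_inv_cancel_left]
    | add x y hx hy => simp only [map_add, hx, hy, add_mul]
    | smul c x hx => simp only [map_smul, hx, smul_mul_assoc]
  refine ⟨e, ?_, fun u hu => ?_⟩
  · simp only [e, map_smul, map_sum, hf]
    rw [Finset.sum_congr rfl fun g _ => by rw [MonoidHom.mem_ker.1 g.2, map_one]]
    simp [hcard, ← Nat.cast_smul_eq_nsmul k, smul_smul]
  · rw [← hS, hu, map_zero]

theorem map_transition_brPrimStar [CharZero k] {N N' : FinQuot n} (h : N ≤ N') :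
    (brPrimStar k n N).map (transition k h).toLinearMap = brPrimStar k n N' := by
  apply le_antisymm
  · rintro _ ⟨x, hx, rfl⟩
    exact transition_mem_brPrimStar h hx
  · intro x hx
    obtain ⟨z, rfl⟩ := toLevel_surjective N' x
    rcases lt_trichotomy n 1 with hn | rfl | hn
    · obtain rfl : n = 0 := by omega
      rw [brPrimStar_zero, Submodule.mem_bot] at hx
      rw [hx]
      exact Submodule.zero_mem _
    · exact ⟨toLevel k N z, by rw [brPrimStar_one]; trivial, transition_toLevel h z⟩
    · obtain ⟨e, he, he0⟩ := exists_transition_eq_one (k := k) h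
      -- An arbitrary lift satisfies the equations only modulo the kernel of the transition map; the
      -- factor `e` removes that error without changing the image.
      refine ⟨toLevel k N z * e, ?_, ?_⟩
      · rw [brPrimStar_of_lt hn, mem_brPrim hn] at hx
        rw [SetLike.mem_coe, brPrimStar_of_lt hn, mem_brPrim hn]
        intro p hp
        rw [← mul_assoc, ← map_mul]
        refine he0 _ ?_
        rw [transition_toLevel, map_mul, hx p hp]
      · change transition k h _ = _
        rw [map_mul, he, mul_one, transition_toLevel]

end Strict

end BraidedPrimitive

theorem mainTheorem7 (k : Type u) [Field k] [CharZero k] :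
    (∀ (n : ℕ) (α : BrAssHat k n),
      α ∈ (brPrimStar k).elements n ↔
        ∀ (A : Type (max u v)) [Ring A] [Algebra k A] [Coalgebra k A]
          (H : BraidedHopfAlgebra k A) (hH : H.FinitelyBraided) (a : Fin n → A),
          (∀ i, IsPrimitive k (a i)) → IsPrimitive k (evaluate H.toBraiding hH α a)) ∧
    IsSuboperad (brPrimStar k) ∧ IsReducedSeq (brPrimStar k) ∧ IsUnitalSeq (brPrimStar k) ∧
      IsStrictSeq (brPrimStar k) :=
  ⟨mem_elements_brPrimStar_iff.{u, v} k,
    ⟨fun _ _ _ h _ => transition_mem_brPrimStar h, fun _ _ _ _ hx => mul_mem_brPrimStar hx _,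
      fun _ _ => exists_comp_mem_brPrimStar⟩,
    brPrimStar_zero, fun N => by rw [brPrimStar_one]; trivial,
    fun _ _ _ => map_transition_brPrimStar⟩
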